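/- Let $(\mathcal S,\mathcal A,P)$ be a probability space with expectation $E$ and let $\{c(t,x):t\in\mathbb R_+,x\in\mathbb R\}$ be a (jointly measurable) stationary random field on it, uniformly bounded, with $E\,c(t,x)=0$. For $A\subset\mathbb R_+\times\mathbb R$ let $\mathcal F_A=\sigma\{c(t,x):(t,x)\in A\}$, and $$\alpha_{\rm um}(r)=\sup_{\mathrm{dist}(A_1,A_2)\ge r}\ \sup_{S_1\in\mathcal F_{A_1},\,S_2\in\mathcal F_{A_2},\,P(S_2)\ne0}|P(S_1|S_2)-P(S_1)| .$$ Assume $(H_{\rm um})$: there are $C,\delta>0$ with $\alpha_{\rm um}(r)\le C(1+r)^{-(2+\delta)}$ for all $r\ge0$. Put $\Phi(t,x)=E[c(s,y)\,c(s+t,y+x)]$ (independent of $(s,y)$ by stationarity). Let $0<2\beta<\alpha$ (after rescaling $\varepsilon$ one may take $\alpha=1$, $0<\beta<1/2$), let $g\in L^2(\mathbb R)\cap C(\mathbb R)$, and for $\varepsilon>0$ let $u^\varepsilon$ be the solution of $$\partial_t u^\varepsilon(t,x)=\tfrac12\partial_{xx}u^\varepsilon(t,x)+\varepsilon^{-\alpha/2}\,c\!\left(\tfrac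 t{\varepsilon^\alpha},\tfrac x{\varepsilon^\beta}\right)u^\varepsilon(t,x),\qquad u^\varepsilon(0,x)=g(x),$$ understood $P$-almost surely in the mild (Duhamel) sense, with $u^\varepsilon$ continuous on $[0,\infty)\times\mathbb R$ and $\|u^\varepsilon(t,\cdot)\|_{L^2(\mathbb R)}$ bounded on bounded time intervals. Let $B$ be a standard Brownian motion on a probability space $(\Omega,\mathcal F,\mathbb P)$ with expectation $\mathbb E$. Then $\Phi(\cdot,0)$ is integrable on $(0,\infty)$ and, with $$\Sigma'=\int_0^\infty\Phi(r,0)\,dr,\qquad u(t,x)=\mathbb E[g(x+B_t)]\exp(t\Sigma'),$$ one has $g(x+B_t)\in L^1(\mathbb P)$ and, for every $t\ge0$ and $x\in\mathbb R$, $u^\varepsilon(t,x)\in L^2(P)$ and $$E\big[(u^\varepsilon(t,x)-u(t,x))^2\big]\longrightarrow0\qquad(\varepsilon\to0).$$ The same holds with $u^\varepsilon(t,x)$ replaced by the Feynman–Kac functional $$\mathbb E\Big[g(x+B_t)\exp\Big(\varepsilon^{-\alpha/2}\int_0^t c\big(\tfrac s{\varepsilon^\alpha},\tfrac{x+B_s}{\varepsilon^\beta}\big)ds\Big)\Big].$$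 Moreover $u$ is continuous on $[0,\infty)\times\mathbb R$ and is a classical solution of $$\partial_t u=\tfrac12\partial_{xx}u+\Sigma' u\quad(t>0,\ x\in\mathbb R),\qquad u(0,x)=g(x).$$ -/

import Mathlib

open MeasureTheory ProbabilityTheory Filter Set
open scoped NNReal ENNReal Topology

noncomputable section

/-- A random field on the half plane `ℝ₊ × ℝ` (time, space) is (strictly) stationary: its law as a
process is invariant under every translation that maps the half plane into itself. -/
def IsStationaryField {S : Type*} [MeasurableSpace S] (c : ℝ≥0 → ℝ → S → ℝ) (P : Measure S) :
    Prop :=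
  ∀ (h : ℝ≥0) (k : ℝ),
    P.map (fun s (p : ℝ≥0 × ℝ) => c (p.1 + h) (p.2 + k) s) =
      P.map (fun s (p : ℝ≥0 × ℝ) => c p.1 p.2 s)

/-- The sigma-algebra generated by the variables `c t x` with `(t, x) ∈ A`. -/
@[reducible] def fieldSigma {S : Type*} (c : ℝ≥0 → ℝ → S → ℝ) (A : Set (ℝ≥0 × ℝ)) : MeasurableSpace S :=
  ⨆ p ∈ A, MeasurableSpace.comap (c p.1 p.2) inferInstance

/-- The Euclidean distance in the half plane (the product metric of Mathlib is the sup metric). -/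
def planeDist (p q : ℝ≥0 × ℝ) : ℝ :=
  √(((p.1 : ℝ) - (q.1 : ℝ)) ^ 2 + (p.2 - q.2) ^ 2)

/-- The uniform mixing coefficient at distance `r`: the supremum of `|P(S₁ | S₂) - P(S₁)|` over
events `S₁`, `S₂` that depend on the field in sets `A₁`, `A₂` at distance at least `r`, with
`P(S₂) ≠ 0`. The set of these numbers is nonempty and bounded by `1`. -/
def uniformMixingCoeff {S : Type*} [MeasurableSpace S] (c : ℝ≥0 → ℝ → S → ℝ) (P : Measure S)
    (r : ℝ) : ℝ :=
  sSup {a : ℝ | ∃ A₁ A₂ : Set (ℝ≥0 × ℝ), (∀ p ∈ A₁, ∀ q ∈ A₂, r ≤ planeDist p q) ∧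
    ∃ S₁ S₂ : Set S, MeasurableSet[fieldSigma c A₁] S₁ ∧ MeasurableSet[fieldSigma c A₂] S₂ ∧
      P S₂ ≠ 0 ∧ a = |(ProbabilityTheory.cond P S₂).real S₁ - P.real S₁|}

/-- The mixing condition: the uniform mixing coefficient is at most `C (1 + r) ^ (-(2 + δ))` for
some constants `C` and `δ > 0`. -/
def MixingUm {S : Type*} [MeasurableSpace S] (c : ℝ≥0 → ℝ → S → ℝ) (P : Measure S) : Prop :=
  ∃ C δ : ℝ, 0 < δ ∧ ∀ r : ℝ, 0 ≤ r → uniformMixingCoeff c P r ≤ C * (1 + r) ^ (-(2 + δ))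

/-- The correlation function `Φ(t, x) = E[c(0, 0) c(t, x)]`. For a stationary field this is
`E[c(s, y) c(s + t, y + x)]` for every `(s, y)`. -/
def fieldCorrelation {S : Type*} [MeasurableSpace S] (c : ℝ≥0 → ℝ → S → ℝ) (P : Measure S)
    (t : ℝ≥0) (x : ℝ) : ℝ :=
  ∫ s, c 0 0 s * c t x s ∂P

/-- The rescaled potential `ε ^ (-γ) c(t / ε ^ α, x / ε ^ β)` for a realization `c` of the field. -/
def rescaledPotential (α β γ ε : ℝ) (c : ℝ≥0 → ℝ → ℝ) (t x : ℝ) : ℝ :=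
  ε ^ (-γ) * c (t / ε ^ α).toNNReal (x / ε ^ β)

/-- The heat kernel of `∂ₜ - (1/2) ∂ₓₓ`. -/
def heatKernel (t z : ℝ) : ℝ :=
  (√(2 * Real.pi * t))⁻¹ * Real.exp (-z ^ 2 / (2 * t))

/-- `u` is the (mild) solution of `∂ₜ u = (1/2) ∂ₓₓ u + V u` on `t ≥ 0`, `u(0, ·) = g`, in the class
of functions that are continuous on `[0, ∞) × ℝ` and whose spatial `L²` norms are bounded on
bounded time intervals. -/
structure IsMildSolution (V : ℝ → ℝ → ℝ) (g : ℝ → ℝ) (u : ℝ → ℝ → ℝ) : Prop where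
  continuousOn : ContinuousOn (fun p : ℝ × ℝ => u p.1 p.2) (Ici 0 ×ˢ univ)
  bounded : ∀ T : ℝ, ∃ K : ℝ≥0, ∀ t ∈ Icc 0 T, eLpNorm (u t) 2 volume ≤ K
  initial : ∀ x, u 0 x = g x
  duhamel : ∀ t : ℝ, 0 < t → ∀ x : ℝ,
    u t x = (∫ y, heatKernel t (x - y) * g y) +
      ∫ s in (0 : ℝ)..t, ∫ y, heatKernel (t - s) (x - y) * (V s y * u s y)

/-- The Feynman-Kac functional `𝔼[g(x + B_t) exp(∫₀ᵗ V(s, x + B_s) ds)]`. -/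
def feynmanKac {Ω : Type*} [MeasurableSpace Ω] (B : ℝ≥0 → Ω → ℝ) (Q : Measure Ω)
    (V : ℝ → ℝ → ℝ) (g : ℝ → ℝ) (t x : ℝ) : ℝ :=
  ∫ ω, g (x + B t.toNNReal ω) *
    Real.exp (∫ s in (0 : ℝ)..t, V s (x + B s.toNNReal ω)) ∂Q

/-- `u` is a classical solution of `∂ₜ u = (1/2) ∂ₓₓ u + σ u` for `t > 0`, continuous up to `t = 0`,
with `u(0, ·) = g`. -/
structure IsClassicalHeatSolution (σ : ℝ) (g : ℝ → ℝ) (u : ℝ → ℝ → ℝ) : Prop where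
  continuousOn : ContinuousOn (fun p : ℝ × ℝ => u p.1 p.2) (Ici 0 ×ˢ univ)
  initial : ∀ x, u 0 x = g x
  differentiable_time : ∀ t : ℝ, 0 < t → ∀ x : ℝ, DifferentiableAt ℝ (fun r => u r x) t
  contDiff_space : ∀ t : ℝ, 0 < t → ContDiff ℝ 2 (u t)
  equation : ∀ t : ℝ, 0 < t → ∀ x : ℝ,
    deriv (fun r => u r x) t = 1 / 2 * iteratedDeriv 2 (u t) x + σ * u t x

end

/-! The proof is a second moment computation over two independent Brownian paths. The Feynman–Kac
formula (`IsDuhamelSolution.eq_integral_exp`) writes `u^ε(t,x)` as the Brownian mean of a weight `w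
= g(x + B_t)` times `exp A`, where `A` is the action of the rescaled field along a time-reversed
path. With `κ = tΣ'`, the quantity `E[(u^ε - u)²]` is then an integral over pairs of paths of `w w'
E[(e^A - e^κ)(e^{A'} - e^κ)]` (`integral_sq_sub_eq`). So it suffices that `E exp(aA + bA')` tends to
`exp((a² + b²)κ)` in mean over the pair of paths, boundedly, for `(a,b) = (1,1), (1,0), (0,1)`.

For frozen paths, put `Λ = ε^(-α/2)`. Then `aA + bA'` is `Λ⁻¹ ∫₀^{Λ²t} ξ`, where `ξ` is a bounded
centered process which is uniformly mixing in time, whatever the paths are. Let `Z` be its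
exponential moment as a function of the upper limit. To compute the logarithmic derivative of `Z` at
a microscopic time, one freezes the exponential a lag `h` earlier and expands to second order.
Centering removes the first term, the second is a covariance integrated over lags up to `h`, and the
third is a remainder (`abs_integral_mul_exp_sub_truncatedCovariance_le`). Uniform mixing is
essential here: its covariance inequality carries the `L¹` norm of the conditioning variable, so
every error is relative to `Z`. In total the logarithm is off by `Λφ(h) + hφ(h/2) + h²/Λ` up to
constants, uniformly in the paths. A mixing exponent larger than 2 permits a choice of `h` that
makes all of this vanish.

It remains to find the limit of the covariances along the paths
(`tendsto_lintegral_pathCovariance_sub`). At a fixed microscopic lag `ρ` a path moves by about `√ρ /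
Λ`, which is small against `ε^β` since `2β < α`; hence the diagonal terms converge to `Φ(ρ,0)`. Two
independent paths almost surely differ at a fixed interior time, so on the scale `ε^β` they are
infinitely far apart and mixing in space removes the cross terms. Continuity of `Φ(ρ,·)` at zero
needs no regularity of the field: stationarity and the continuity of translations in `L¹` give it
(`tendsto_meanIncrement`). The mixing rate dominates the integral over lags.

The Feynman–Kac formula itself is obtained without stochastic calculus, from Duhamel's formula, the
Markov property and Fubini's theorem. The limit equation follows by differentiating the heat kernel
under the integral; only continuity at time zero for an unbounded `g` needs a separate argument. -/

/-- Uniform mixing of two sigma-algebras with coefficient `φ`. -/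
def UniformMixing {S : Type*} [MeasurableSpace S] (P : Measure S) (m₁ m₂ : MeasurableSpace S)
    (φ : ℝ) : Prop :=
  ∀ S₁ S₂ : Set S, MeasurableSet[m₁] S₁ → MeasurableSet[m₂] S₂ →
    |P.real (S₁ ∩ S₂) - P.real S₁ * P.real S₂| ≤ φ * P.real S₂

/-- The layer-cake formula in `ℝ≥0∞` bounds the integral of the tail. Integrability is needed so
that layer-cake integrals can be subtracted from one another. -/
lemma integrableOn_real_meas_lt {S : Type*} [MeasurableSpace S] {P : Measure S} {g : S → ℝ} (hg : Integrable g P) (hg0 : 0 ≤ᵐ[P] g) :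
    IntegrableOn (fun t => P.real {a | t < g a}) (Ioi 0) := by
  have key := lintegral_eq_lintegral_meas_lt P hg0 hg.aemeasurable
  have hm : Measurable (fun t : ℝ => P {a | t < g a}) :=
    Antitone.measurable fun s t hst => measure_mono fun a ha => lt_of_le_of_lt hst ha
  refine ⟨hm.ennreal_toReal.aestronglyMeasurable, ?_⟩
  have h1 : ∫⁻ t in Ioi (0 : ℝ), P {a | t < g a} < ∞ := by
    rw [← key]; exact hg.lintegral_lt_top
  refine lt_of_le_of_lt (lintegral_mono fun t => ?_) h1
  rw [Real.enorm_eq_ofReal measureReal_nonneg, measureReal_def]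
  exact ENNReal.ofReal_toReal_le

/-! ### Covariance inequalities under uniform mixing -/

section Mixing

variable {S : Type*} {m₁ m₂ : MeasurableSpace S} [mS : MeasurableSpace S] {P : Measure S}
  [IsProbabilityMeasure P] {φ : ℝ}

/-- The mixing inequality holds for `A` and each level set of `g`, with an error proportional to the
measure of that level set. The layer-cake formula integrates it over the levels and gives an error
proportional to the mean of `g`. -/
lemma UniformMixing.abs_setIntegral_sub_le (h : UniformMixing P m₁ m₂ φ) (hm₁ : m₁ ≤ mS)
    (hm₂ : m₂ ≤ mS) {A : Set S} (hA : MeasurableSet[m₁] A) {g : S → ℝ} (hg : Measurable[m₂] g)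
    (hgi : Integrable g P) (hg0 : ∀ s, 0 ≤ g s) :
    |(∫ s in A, g s ∂P) - P.real A * ∫ s, g s ∂P| ≤ φ * ∫ s, g s ∂P := by
  have hAm : MeasurableSet A := hm₁ _ hA
  have hgm : Measurable g := hg.mono hm₂ le_rfl
  rw [Integrable.integral_eq_integral_meas_lt hgi (ae_of_all _ hg0),
    Integrable.integral_eq_integral_meas_lt hgi.restrict (ae_of_all _ hg0),
    ← integral_const_mul, ← integral_const_mul]
  have hi := integrableOn_real_meas_lt hgi (ae_of_all _ hg0)
  have hi' : IntegrableOn (fun t => (P.restrict A).real {a | t < g a}) (Ioi 0) := by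
    refine Integrable.mono' hi ?_ (ae_of_all _ fun t => ?_)
    · have : Measurable (fun t : ℝ => P.restrict A {a | t < g a}) :=
        Antitone.measurable fun s t hst => measure_mono fun a ha => lt_of_le_of_lt hst ha
      exact this.ennreal_toReal.aestronglyMeasurable
    · rw [Real.norm_of_nonneg measureReal_nonneg]
      exact ENNReal.toReal_mono (measure_ne_top _ _) (Measure.restrict_apply_le _ _)
  rw [← integral_sub hi' (hi.const_mul _), ← Real.norm_eq_abs]
  refine norm_integral_le_of_norm_le (hi.const_mul _) (ae_of_all _ fun t => ?_)
  have hs : MeasurableSet[m₂] {a | t < g a} := hg measurableSet_Ioi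
  have := h A {a | t < g a} hA hs
  rwa [Real.norm_eq_abs, measureReal_restrict_apply (hm₂ _ hs), inter_comm]

/-- Here the layer-cake formula is applied to `f`, shifted to take values in `[0, 2M]`. Each level
contributes at most `φ ∫ g` by `abs_setIntegral_sub_le`, and the levels fill an interval of length
`2M`. -/
lemma UniformMixing.abs_integral_mul_sub_le_of_nonneg (h : UniformMixing P m₁ m₂ φ) (hm₁ : m₁ ≤ mS)
    (hm₂ : m₂ ≤ mS) {f : S → ℝ} (hf : Measurable[m₁] f) {M : ℝ} (hM : ∀ s, |f s| ≤ M)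
    {g : S → ℝ} (hg : Measurable[m₂] g) (hgi : Integrable g P) (hg0 : ∀ s, 0 ≤ g s) :
    |(∫ s, f s * g s ∂P) - (∫ s, f s ∂P) * ∫ s, g s ∂P| ≤ 2 * M * φ * ∫ s, g s ∂P := by
  have hfm : Measurable f := hf.mono hm₁ le_rfl
  have hgm : Measurable g := hg.mono hm₂ le_rfl
  have hM0 : 0 ≤ M := by
    obtain ⟨s⟩ := P.nonempty_of_neZero
    exact (abs_nonneg _).trans (hM s)
  -- Integrating `f g` against `P` is integrating `f` against `ν`, so one layer-cake formula serves
  -- both terms of the covariance.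
  set ν := P.withDensity (fun s => ENNReal.ofReal (g s)) with hν
  have : IsFiniteMeasure ν := isFiniteMeasure_withDensity_ofReal hgi.2
  have hfi : Integrable f P := Integrable.of_bound hfm.aestronglyMeasurable M
    (ae_of_all _ hM)
  have hνint : ∀ k : S → ℝ, ∫ s, k s ∂ν = ∫ s, k s * g s ∂P := fun k => by
    rw [hν, integral_withDensity_eq_integral_toReal_smul (by fun_prop) (by simp)]
    simp only [ENNReal.toReal_ofReal (hg0 _), smul_eq_mul, mul_comm]
  have hνset : ∀ A, MeasurableSet A → ν.real A = ∫ s in A, g s ∂P := fun A hA => by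
    rw [measureReal_def, hν, withDensity_apply _ hA,
      integral_eq_lintegral_of_nonneg_ae (ae_of_all _ hg0) hgm.aestronglyMeasurable]
  have key : ∀ μ : Measure S, IsFiniteMeasure μ →
      ∫ s, f s + M ∂μ = ∫ t in Ioc 0 (2 * M), μ.real {a | t ≤ f a + M} := fun μ _ => by
    refine Integrable.integral_eq_integral_Ioc_meas_le
      ((Integrable.of_bound hfm.aestronglyMeasurable M (ae_of_all _ hM)).add
        (integrable_const _)) (ae_of_all _ fun s => ?_) (ae_of_all _ fun s => ?_)
    · have := neg_le_of_abs_le (hM s); simp only [Pi.zero_apply]; linarith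
    · have := le_of_abs_le (hM s); simp only; linarith
  have hI : ∀ μ : Measure S, IsFiniteMeasure μ →
      IntegrableOn (fun t => μ.real {a | t ≤ f a + M}) (Ioc 0 (2 * M)) := fun μ _ => by
    refine Integrable.of_bound (C := μ.real univ) ?_ (ae_of_all _ fun t => ?_)
    · have : Measurable (fun t : ℝ => μ {a | t ≤ f a + M}) :=
        Antitone.measurable fun s t hst => measure_mono fun a ha => le_trans hst ha
      exact this.ennreal_toReal.aestronglyMeasurable
    · rw [Real.norm_of_nonneg measureReal_nonneg]
      exact measureReal_mono (subset_univ _)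
  -- A constant added to `f` drops out of the covariance.
  have e1 : (∫ s, f s * g s ∂P) - (∫ s, f s ∂P) * ∫ s, g s ∂P =
      (∫ s, f s + M ∂ν) - (∫ s, f s + M ∂P) * ∫ s, g s ∂P := by
    rw [hνint]
    have : ∀ s, (f s + M) * g s = f s * g s + M * g s := fun s => by ring
    simp only [this]
    rw [integral_add (hgi.bdd_mul (c := M) hfm.aestronglyMeasurable (ae_of_all _ hM)) (hgi.const_mul _),
      integral_add hfi (integrable_const _), integral_const_mul]
    simp; ring
  rw [e1, key ν inferInstance, key P inferInstance, ← integral_mul_const,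
    ← integral_sub (hI ν inferInstance) ((hI P inferInstance).mul_const _), ← Real.norm_eq_abs]
  have := norm_setIntegral_le_of_norm_le_const (μ := volume) (s := Ioc 0 (2 * M))
    (f := fun t => ν.real {a | t ≤ f a + M} - P.real {a | t ≤ f a + M} * ∫ s, g s ∂P)
    (C := φ * ∫ s, g s ∂P) measure_Ioc_lt_top (fun t _ => ?_)
  · refine this.trans_eq ?_
    rw [measureReal_def, Real.volume_Ioc, ENNReal.toReal_ofReal (by linarith)]; ring
  · have hs : MeasurableSet[m₁] {a | t ≤ f a + M} :=
      (hf.add_const M) measurableSet_Ici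
    rw [hνset _ (hm₁ _ hs)]
    exact h.abs_setIntegral_sub_le hm₁ hm₂ hs hg hgi hg0

/-- The covariance inequality for uniformly mixing sigma-algebras. -/
lemma UniformMixing.abs_integral_mul_sub_le (h : UniformMixing P m₁ m₂ φ) (hm₁ : m₁ ≤ mS)
    (hm₂ : m₂ ≤ mS) {f : S → ℝ} (hf : AEStronglyMeasurable[m₁] f P) {M : ℝ} (hM : ∀ s, |f s| ≤ M)
    {g : S → ℝ} (hg : AEStronglyMeasurable[m₂] g P) (hgi : Integrable g P) :
    |(∫ s, f s * g s ∂P) - (∫ s, f s ∂P) * ∫ s, g s ∂P| ≤ 2 * M * φ * ∫ s, |g s| ∂P := by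
  obtain ⟨f₀, hf₀, hff₀⟩ := hf
  obtain ⟨g', hg', hgg'⟩ := hg
  have hM0 : 0 ≤ M := by
    obtain ⟨s⟩ := P.nonempty_of_neZero
    exact (abs_nonneg _).trans (hM s)
  -- The measurable representative need not obey the bound everywhere; truncation restores it
  -- without changing the almost sure class.
  set f' : S → ℝ := fun s => max (-M) (min M (f₀ s)) with hf'
  have hf'm : Measurable[m₁] f' := by
    have := hf₀.measurable
    exact measurable_const.max (measurable_const.min this)
  have hff' : f =ᵐ[P] f' := by
    filter_upwards [hff₀] with s hs
    have := abs_le.1 (hM s)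
    rw [hf']; simp only; rw [← hs, min_eq_right this.2, max_eq_right this.1]
  have hf'M : ∀ s, |f' s| ≤ M := fun s =>
    abs_le.2 ⟨le_max_left _ _, max_le (by linarith) (min_le_left _ _)⟩
  have hg'i : Integrable g' P := hgi.congr hgg'
  have hg'm : Measurable[m₂] g' := hg'.measurable
  have e4 : ∫ s, f s * g s ∂P = ∫ s, f' s * g' s ∂P := integral_congr_ae (hff'.mul hgg')
  have e5 : ∫ s, |g s| ∂P = ∫ s, |g' s| ∂P := integral_congr_ae (hgg'.fun_comp (fun x => |x|))
  rw [e4, e5, integral_congr_ae hff', integral_congr_ae hgg']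
  have hp := h.abs_integral_mul_sub_le_of_nonneg hm₁ hm₂ hf'm hf'M
    (g := fun s => max (g' s) 0) (hg'm.max measurable_const) hg'i.pos_part
    (fun s => le_max_right _ _)
  have hn := h.abs_integral_mul_sub_le_of_nonneg hm₁ hm₂ hf'm hf'M
    (g := fun s => max (-g' s) 0) (hg'm.neg.max measurable_const) hg'i.neg_part
    (fun s => le_max_right _ _)
  have hf'meas : AEStronglyMeasurable f' P := (hf'm.mono hm₁ le_rfl).aestronglyMeasurable
  have e0 : ∀ s, g' s = max (g' s) 0 - max (-g' s) 0 := fun s => by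
    rcases le_total 0 (g' s) with h0 | h0
    · rw [max_eq_left h0, max_eq_right (by linarith)]; ring
    · rw [max_eq_right h0, max_eq_left (by linarith)]; ring
  have e1 : ∫ s, g' s ∂P = (∫ s, max (g' s) 0 ∂P) - ∫ s, max (-g' s) 0 ∂P := by
    rw [← integral_sub hg'i.pos_part hg'i.neg_part]
    exact integral_congr_ae (ae_of_all _ e0)
  have e2 : ∫ s, |g' s| ∂P = (∫ s, max (g' s) 0 ∂P) + ∫ s, max (-g' s) 0 ∂P := by
    rw [← integral_add hg'i.pos_part hg'i.neg_part]
    refine integral_congr_ae (ae_of_all _ fun s => ?_)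
    rcases le_total 0 (g' s) with h0 | h0
    · simp only; rw [max_eq_left h0, max_eq_right (by linarith), abs_of_nonneg h0]; ring
    · simp only; rw [max_eq_right h0, max_eq_left (by linarith), abs_of_nonpos h0]; ring
  have e3 : ∫ s, f' s * g' s ∂P =
      (∫ s, f' s * max (g' s) 0 ∂P) - ∫ s, f' s * max (-g' s) 0 ∂P := by
    rw [← integral_sub (hg'i.pos_part.bdd_mul (c := M) hf'meas (ae_of_all _ hf'M))
      (hg'i.neg_part.bdd_mul (c := M) hf'meas (ae_of_all _ hf'M))]
    refine integral_congr_ae (ae_of_all _ fun s => ?_)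
    simp only
    rw [← mul_sub, ← e0]
  rw [e1, e2, e3]
  rw [abs_le] at hp hn ⊢
  constructor <;> nlinarith [hp.1, hp.2, hn.1, hn.2]

/-- A time integral of a bounded jointly measurable process whose values are measurable for a
sub-sigma-algebra is almost surely equal to a variable that is measurable for it. -/
lemma aestronglyMeasurable_intervalIntegral_of_forall (hm : m₁ ≤ mS)
    {ξ : ℝ → S → ℝ} (hξ : Measurable (Function.uncurry ξ)) {M : ℝ} (hM : ∀ r s, |ξ r s| ≤ M)
    {a b : ℝ} (hab : a ≤ b) (hmeas : ∀ r, a ≤ r → r ≤ b → AEStronglyMeasurable[m₁] (ξ r) P) :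
    AEStronglyMeasurable[m₁] (fun s => ∫ r in a..b, ξ r s) P := by
  set Y : S → ℝ := fun s => ∫ r in a..b, ξ r s with hY
  have hξ' : Measurable (fun p : S × ℝ => ξ p.2 p.1) := hξ.comp measurable_swap
  have hYm : StronglyMeasurable Y := by
    simp only [hY, intervalIntegral.integral_of_le hab]
    exact hξ'.stronglyMeasurable.integral_prod_right
  have hYb : ∀ s, |Y s| ≤ M * |b - a| := fun s => by
    rw [← Real.norm_eq_abs]
    exact intervalIntegral.norm_integral_le_of_norm_le_const fun r _ => hM r s
  have hYi : Integrable Y P := Integrable.of_bound hYm.aestronglyMeasurable _ (ae_of_all _ hYb)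
  have hcb : ∀ᵐ s ∂P, |(P[Y|m₁]) s| ≤ M * |b - a| :=
    ae_bdd_abs_condExp_of_ae_bdd_abs (ae_of_all _ hYb)
  -- The claim is that `Y` agrees almost surely with its conditional expectation, that is, `∫ W² =
  -- 0`.
  set W : S → ℝ := Y - P[Y|m₁] with hW
  have hWi : Integrable W P := hYi.sub integrable_condExp
  have hce : StronglyMeasurable[m₁] (P[Y|m₁]) := stronglyMeasurable_condExp
  have hWb : ∀ᵐ s ∂P, |W s| ≤ M * |b - a| + M * |b - a| := by
    filter_upwards [hcb] with s hs
    exact (abs_sub _ _).trans (add_le_add (hYb s) hs)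
  have orth : ∀ f : S → ℝ, AEStronglyMeasurable[m₁] f P → (∃ C, ∀ᵐ s ∂P, |f s| ≤ C) →
      ∫ s, f s * W s ∂P = 0 := by
    rintro f hf ⟨C, hC⟩
    have hfm : AEStronglyMeasurable f P := hf.mono hm
    have hfY : Integrable (f * Y) P := hYi.bdd_mul (c := C) hfm hC
    have h1 : P[f * Y|m₁] =ᵐ[P] f * P[Y|m₁] := condExp_mul_of_aestronglyMeasurable_left hf hfY hYi
    have h2 : ∫ s, (f * Y) s ∂P = ∫ s, f s * (P[Y|m₁]) s ∂P := by
      rw [← integral_condExp hm, integral_congr_ae h1]; rfl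
    have : ∀ s, f s * W s = (f * Y) s - f s * (P[Y|m₁]) s := fun s => by
      simp only [hW, Pi.sub_apply, Pi.mul_apply]; ring
    simp only [this]
    rw [integral_sub hfY (integrable_condExp.bdd_mul (c := C) hfm hC), h2, sub_self]
  have hWm : AEStronglyMeasurable W P := hWi.1
  -- Fubini needs orthogonality of `W` to each `ξ r` separately. This is why measurability at fixed
  -- times suffices and no joint measurability for the smaller sigma-algebra is required.
  have hYW : ∫ s, Y s * W s ∂P = 0 := by
    have : ∀ s, Y s * W s = ∫ r in a..b, ξ r s * W s := fun s => by
      rw [hY]; simp only [intervalIntegral.integral_mul_const]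
    simp only [this, intervalIntegral.integral_of_le hab]
    rw [integral_integral_swap]
    · rw [← intervalIntegral.integral_of_le hab]
      rw [intervalIntegral.integral_congr (g := fun _ => 0)]
      · simp
      · intro r hr
        rw [uIcc_of_le hab] at hr
        exact orth _ (hmeas r hr.1 hr.2) ⟨M, ae_of_all _ (hM r)⟩
    · have hWp : AEStronglyMeasurable (fun p : S × ℝ => W p.1)
        (P.prod (volume.restrict (Ioc a b))) := hWm.comp_fst
      refine Integrable.of_bound (C := M * (M * |b - a| + M * |b - a|))
        (hξ'.aestronglyMeasurable.mul hWp) ?_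
      have : ∀ᵐ p ∂(P.prod (volume.restrict (Ioc a b))), |W p.1| ≤ M * |b - a| + M * |b - a| :=
        Measure.quasiMeasurePreserving_fst.ae hWb
      filter_upwards [this] with p hp
      simp only [Function.uncurry, norm_mul, Real.norm_eq_abs]
      exact mul_le_mul (hM _ _) hp (abs_nonneg _) ((abs_nonneg _).trans (hM p.2 p.1))
  have hcW : ∫ s, (P[Y|m₁]) s * W s ∂P = 0 :=
    orth _ hce.aestronglyMeasurable ⟨_, hcb⟩
  have hWW : ∫ s, W s * W s ∂P = 0 := by
    have : ∀ s, W s * W s = Y s * W s - (P[Y|m₁]) s * W s := fun s => by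
      simp only [hW, Pi.sub_apply]; ring
    simp only [this]
    rw [integral_sub, hYW, hcW, sub_self]
    · exact hWi.bdd_mul (c := M * |b - a|) hYm.aestronglyMeasurable (ae_of_all _ hYb)
    · exact hWi.bdd_mul (c := M * |b - a|) integrable_condExp.1 hcb
  have hW0 : (fun s => W s * W s) =ᵐ[P] 0 := by
    rwa [integral_eq_zero_iff_of_nonneg (fun s => mul_self_nonneg _)
      (hWi.bdd_mul (c := _) hWm hWb)] at hWW
  refine ⟨P[Y|m₁], hce, ?_⟩
  filter_upwards [hW0] with s hs
  have := mul_self_eq_zero.1 hs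
  simp only [hW, Pi.sub_apply] at this
  linarith

end Mixing


/-! ### Exponentials of primitives and scalar linear equations -/

section Primitives

lemma intervalIntegrable_of_abs_le {f : ℝ → ℝ} (hf : Measurable f) {C : ℝ} (hC : ∀ r, |f r| ≤ C)
    (a b : ℝ) : IntervalIntegrable f volume a b :=
  (intervalIntegrable_const (c := C)).mono_fun hf.aestronglyMeasurable
    (ae_of_all _ fun r => (hC r).trans (le_abs_self C))

lemma ae_hasDerivAt_primitive {f : ℝ → ℝ} {a b : ℝ} (hf : IntervalIntegrable f volume a b) :
    ∀ᵐ x, x ∈ uIcc a b → HasDerivAt (fun t => ∫ r in a..t, f r) (f x) x := by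
  filter_upwards [hf.ae_hasDerivAt_integral] with x hx hxm using hx hxm a left_mem_uIcc

/-- The product rule for two primitives of integrable functions. -/
lemma primitive_mul_primitive {f g : ℝ → ℝ} {T : ℝ} (hf : IntervalIntegrable f volume 0 T)
    (hg : IntervalIntegrable g volume 0 T) (F₀ G₀ : ℝ) :
    (F₀ + ∫ r in (0 : ℝ)..T, f r) * (G₀ + ∫ r in (0 : ℝ)..T, g r) = F₀ * G₀ +
      ∫ r in (0 : ℝ)..T, (f r * (G₀ + ∫ q in (0 : ℝ)..r, g q) +
        (F₀ + ∫ q in (0 : ℝ)..r, f q) * g r) := by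
  have hF := (hf.absolutelyContinuousOnInterval_intervalIntegral (c := 0) (by simp))
  have hG := (hg.absolutelyContinuousOnInterval_intervalIntegral (c := 0) (by simp))
  have hc : ∀ c : ℝ, AbsolutelyContinuousOnInterval (fun _ : ℝ => c) 0 T := fun c =>
    (LipschitzWith.const c).lipschitzOnWith.absolutelyContinuousOnInterval
  have key := AbsolutelyContinuousOnInterval.integral_deriv_mul_eq_sub
    ((hc F₀).fun_add hF) ((hc G₀).fun_add hG)
  simp only [intervalIntegral.integral_same, add_zero] at key
  rw [← sub_eq_iff_eq_add', ← key]
  refine intervalIntegral.integral_congr_ae ?_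
  filter_upwards [ae_hasDerivAt_primitive hf, ae_hasDerivAt_primitive hg] with x hx1 hx2 hx
  have hx' := uIoc_subset_uIcc hx
  rw [((hx1 hx').const_add F₀).deriv, ((hx2 hx').const_add G₀).deriv]

/-- As `f` is only bounded and measurable, its primitive is differentiable only almost everywhere.
The exponential of the primitive is Lipschitz on the interval, hence absolutely continuous, and the
fundamental theorem still applies. -/
lemma exp_primitive {f : ℝ → ℝ} (hf : Measurable f) {C : ℝ} (hC : ∀ r, |f r| ≤ C) (T : ℝ) :
    Real.exp (∫ r in (0 : ℝ)..T, f r) =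
      1 + ∫ r in (0 : ℝ)..T, f r * Real.exp (∫ q in (0 : ℝ)..r, f q) := by
  have hC0 : 0 ≤ C := (abs_nonneg _).trans (hC 0)
  have hi := intervalIntegrable_of_abs_le hf hC
  have hb : ∀ a b, |∫ r in a..b, f r| ≤ C * |b - a| := fun a b => by
    rw [← Real.norm_eq_abs]
    exact intervalIntegral.norm_integral_le_of_norm_le_const fun r _ => hC r
  set K := Real.exp (C * |T|) with hK
  have hL : LipschitzOnWith (K * C).toNNReal (fun t => Real.exp (∫ r in (0 : ℝ)..t, f r))
      (uIcc 0 T) := by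
    refine LipschitzOnWith.of_dist_le' fun x hx y hy => ?_
    have hbd : ∀ z ∈ uIcc 0 T, |z| ≤ |T| := fun z hz => by
      have := abs_sub_left_of_mem_uIcc hz; simpa using this
    have hle : ∀ z ∈ uIcc 0 T, (∫ r in (0 : ℝ)..z, f r) ∈ Icc (-(C * |T|)) (C * |T|) :=
      fun z hz => by
        rw [mem_Icc, ← abs_le]
        refine (hb 0 z).trans ?_
        rw [sub_zero]
        exact mul_le_mul_of_nonneg_left (hbd z hz) hC0
    have h1 := Convex.norm_image_sub_le_of_norm_deriv_le (f := Real.exp) (C := K)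
      (s := Icc (-(C * |T|)) (C * |T|)) (fun z _ => Real.differentiableAt_exp)
      (fun z hz => by
        rw [Real.deriv_exp, Real.norm_of_nonneg (Real.exp_pos _).le]
        exact Real.exp_le_exp.2 hz.2) (convex_Icc _ _) (hle y hy) (hle x hx)
    rw [Real.dist_eq, Real.dist_eq]
    refine h1.trans ?_
    rw [Real.norm_eq_abs, intervalIntegral.integral_interval_sub_left (hi _ _) (hi _ _), mul_assoc]
    exact mul_le_mul_of_nonneg_left (hb y x) (Real.exp_pos _).le
  have key := hL.absolutelyContinuousOnInterval.integral_deriv_eq_sub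
  simp only [intervalIntegral.integral_same, Real.exp_zero] at key
  rw [← sub_eq_iff_eq_add', ← key]
  refine intervalIntegral.integral_congr_ae ?_
  filter_upwards [ae_hasDerivAt_primitive (hi 0 T)] with x hx1 hx
  rw [(hx1 (uIoc_subset_uIcc hx)).exp.deriv, mul_comm]

/-- A continuous solution of a scalar linear equation in integral form is an exponential. -/
lemma eq_exp_of_integral_eq {k f : ℝ → ℝ} (hk : Measurable k) {C : ℝ} (hC : ∀ r, |k r| ≤ C)
    {T : ℝ} (hT : 0 ≤ T) (hf : ContinuousOn f (Icc 0 T))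
    (h : ∀ s ∈ Icc 0 T, f s = 1 + ∫ r in (0 : ℝ)..s, k r * f r) :
    f T = Real.exp (∫ r in (0 : ℝ)..T, k r) := by
  have hE : ∀ s, Real.exp (∫ r in (0 : ℝ)..s, -k r) =
      1 + ∫ r in (0 : ℝ)..s, -k r * Real.exp (∫ q in (0 : ℝ)..r, -k q) := fun s =>
    exp_primitive hk.neg (C := C) (fun r => (abs_neg (k r)).trans_le (hC r)) s
  have hki : ∀ a b, IntervalIntegrable k volume a b := intervalIntegrable_of_abs_le hk hC
  have hkf : IntervalIntegrable (fun r => k r * f r) volume 0 T :=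
    (hki 0 T).mul_continuousOn (by rwa [uIcc_of_le hT])
  have hEc : Continuous (fun r => Real.exp (∫ q in (0 : ℝ)..r, -k q)) :=
    Real.continuous_exp.comp (intervalIntegral.continuous_primitive (fun a b => (hki a b).neg) 0)
  have hkE : IntervalIntegrable (fun r => -k r * Real.exp (∫ q in (0 : ℝ)..r, -k q)) volume 0 T :=
    (hki 0 T).neg.mul_continuousOn hEc.continuousOn
  -- The integrating factor: the product of `f` and `exp(-∫k)` has zero derivative almost
  -- everywhere, so it keeps its initial value 1.
  have key := primitive_mul_primitive hkf hkE 1 1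
  have h0 : ∫ r in (0 : ℝ)..T,
      (k r * f r * (1 + ∫ q in (0 : ℝ)..r, -k q * Real.exp (∫ p in (0 : ℝ)..q, -k p)) +
        (1 + ∫ q in (0 : ℝ)..r, k q * f q) * (-k r * Real.exp (∫ q in (0 : ℝ)..r, -k q))) = 0 := by
    refine (intervalIntegral.integral_congr (g := fun _ => 0) fun r hr => ?_).trans (by simp)
    rw [uIcc_of_le hT] at hr
    simp only
    rw [← hE r, ← h r hr]
    ring
  rw [h0, ← hE T, ← h T ⟨hT, le_rfl⟩, intervalIntegral.integral_neg, Real.exp_neg] at key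
  field_simp at key
  linarith

end Primitives


/-! ### Mixing processes in time and their covariances -/

noncomputable section

/-- A bounded centered process `ξ` on the time half line, adapted to a family `𝓖` of
sigma-algebras indexed by sets of times which is uniformly mixing with rate `φ`. -/
structure IsMixingProcess {S : Type*} [mS : MeasurableSpace S] (P : Measure S)
    (𝓖 : Set ℝ → MeasurableSpace S) (φ : ℝ → ℝ) (ξ : ℝ → S → ℝ) (M : ℝ) : Prop where
  le : ∀ A, 𝓖 A ≤ mS
  mono : ∀ A A', A ⊆ A' → 𝓖 A ≤ 𝓖 A'
  mixing : ∀ A A' r, 0 ≤ r → (∀ a ∈ A, ∀ a' ∈ A', r ≤ |a - a'|) →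
    UniformMixing P (𝓖 A) (𝓖 A') (φ r)
  antitone : AntitoneOn φ (Ici 0)
  nonneg : ∀ r, 0 ≤ r → 0 ≤ φ r
  measurable : Measurable (Function.uncurry ξ)
  bdd : ∀ r s, |ξ r s| ≤ M
  adapted : ∀ r, 0 ≤ r → Measurable[𝓖 {r}] (ξ r)
  centered : ∀ r, 0 ≤ r → ∫ s, ξ r s ∂P = 0

/-- The rescaled primitive `Λ⁻¹ ∫₀ᵗ ξ` of a process. -/
def scaledPrimitive {S : Type*} (ξ : ℝ → S → ℝ) (Λ t : ℝ) (s : S) : ℝ :=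
  Λ⁻¹ * ∫ r in (0 : ℝ)..t, ξ r s

lemma scaledPrimitive_zero {S : Type*} (ξ : ℝ → S → ℝ) (Λ : ℝ) (s : S) : scaledPrimitive ξ Λ 0 s = 0 := by
  simp [scaledPrimitive]

/-- The integral of the covariance `E[ξ_t ξ_{t - ρ}]` over time lags `ρ ≤ h`. -/
def truncatedCovariance {S : Type*} [MeasurableSpace S] (P : Measure S) (ξ : ℝ → S → ℝ)
    (h t : ℝ) : ℝ :=
  ∫ ρ in (0 : ℝ)..min h t, ∫ s, ξ t s * ξ (t - ρ) s ∂P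

namespace IsMixingProcess

variable {S : Type*} [mS : MeasurableSpace S] {P : Measure S}
  {𝓖 : Set ℝ → MeasurableSpace S} {φ : ℝ → ℝ} {ξ : ℝ → S → ℝ} {M : ℝ}

lemma measurable_eval (H : IsMixingProcess P 𝓖 φ ξ M) (r : ℝ) : Measurable (ξ r) :=
  H.measurable.of_uncurry_left

lemma intervalIntegrable (H : IsMixingProcess P 𝓖 φ ξ M) (s : S) (a b : ℝ) :
    IntervalIntegrable (fun r => ξ r s) volume a b :=
  intervalIntegrable_of_abs_le H.measurable.of_uncurry_right (fun r => H.bdd r s) a b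

lemma abs_primitive_le (H : IsMixingProcess P 𝓖 φ ξ M) (s : S) (a b : ℝ) :
    |∫ r in a..b, ξ r s| ≤ M * |b - a| := by
  rw [← Real.norm_eq_abs]
  exact intervalIntegral.norm_integral_le_of_norm_le_const fun r _ => H.bdd r s

lemma measurable_uncurry_scaledPrimitive (H : IsMixingProcess P 𝓖 φ ξ M) (Λ : ℝ) :
    Measurable (Function.uncurry (scaledPrimitive ξ Λ)) := by
  refine measurable_uncurry_of_continuous_of_measurable (fun s => ?_) (fun t => ?_)
  · exact continuous_const.mul (intervalIntegral.continuous_primitive (H.intervalIntegrable s) 0)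
  · refine Measurable.const_mul ?_ _
    have h : Measurable (fun p : S × ℝ => ξ p.2 p.1) := H.measurable.comp measurable_swap
    simp only [intervalIntegral]
    exact (h.stronglyMeasurable.integral_prod_right.sub
      h.stronglyMeasurable.integral_prod_right).measurable

lemma measurable_scaledPrimitive (H : IsMixingProcess P 𝓖 φ ξ M) (Λ t : ℝ) :
    Measurable (scaledPrimitive ξ Λ t) :=
  (H.measurable_uncurry_scaledPrimitive Λ).of_uncurry_left

lemma abs_scaledPrimitive_sub_le (H : IsMixingProcess P 𝓖 φ ξ M) {Λ : ℝ} (hΛ : 0 < Λ)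
    (a b : ℝ) (s : S) :
    |scaledPrimitive ξ Λ b s - scaledPrimitive ξ Λ a s| ≤ M * |b - a| / Λ := by
  unfold scaledPrimitive
  rw [← mul_sub, intervalIntegral.integral_interval_sub_left (H.intervalIntegrable s _ _)
    (H.intervalIntegrable s _ _), abs_mul, abs_of_pos (inv_pos.2 hΛ), inv_mul_eq_div]
  gcongr
  exact H.abs_primitive_le s a b

lemma exp_scaledPrimitive_le (H : IsMixingProcess P 𝓖 φ ξ M) {Λ : ℝ} (hΛ : 0 < Λ)
    (t : ℝ) (s : S) : Real.exp (scaledPrimitive ξ Λ t s) ≤ Real.exp (M * |t| / Λ) := by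
  have := H.abs_scaledPrimitive_sub_le hΛ 0 t s
  rw [scaledPrimitive_zero, sub_zero, sub_zero] at this
  exact Real.exp_le_exp.2 ((le_abs_self _).trans this)

variable [IsProbabilityMeasure P]

lemma bound_nonneg (H : IsMixingProcess P 𝓖 φ ξ M) : 0 ≤ M := by
  obtain ⟨s⟩ := P.nonempty_of_neZero
  exact (abs_nonneg _).trans (H.bdd 0 s)

lemma integrable_exp (H : IsMixingProcess P 𝓖 φ ξ M) {Λ : ℝ} (hΛ : 0 < Λ) (t : ℝ) :
    Integrable (fun s => Real.exp (scaledPrimitive ξ Λ t s)) P := by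
  refine Integrable.of_bound (C := Real.exp (M * |t| / Λ))
    (H.measurable_scaledPrimitive Λ t).exp.aestronglyMeasurable (ae_of_all _ fun s => ?_)
  rw [Real.norm_of_nonneg (Real.exp_pos _).le]
  exact H.exp_scaledPrimitive_le hΛ t s

lemma integral_exp_pos (H : IsMixingProcess P 𝓖 φ ξ M) {Λ : ℝ} (hΛ : 0 < Λ) (t : ℝ) :
    0 < ∫ s, Real.exp (scaledPrimitive ξ Λ t s) ∂P :=
  MeasureTheory.integral_exp_pos (H.integrable_exp hΛ t)

/-- Adaptedness is given at single times only, so the time integral is known to depend on the past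
only up to a null set. This is why the covariance inequality is stated for almost everywhere
measurable variables. -/
lemma aestronglyMeasurable_exp (H : IsMixingProcess P 𝓖 φ ξ M) {Λ t : ℝ} (ht : 0 ≤ t) :
    AEStronglyMeasurable[𝓖 (Icc 0 t)] (fun s => Real.exp (scaledPrimitive ξ Λ t s)) P := by
  refine Real.continuous_exp.comp_aestronglyMeasurable (AEStronglyMeasurable.const_mul ?_ _)
  refine aestronglyMeasurable_intervalIntegral_of_forall (H.le _) H.measurable H.bdd ht
    fun r hr hrt => ?_
  have hsub : ({r} : Set ℝ) ⊆ Icc 0 t := singleton_subset_iff.2 ⟨hr, hrt⟩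
  exact ((H.adapted r hr).mono (H.mono _ _ hsub) le_rfl).stronglyMeasurable.aestronglyMeasurable

/-- Decorrelation of the past exponential, at time `a`, from a bounded variable that depends on the
process at a finite set of later times. -/
lemma abs_integral_mul_exp_sub_le (H : IsMixingProcess P 𝓖 φ ξ M) {Λ : ℝ} (hΛ : 0 < Λ)
    {a r : ℝ} (ha : 0 ≤ a) (hr : 0 ≤ r) {A : Set ℝ} (hA : ∀ q ∈ A, a + r ≤ q) {f : S → ℝ}
    (hf : Measurable[𝓖 A] f) {C : ℝ} (hC : ∀ s, |f s| ≤ C) :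
    |(∫ s, f s * Real.exp (scaledPrimitive ξ Λ a s) ∂P) -
      (∫ s, f s ∂P) * ∫ s, Real.exp (scaledPrimitive ξ Λ a s) ∂P| ≤
      2 * C * φ r * ∫ s, Real.exp (scaledPrimitive ξ Λ a s) ∂P := by
  have hmix : UniformMixing P (𝓖 A) (𝓖 (Icc 0 a)) (φ r) := by
    refine H.mixing _ _ r hr fun q hq p hp => ?_
    have := hA q hq
    rw [abs_of_nonneg] <;> linarith [hp.2]
  have := hmix.abs_integral_mul_sub_le (H.le _) (H.le _)
    hf.stronglyMeasurable.aestronglyMeasurable hC (H.aestronglyMeasurable_exp (Λ := Λ) ha)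
    (H.integrable_exp hΛ a)
  simpa only [abs_of_pos (Real.exp_pos _)] using this

/-- The gap is the one between `q` and `t`: `ξ q` and the exponential together form one variable of
the past up to `q`, and centering of `ξ t` removes the product of means. -/
lemma abs_integral_mul_mul_exp_le (H : IsMixingProcess P 𝓖 φ ξ M) {Λ : ℝ} (hΛ : 0 < Λ)
    {a r t q : ℝ} (ha : 0 ≤ a) (haq : a ≤ q) (hr : 0 ≤ r) (hqt : q + r ≤ t) :
    |∫ s, ξ t s * (ξ q s * Real.exp (scaledPrimitive ξ Λ a s)) ∂P| ≤
      2 * M ^ 2 * φ r * ∫ s, Real.exp (scaledPrimitive ξ Λ a s) ∂P := by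
  have hM := H.bound_nonneg
  have hmix : UniformMixing P (𝓖 {t}) (𝓖 (Icc 0 q)) (φ r) := by
    refine H.mixing _ _ r hr fun t' ht' p hp => ?_
    rw [mem_singleton_iff] at ht'
    rw [abs_of_nonneg] <;> linarith [hp.2]
  have h1 : Measurable[𝓖 (Icc 0 q)] (ξ q) := (H.adapted q (ha.trans haq)).mono
    (H.mono _ _ (singleton_subset_iff.2 ⟨ha.trans haq, le_rfl⟩)) le_rfl
  have hi : Integrable (fun s => ξ q s * Real.exp (scaledPrimitive ξ Λ a s)) P :=
    (H.integrable_exp hΛ a).bdd_mul (c := M) (H.measurable_eval q).aestronglyMeasurable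
      (ae_of_all _ fun s => H.bdd q s)
  have := hmix.abs_integral_mul_sub_le (H.le _) (H.le _)
    (H.adapted t (by linarith)).stronglyMeasurable.aestronglyMeasurable (H.bdd t)
    (h1.stronglyMeasurable.aestronglyMeasurable.mul
      ((H.aestronglyMeasurable_exp (Λ := Λ) ha).mono (H.mono _ _ (Icc_subset_Icc_right haq)))) hi
  rw [H.centered t (by linarith), zero_mul, sub_zero] at this
  refine this.trans ?_
  have h2 : ∫ s, |ξ q s * Real.exp (scaledPrimitive ξ Λ a s)| ∂P ≤
      M * ∫ s, Real.exp (scaledPrimitive ξ Λ a s) ∂P := by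
    rw [← integral_const_mul]
    refine integral_mono hi.abs ((H.integrable_exp hΛ a).const_mul _) fun s => ?_
    simp only [abs_mul, abs_of_pos (Real.exp_pos _)]
    exact mul_le_mul_of_nonneg_right (H.bdd q s) (Real.exp_pos _).le
  calc 2 * M * φ r * ∫ s, |ξ q s * Real.exp (scaledPrimitive ξ Λ a s)| ∂P
      ≤ 2 * M * φ r * (M * ∫ s, Real.exp (scaledPrimitive ξ Λ a s) ∂P) :=
        mul_le_mul_of_nonneg_left h2 (mul_nonneg (by linarith) (H.nonneg r hr))
    _ = _ := by ring

/-- The covariance of the process decays like the mixing rate. -/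
lemma abs_covariance_le (H : IsMixingProcess P 𝓖 φ ξ M) {r t : ℝ} (hr : 0 ≤ r) (hrt : r ≤ t) :
    |∫ s, ξ t s * ξ (t - r) s ∂P| ≤ 2 * M ^ 2 * φ r := by
  -- At time `a = 0` the exponential is constantly 1, and the value of `Λ` is irrelevant.
  have := H.abs_integral_mul_mul_exp_le (Λ := 1) one_pos (a := 0) (r := r) (t := t) (q := t - r)
    le_rfl (by linarith) hr (by linarith)
  simpa [scaledPrimitive_zero] using this

lemma measurable_covariance (H : IsMixingProcess P 𝓖 φ ξ M) :
    Measurable (fun p : ℝ × ℝ => ∫ s, ξ p.1 s * ξ (p.1 - p.2) s ∂P) := by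
  have h1 : Measurable (fun p : (ℝ × ℝ) × S => ξ p.1.1 p.2) :=
    H.measurable.comp ((measurable_fst.comp measurable_fst).prodMk measurable_snd)
  have h2 : Measurable (fun p : (ℝ × ℝ) × S => ξ (p.1.1 - p.1.2) p.2) :=
    H.measurable.comp (((measurable_fst.comp measurable_fst).sub
      (measurable_snd.comp measurable_fst)).prodMk measurable_snd)
  exact (h1.mul h2).stronglyMeasurable.integral_prod_right.measurable

lemma abs_covariance_le_sq (H : IsMixingProcess P 𝓖 φ ξ M) (t q : ℝ) :
    |∫ s, ξ t s * ξ q s ∂P| ≤ M ^ 2 := by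
  have := norm_integral_le_of_norm_le_const (μ := P) (f := fun s => ξ t s * ξ q s) (C := M ^ 2)
    (ae_of_all _ fun s => by
      rw [norm_mul, sq]
      exact mul_le_mul (H.bdd t s) (H.bdd q s) (norm_nonneg _) H.bound_nonneg)
  simpa using this

lemma measurable_truncatedCovariance (H : IsMixingProcess P 𝓖 φ ξ M) (h : ℝ) :
    Measurable (truncatedCovariance P ξ h) := by
  have key : ∀ u v : ℝ → ℝ, Measurable u → Measurable v →
      Measurable (fun t => ∫ ρ in Ioc (u t) (v t), ∫ s, ξ t s * ξ (t - ρ) s ∂P) := by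
    intro u v hu hv
    have hs : MeasurableSet {p : ℝ × ℝ | p.2 ∈ Ioc (u p.1) (v p.1)} :=
      (measurableSet_lt (hu.comp measurable_fst) measurable_snd).inter
        (measurableSet_le measurable_snd (hv.comp measurable_fst))
    have := ((H.measurable_covariance.indicator hs).stronglyMeasurable.integral_prod_right'
      (ν := (volume : Measure ℝ))).measurable
    convert this using 2 with t
    rw [← integral_indicator measurableSet_Ioc]
    rfl
  unfold truncatedCovariance
  simp only [intervalIntegral]
  exact (key _ _ measurable_const (measurable_const.min measurable_id)).sub
    (key _ _ (measurable_const.min measurable_id) measurable_const)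

lemma abs_truncatedCovariance_le (H : IsMixingProcess P 𝓖 φ ξ M) {h t : ℝ} (hh : 0 ≤ h)
    (ht : 0 ≤ t) : |truncatedCovariance P ξ h t| ≤ M ^ 2 * h := by
  unfold truncatedCovariance
  have := intervalIntegral.norm_integral_le_of_norm_le_const (a := 0) (b := min h t)
    (f := fun ρ => ∫ s, ξ t s * ξ (t - ρ) s ∂P) (C := M ^ 2)
    fun r _ => H.abs_covariance_le_sq t (t - r)
  rw [sub_zero, abs_of_nonneg (le_min hh ht), Real.norm_eq_abs] at this
  exact this.trans (mul_le_mul_of_nonneg_left (min_le_left _ _) (sq_nonneg _))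

/-- Integrability of the rate makes this bound independent of the cutoff `h`. It later bounds the
exponential moments uniformly in the paths while `h` tends to infinity. -/
lemma abs_truncatedCovariance_le_integral (H : IsMixingProcess P 𝓖 φ ξ M)
    (hφ : IntegrableOn φ (Ioi 0)) {h t : ℝ} (hh : 0 ≤ h) (ht : 0 ≤ t) :
    |truncatedCovariance P ξ h t| ≤ 2 * M ^ 2 * ∫ r in Ioi 0, φ r := by
  unfold truncatedCovariance
  rw [intervalIntegral.integral_of_le (le_min hh ht), ← integral_const_mul, ← Real.norm_eq_abs]
  have hsub : Ioc 0 (min h t) ⊆ Ioi (0 : ℝ) := fun r hr => hr.1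
  refine (norm_integral_le_of_norm_le ((hφ.mono_set hsub).const_mul (2 * M ^ 2)) ?_).trans ?_
  · refine (ae_restrict_iff' measurableSet_Ioc).2 (ae_of_all _ fun r hr => ?_)
    exact H.abs_covariance_le hr.1.le (hr.2.trans (min_le_right _ _))
  · refine setIntegral_mono_set (hφ.const_mul _) ?_ hsub.eventuallyLE
    refine (ae_restrict_iff' measurableSet_Ioi).2 (ae_of_all _ fun r hr => ?_)
    exact mul_nonneg (by positivity) (H.nonneg r (le_of_lt hr))

end IsMixingProcess
end


/-! ### Exponential moments of a mixing process -/

noncomputable section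
namespace IsMixingProcess

variable {S : Type*} [mS : MeasurableSpace S] {P : Measure S} [IsProbabilityMeasure P]
  {𝓖 : Set ℝ → MeasurableSpace S} {φ : ℝ → ℝ} {ξ : ℝ → S → ℝ} {M : ℝ}

lemma integrable_mul_exp (H : IsMixingProcess P 𝓖 φ ξ M) {Λ : ℝ} (hΛ : 0 < Λ) (a : ℝ)
    {f : S → ℝ} (hf : Measurable f) {C : ℝ} (hC : ∀ s, |f s| ≤ C) :
    Integrable (fun s => f s * Real.exp (scaledPrimitive ξ Λ a s)) P :=
  (H.integrable_exp hΛ a).bdd_mul (c := C) hf.aestronglyMeasurable (ae_of_all _ hC)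

lemma abs_integral_mul_exp_le (H : IsMixingProcess P 𝓖 φ ξ M) {Λ : ℝ} (hΛ : 0 < Λ) (a : ℝ)
    {f : S → ℝ} {C : ℝ} (hC : ∀ s, |f s| ≤ C) :
    |∫ s, f s * Real.exp (scaledPrimitive ξ Λ a s) ∂P| ≤
      C * ∫ s, Real.exp (scaledPrimitive ξ Λ a s) ∂P := by
  rw [← integral_const_mul, ← Real.norm_eq_abs]
  refine norm_integral_le_of_norm_le ((H.integrable_exp hΛ a).const_mul C) (ae_of_all _ fun s => ?_)
  rw [norm_mul, Real.norm_of_nonneg (Real.exp_pos _).le]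
  exact mul_le_mul_of_nonneg_right (hC s) (Real.exp_pos _).le

/-- Among the times `t - h`, `t - ρ`, `t` some consecutive pair is at least `h / 2` apart. If it is
the later pair, both terms are small because `ξ t` is centered; if it is the earlier pair, the
product of the two values of `ξ` decorrelates from the exponential. -/
lemma abs_integral_mul_exp_sub_covariance_le (H : IsMixingProcess P 𝓖 φ ξ M) {Λ : ℝ} (hΛ : 0 < Λ)
    {h t ρ : ℝ} (hh : 0 ≤ h) (ht : h ≤ t) (hρ : 0 ≤ ρ) (hρh : ρ ≤ h) :
    |(∫ s, ξ t s * ξ (t - ρ) s * Real.exp (scaledPrimitive ξ Λ (t - h) s) ∂P) -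
      (∫ s, ξ t s * ξ (t - ρ) s ∂P) * ∫ s, Real.exp (scaledPrimitive ξ Λ (t - h) s) ∂P| ≤
      4 * M ^ 2 * φ (h / 2) * ∫ s, Real.exp (scaledPrimitive ξ Λ (t - h) s) ∂P := by
  have hM := H.bound_nonneg
  have hZ := H.integral_exp_pos hΛ (t - h)
  set Z := ∫ s, Real.exp (scaledPrimitive ξ Λ (t - h) s) ∂P with hZdef
  have hφ := H.nonneg (h / 2) (by linarith)
  rcases le_total (h / 2) ρ with h1 | h1
  · have e1 := H.abs_integral_mul_mul_exp_le hΛ (a := t - h) (q := t - ρ) (t := t) (r := ρ)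
      (by linarith) (by linarith) hρ (by linarith)
    have e2 := H.abs_covariance_le hρ (hρh.trans ht)
    have hanti : φ ρ ≤ φ (h / 2) :=
      H.antitone (mem_Ici.2 (by linarith)) (mem_Ici.2 hρ) h1
    simp only [← mul_assoc] at e1
    refine (abs_sub _ _).trans ?_
    rw [abs_mul, abs_of_pos hZ]
    calc _ ≤ 2 * M ^ 2 * φ ρ * Z + 2 * M ^ 2 * φ ρ * Z :=
          add_le_add e1 (mul_le_mul_of_nonneg_right e2 hZ.le)
      _ = 4 * M ^ 2 * φ ρ * Z := by ring
      _ ≤ _ := by gcongr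
  · have hm1 : Measurable[𝓖 {t, t - ρ}] (ξ t) := (H.adapted t (by linarith)).mono
      (H.mono _ _ (by simp)) le_rfl
    have hm2 : Measurable[𝓖 {t, t - ρ}] (ξ (t - ρ)) := (H.adapted (t - ρ) (by linarith)).mono
      (H.mono _ _ (by simp)) le_rfl
    have := H.abs_integral_mul_exp_sub_le hΛ (a := t - h) (r := h / 2) (by linarith)
      (by linarith) (A := {t, t - ρ}) (fun q hq => by
        rcases hq with rfl | rfl <;> linarith) (hm1.mul hm2) (C := M ^ 2) (fun s => by
        rw [Pi.mul_apply, abs_mul, sq]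
        exact mul_le_mul (H.bdd t s) (H.bdd _ s) (abs_nonneg _) hM)
    refine this.trans ?_
    gcongr
    nlinarith [sq_nonneg M]

/-- The logarithmic derivative of the exponential moment is the truncated covariance, up to a small
error. -/
lemma abs_integral_mul_exp_sub_truncatedCovariance_le (H : IsMixingProcess P 𝓖 φ ξ M) {Λ : ℝ}
    (hΛ : 0 < Λ) {h t : ℝ} (hh : 0 ≤ h) (ht : 0 ≤ t) (hMh : M * h ≤ Λ) :
    |(∫ s, ξ t s * Real.exp (scaledPrimitive ξ Λ t s) ∂P) -
      Λ⁻¹ * truncatedCovariance P ξ h t * ∫ s, Real.exp (scaledPrimitive ξ Λ t s) ∂P| ≤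
      3 * (2 * M * φ h + 4 * M ^ 2 * h * φ (h / 2) / Λ + 3 * M ^ 3 * h ^ 2 / Λ ^ 2) *
        ∫ s, Real.exp (scaledPrimitive ξ Λ t s) ∂P := by
  have hM := H.bound_nonneg
  -- The minimum covers `t < h`: then `a = 0`, the frozen exponential is 1, and the mixing errors
  -- vanish identically.
  set a := t - min h t with ha
  have hm0 : 0 ≤ min h t := le_min hh ht
  have ha0 : 0 ≤ a := sub_nonneg.2 (min_le_right _ _)
  have hat : a ≤ t := by linarith
  have hφh := H.nonneg h hh
  have hφh2 := H.nonneg (h / 2) (by linarith)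
  set D : S → ℝ := fun s => scaledPrimitive ξ Λ t s - scaledPrimitive ξ Λ a s with hD
  set θ := M * h / Λ with hθ
  have hθ0 : 0 ≤ θ := by positivity
  -- Smallness of `h` against `Λ` keeps the increment `D` within `[-1, 1]`. This allows the
  -- quadratic Taylor bound and makes the exponentials at times `a` and `t` comparable.
  have hθ1 : θ ≤ 1 := (div_le_one hΛ).2 hMh
  have hDθ : ∀ s, |D s| ≤ θ := fun s => by
    refine (H.abs_scaledPrimitive_sub_le hΛ a t s).trans ?_
    rw [abs_of_nonneg (by linarith), hθ, ha, sub_sub_cancel]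
    gcongr
    exact min_le_left _ _
  have hDm : Measurable D := (H.measurable_scaledPrimitive Λ t).sub (H.measurable_scaledPrimitive Λ a)
  have hexp : ∀ s, Real.exp (scaledPrimitive ξ Λ t s) =
      Real.exp (D s) * Real.exp (scaledPrimitive ξ Λ a s) := fun s => by
    rw [← Real.exp_add, hD]; ring_nf
  set Z := ∫ s, Real.exp (scaledPrimitive ξ Λ t s) ∂P with hZ
  set Za := ∫ s, Real.exp (scaledPrimitive ξ Λ a s) ∂P with hZa
  have hZpos : 0 < Z := H.integral_exp_pos hΛ t
  have hZapos : 0 < Za := H.integral_exp_pos hΛ a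
  set Γ := truncatedCovariance P ξ h t with hΓ
  have hξb := H.bdd t
  have hξm := H.measurable_eval t
  -- the three terms of the second order expansion
  have hR : ∀ s, |Real.exp (D s) - 1 - D s| ≤ θ ^ 2 := fun s =>
    (Real.abs_exp_sub_one_sub_id_le ((hDθ s).trans hθ1)).trans
      (sq_le_sq' (by linarith [neg_le_of_abs_le (hDθ s)]) (le_of_abs_le (hDθ s)))
  have hsplit : ∫ s, ξ t s * Real.exp (scaledPrimitive ξ Λ t s) ∂P =
      (∫ s, ξ t s * Real.exp (scaledPrimitive ξ Λ a s) ∂P) +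
      (∫ s, ξ t s * D s * Real.exp (scaledPrimitive ξ Λ a s) ∂P) +
      ∫ s, ξ t s * (Real.exp (D s) - 1 - D s) * Real.exp (scaledPrimitive ξ Λ a s) ∂P := by
    rw [← integral_add, ← integral_add]
    · refine integral_congr_ae (ae_of_all _ fun s => ?_)
      simp only [hexp]; ring
    · exact (H.integrable_mul_exp hΛ a hξm hξb).add
        (H.integrable_mul_exp hΛ a (f := fun s => ξ t s * D s) (hξm.mul hDm) (C := M * θ) fun s => by
          rw [abs_mul]; exact mul_le_mul (hξb s) (hDθ s) (abs_nonneg _) hM)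
    · exact H.integrable_mul_exp hΛ a (f := fun s => ξ t s * (Real.exp (D s) - 1 - D s))
        (hξm.mul ((hDm.exp.sub_const 1).sub hDm)) (C := M * θ ^ 2) fun s => by
          rw [abs_mul]; exact mul_le_mul (hξb s) (hR s) (abs_nonneg _) hM
    · exact H.integrable_mul_exp hΛ a hξm hξb
    · exact H.integrable_mul_exp hΛ a (f := fun s => ξ t s * D s) (hξm.mul hDm) (C := M * θ) fun s => by
        rw [abs_mul]; exact mul_le_mul (hξb s) (hDθ s) (abs_nonneg _) hM
  have h3 : |∫ s, ξ t s * (Real.exp (D s) - 1 - D s) * Real.exp (scaledPrimitive ξ Λ a s) ∂P| ≤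
      M * θ ^ 2 * Za :=
    H.abs_integral_mul_exp_le hΛ a fun s => by
      rw [abs_mul]; exact mul_le_mul (hξb s) (hR s) (abs_nonneg _) hM
  have h1 : |∫ s, ξ t s * Real.exp (scaledPrimitive ξ Λ a s) ∂P| ≤ 2 * M * φ h * Za := by
    rcases le_total h t with hc | hc
    · have hah : a + h = t := by rw [ha, min_eq_left hc]; ring
      have := H.abs_integral_mul_exp_sub_le hΛ ha0 hh (A := {t}) (fun q hq => by
        rw [mem_singleton_iff] at hq; linarith) (H.adapted t ht) hξb
      rwa [H.centered t ht, zero_mul, sub_zero] at this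
    · have : a = 0 := by rw [ha, min_eq_right hc]; ring
      simp only [this, scaledPrimitive_zero, Real.exp_zero, mul_one, H.centered t ht, abs_zero]
      positivity
  have h2 : |(∫ s, ξ t s * D s * Real.exp (scaledPrimitive ξ Λ a s) ∂P) - Λ⁻¹ * Γ * Za| ≤
      4 * M ^ 2 * h * φ (h / 2) / Λ * Za := by
    -- Written as an integral over lags, `D` turns the second order term into an integral of
    -- three-point expectations, each of which is compared with a covariance.
    have hDint : ∀ s, D s = Λ⁻¹ * ∫ ρ in (0 : ℝ)..min h t, ξ (t - ρ) s := fun s => by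
      rw [intervalIntegral.integral_comp_sub_left (fun r => ξ r s), sub_zero, hD]
      simp only [scaledPrimitive]
      rw [← mul_sub, intervalIntegral.integral_interval_sub_left (H.intervalIntegrable s _ _)
        (H.intervalIntegrable s _ _)]
    have hmρ : Measurable (fun p : S × ℝ => ξ (t - p.2) p.1) :=
      H.measurable.comp ((measurable_const.sub measurable_snd).prodMk measurable_fst)
    have hm3 : Measurable (fun p : S × ℝ =>
        ξ t p.1 * ξ (t - p.2) p.1 * Real.exp (scaledPrimitive ξ Λ a p.1)) :=
      ((hξm.comp measurable_fst).mul hmρ).mul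
        ((H.measurable_scaledPrimitive Λ a).exp.comp measurable_fst)
    have hb3 : ∀ p : S × ℝ, |ξ t p.1 * ξ (t - p.2) p.1 * Real.exp (scaledPrimitive ξ Λ a p.1)| ≤
        M * M * Real.exp (M * |a| / Λ) := fun p => by
      rw [abs_mul, abs_mul, abs_of_pos (Real.exp_pos _)]
      exact mul_le_mul (mul_le_mul (hξb _) (H.bdd _ _) (abs_nonneg _) hM)
        (H.exp_scaledPrimitive_le hΛ a _) (Real.exp_pos _).le (by positivity)
    have e1 : ∫ s, ξ t s * D s * Real.exp (scaledPrimitive ξ Λ a s) ∂P = Λ⁻¹ *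
        ∫ ρ in (0 : ℝ)..min h t, ∫ s, ξ t s * ξ (t - ρ) s * Real.exp (scaledPrimitive ξ Λ a s) ∂P := by
      rw [intervalIntegral.integral_of_le hm0, ← integral_integral_swap, ← integral_const_mul]
      · refine integral_congr_ae (ae_of_all _ fun s => ?_)
        simp only [hDint, intervalIntegral.integral_of_le hm0, integral_mul_const, integral_const_mul]
        ring
      · exact Integrable.of_bound hm3.aestronglyMeasurable _ (ae_of_all _ hb3)
    have hGi : IntervalIntegrable (fun ρ => ∫ s, ξ t s * ξ (t - ρ) s ∂P) volume 0 (min h t) :=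
      intervalIntegrable_of_abs_le (H.measurable_covariance.comp measurable_prodMk_left)
        (fun ρ => H.abs_covariance_le_sq t (t - ρ)) _ _
    have hGi' : IntervalIntegrable (fun ρ => ∫ s, ξ t s * ξ (t - ρ) s *
        Real.exp (scaledPrimitive ξ Λ a s) ∂P) volume 0 (min h t) := by
      refine intervalIntegrable_of_abs_le (C := M ^ 2 * Za)
        (hm3.comp measurable_swap).stronglyMeasurable.integral_prod_right'.measurable
        (fun ρ => H.abs_integral_mul_exp_le hΛ a fun s => ?_) _ _
      rw [abs_mul, sq]; exact mul_le_mul (hξb _) (H.bdd _ _) (abs_nonneg _) hM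
    rw [e1, hΓ, truncatedCovariance, mul_assoc, ← mul_sub, abs_mul, abs_of_pos (inv_pos.2 hΛ),
      ← intervalIntegral.integral_mul_const, ← intervalIntegral.integral_sub hGi' (hGi.mul_const _)]
    have := intervalIntegral.norm_integral_le_of_norm_le_const (a := 0) (b := min h t)
      (f := fun ρ => (∫ s, ξ t s * ξ (t - ρ) s * Real.exp (scaledPrimitive ξ Λ a s) ∂P) -
        (∫ s, ξ t s * ξ (t - ρ) s ∂P) * Za) (C := 4 * M ^ 2 * φ (h / 2) * Za) fun ρ hρ => by
      rw [uIoc_of_le hm0] at hρ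
      rcases le_total h t with hc | hc
      · have hah : a = t - h := by rw [ha, min_eq_left hc]
        rw [min_eq_left hc] at hρ
        rw [hZa, hah]
        exact H.abs_integral_mul_exp_sub_covariance_le hΛ hh hc hρ.1.le hρ.2
      · have : a = 0 := by rw [ha, min_eq_right hc]; ring
        rw [hZa]
        simp only [this, scaledPrimitive_zero, Real.exp_zero, mul_one, integral_const, probReal_univ,
          smul_eq_mul, sub_self, norm_zero]
        positivity
    rw [sub_zero, abs_of_nonneg hm0, Real.norm_eq_abs] at this
    calc _ ≤ Λ⁻¹ * (4 * M ^ 2 * φ (h / 2) * Za * min h t) := by gcongr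
      _ ≤ Λ⁻¹ * (4 * M ^ 2 * φ (h / 2) * Za * h) := by gcongr; exact min_le_left _ _
      _ = _ := by field_simp
  have h4 : |Z - Za| ≤ 2 * θ * Za := by
    have : Z - Za = ∫ s, (Real.exp (D s) - 1) * Real.exp (scaledPrimitive ξ Λ a s) ∂P := by
      rw [hZ, hZa, ← integral_sub (H.integrable_exp hΛ t) (H.integrable_exp hΛ a)]
      refine integral_congr_ae (ae_of_all _ fun s => ?_)
      simp only [hexp]; ring
    rw [this]
    refine H.abs_integral_mul_exp_le hΛ a fun s => ?_
    exact (Real.abs_exp_sub_one_le ((hDθ s).trans hθ1)).trans (by linarith [hDθ s])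
  -- The factor 3 in the statement is an upper bound for `e`.
  have h5 : Za ≤ 3 * Z := by
    rw [hZ, hZa, ← integral_const_mul]
    refine integral_mono (H.integrable_exp hΛ a) ((H.integrable_exp hΛ t).const_mul _) fun s => ?_
    have e : Real.exp (scaledPrimitive ξ Λ a s) =
        Real.exp (-D s) * Real.exp (scaledPrimitive ξ Λ t s) := by
      rw [← Real.exp_add, hD]; ring_nf
    simp only
    rw [e]
    refine mul_le_mul_of_nonneg_right ?_ (Real.exp_pos _).le
    have : Real.exp (-D s) ≤ Real.exp 1 :=
      Real.exp_le_exp.2 ((neg_le_abs _).trans ((hDθ s).trans hθ1))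
    linarith [Real.exp_one_lt_d9]
  have hΓb : |Γ| ≤ M ^ 2 * h := H.abs_truncatedCovariance_le hh ht
  have h6 : |Λ⁻¹ * Γ * Za - Λ⁻¹ * Γ * Z| ≤ Λ⁻¹ * (M ^ 2 * h) * (2 * θ * Za) := by
    rw [← mul_sub, abs_mul, abs_mul, abs_of_pos (inv_pos.2 hΛ), abs_sub_comm]
    gcongr
  rw [hsplit]
  set I1 := ∫ s, ξ t s * Real.exp (scaledPrimitive ξ Λ a s) ∂P
  set I2 := ∫ s, ξ t s * D s * Real.exp (scaledPrimitive ξ Λ a s) ∂P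
  set I3 := ∫ s, ξ t s * (Real.exp (D s) - 1 - D s) * Real.exp (scaledPrimitive ξ Λ a s) ∂P
  have e : I1 + I2 + I3 - Λ⁻¹ * Γ * Z = I1 + (I2 - Λ⁻¹ * Γ * Za) + I3 +
    (Λ⁻¹ * Γ * Za - Λ⁻¹ * Γ * Z) := by ring
  rw [e]
  have htri : |I1 + (I2 - Λ⁻¹ * Γ * Za) + I3 + (Λ⁻¹ * Γ * Za - Λ⁻¹ * Γ * Z)| ≤
      |I1| + |I2 - Λ⁻¹ * Γ * Za| + |I3| + |Λ⁻¹ * Γ * Za - Λ⁻¹ * Γ * Z| :=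
    (abs_add_le _ _).trans (add_le_add ((abs_add_le _ _).trans
      (add_le_add (abs_add_le _ _) le_rfl)) le_rfl)
  refine htri.trans ?_
  -- Of the coefficient 3 in front of `M³h²/Λ²`, one part is the Taylor remainder and two parts come
  -- from replacing `Za` by `Z` in the covariance term.
  calc _ ≤ 2 * M * φ h * Za + 4 * M ^ 2 * h * φ (h / 2) / Λ * Za + M * θ ^ 2 * Za +
        Λ⁻¹ * (M ^ 2 * h) * (2 * θ * Za) := by gcongr
    _ = (2 * M * φ h + 4 * M ^ 2 * h * φ (h / 2) / Λ + 3 * M ^ 3 * h ^ 2 / Λ ^ 2) * Za := by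
        rw [hθ]; field_simp; ring
    _ ≤ (2 * M * φ h + 4 * M ^ 2 * h * φ (h / 2) / Λ + 3 * M ^ 3 * h ^ 2 / Λ ^ 2) * (3 * Z) := by
        gcongr
    _ = _ := by ring

/-- The exponential moment of the rescaled primitive of a mixing process. -/
lemma exists_integral_exp_eq (H : IsMixingProcess P 𝓖 φ ξ M) {Λ : ℝ}
    (hΛ : 0 < Λ) {h T : ℝ} (hh : 0 ≤ h) (hT : 0 ≤ T) (hMh : M * h ≤ Λ) :
    ∃ κ, ∫ s, Real.exp (scaledPrimitive ξ Λ T s) ∂P = Real.exp κ ∧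
      |κ - (Λ ^ 2)⁻¹ * ∫ t in (0 : ℝ)..T, truncatedCovariance P ξ h t| ≤
      3 * (2 * M * φ h + 4 * M ^ 2 * h * φ (h / 2) / Λ + 3 * M ^ 3 * h ^ 2 / Λ ^ 2) * T / Λ := by
  have hM := H.bound_nonneg
  set Z : ℝ → ℝ := fun t => ∫ s, Real.exp (scaledPrimitive ξ Λ t s) ∂P with hZ
  have hZpos : ∀ t, 0 < Z t := fun t => H.integral_exp_pos hΛ t
  set z : ℝ → ℝ := fun t => ∫ s, ξ t s * Real.exp (scaledPrimitive ξ Λ t s) ∂P with hz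
  have hYm := H.measurable_uncurry_scaledPrimitive Λ
  have hzm : Measurable z :=
    (H.measurable.mul hYm.exp).stronglyMeasurable.integral_prod_right'.measurable
  have hZm : Measurable Z := hYm.exp.stronglyMeasurable.integral_prod_right'.measurable
  -- This is the logarithmic derivative of `Z`, introduced without differentiating `Z`: the
  -- expectation of `exp_primitive` gives `Z = 1 + ∫ k Z`, hence `Z = exp ∫ k`.
  set k : ℝ → ℝ := fun t => Λ⁻¹ * (z t / Z t) with hk
  have hkm : Measurable k := (hzm.div hZm).const_mul _
  have hkb : ∀ t, |k t| ≤ Λ⁻¹ * M := fun t => by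
    rw [hk]
    simp only
    rw [abs_mul, abs_of_pos (inv_pos.2 hΛ), abs_div, abs_of_pos (hZpos t)]
    gcongr
    rw [div_le_iff₀ (hZpos t)]
    exact H.abs_integral_mul_exp_le hΛ t (H.bdd t)
  have hZint : ∀ t, 0 ≤ t → Z t = 1 + ∫ r in (0 : ℝ)..t, k r * Z r := fun t ht => by
    have e1 : ∀ s, Real.exp (scaledPrimitive ξ Λ t s) =
        1 + ∫ r in (0 : ℝ)..t, Λ⁻¹ * ξ r s * Real.exp (scaledPrimitive ξ Λ r s) := fun s => by
      have := exp_primitive (f := fun r => Λ⁻¹ * ξ r s) (C := Λ⁻¹ * M)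
        (H.measurable.of_uncurry_right.const_mul _) (fun r => by
          rw [abs_mul, abs_of_pos (inv_pos.2 hΛ)]
          exact mul_le_mul_of_nonneg_left (H.bdd r s) (inv_pos.2 hΛ).le) t
      simpa only [intervalIntegral.integral_const_mul, scaledPrimitive] using this
    have hm : Measurable (fun p : S × ℝ => Λ⁻¹ * ξ p.2 p.1 *
        Real.exp (scaledPrimitive ξ Λ p.2 p.1)) :=
      ((H.measurable.comp measurable_swap).const_mul _).mul (hYm.exp.comp measurable_swap)
    have hint : Integrable (fun p : S × ℝ => Λ⁻¹ * ξ p.2 p.1 *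
        Real.exp (scaledPrimitive ξ Λ p.2 p.1)) (P.prod (volume.restrict (Ioc 0 t))) := by
      refine Integrable.of_bound (C := Λ⁻¹ * M * Real.exp (M * t / Λ)) hm.aestronglyMeasurable ?_
      have : ∀ᵐ p : S × ℝ ∂(P.prod (volume.restrict (Ioc 0 t))), p.2 ∈ Ioc 0 t :=
        Measure.quasiMeasurePreserving_snd.ae (ae_restrict_mem measurableSet_Ioc)
      filter_upwards [this] with p hp
      rw [norm_mul, norm_mul, Real.norm_of_nonneg (inv_pos.2 hΛ).le,
        Real.norm_of_nonneg (Real.exp_pos _).le]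
      refine mul_le_mul (mul_le_mul_of_nonneg_left (H.bdd _ _) (inv_pos.2 hΛ).le)
        ((H.exp_scaledPrimitive_le hΛ _ _).trans (Real.exp_le_exp.2 ?_)) (Real.exp_pos _).le
        (by positivity)
      rw [abs_of_pos hp.1]
      gcongr
      exact hp.2
    have e2 : Z t = ∫ s, (1 + ∫ r in (0 : ℝ)..t, Λ⁻¹ * ξ r s *
        Real.exp (scaledPrimitive ξ Λ r s)) ∂P := by
      rw [hZ]; simp only [e1]
    rw [e2]
    simp only [intervalIntegral.integral_of_le ht]
    rw [integral_add (integrable_const _) hint.integral_prod_left, integral_integral_swap hint]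
    simp only [integral_const, probReal_univ, smul_eq_mul, mul_one]
    congr 1
    refine integral_congr_ae (ae_of_all _ fun r => ?_)
    simp only [hk, hz, mul_assoc, integral_const_mul]
    rw [div_mul_cancel₀ _ (hZpos r).ne']
  have hkZi : IntervalIntegrable (fun r => k r * Z r) volume 0 T := by
    have : ∀ r ∈ Ioc 0 T, |k r * Z r| ≤ Λ⁻¹ * M * Real.exp (M * T / Λ) := fun r hr => by
      rw [abs_mul, abs_of_pos (hZpos r)]
      refine mul_le_mul (hkb r) ?_ (hZpos r).le (by positivity)
      have h1 : Z r ≤ ∫ _, Real.exp (M * T / Λ) ∂P := by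
        refine integral_mono (H.integrable_exp hΛ r) (integrable_const _) fun s => ?_
        refine (H.exp_scaledPrimitive_le hΛ _ _).trans (Real.exp_le_exp.2 ?_)
        rw [abs_of_pos hr.1]
        gcongr
        exact hr.2
      simpa using h1
    rw [intervalIntegrable_iff_integrableOn_Ioc_of_le hT]
    exact Integrable.of_bound (hkm.mul hZm).aestronglyMeasurable _
      ((ae_restrict_iff' measurableSet_Ioc).2 (ae_of_all _ this))
  have hZc : ContinuousOn Z (Icc 0 T) := by
    have : ContinuousOn (fun t => 1 + ∫ r in (0 : ℝ)..t, k r * Z r) (Icc 0 T) := by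
      rw [← uIcc_of_le hT]
      exact continuousOn_const.add
        (intervalIntegral.continuousOn_primitive_interval' hkZi left_mem_uIcc)
    exact this.congr fun t ht => hZint t ht.1
  refine ⟨∫ r in (0 : ℝ)..T, k r, eq_exp_of_integral_eq hkm hkb hT hZc fun s hs => hZint s hs.1, ?_⟩
  set E := 3 * (2 * M * φ h + 4 * M ^ 2 * h * φ (h / 2) / Λ + 3 * M ^ 3 * h ^ 2 / Λ ^ 2) with hE
  have hΓi : IntervalIntegrable (truncatedCovariance P ξ h) volume 0 T := by
    rw [intervalIntegrable_iff_integrableOn_Ioc_of_le hT]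
    exact Integrable.of_bound (H.measurable_truncatedCovariance h).aestronglyMeasurable _
      ((ae_restrict_iff' measurableSet_Ioc).2 (ae_of_all _ fun r hr =>
        H.abs_truncatedCovariance_le hh hr.1.le))
  rw [← intervalIntegral.integral_const_mul, ← intervalIntegral.integral_sub
    (intervalIntegrable_of_abs_le hkm hkb _ _) (hΓi.const_mul _)]
  have := intervalIntegral.norm_integral_le_of_norm_le_const (a := 0) (b := T)
    (f := fun t => k t - (Λ ^ 2)⁻¹ * truncatedCovariance P ξ h t) (C := E / Λ) fun t ht => by
    rw [uIoc_of_le hT] at ht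
    have h1 := H.abs_integral_mul_exp_sub_truncatedCovariance_le hΛ hh ht.1.le hMh
    rw [← hE] at h1
    have h2 : k t - (Λ ^ 2)⁻¹ * truncatedCovariance P ξ h t =
        (z t - Λ⁻¹ * truncatedCovariance P ξ h t * Z t) / (Λ * Z t) := by
      have := (hZpos t).ne'
      rw [hk]; field_simp
    rw [h2, Real.norm_eq_abs, abs_div, abs_of_pos (mul_pos hΛ (hZpos t)),
      div_le_div_iff₀ (mul_pos hΛ (hZpos t)) hΛ]
    calc _ ≤ E * Z t * Λ := mul_le_mul_of_nonneg_right h1 hΛ.le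
      _ = _ := by ring
  rw [sub_zero, abs_of_nonneg hT, Real.norm_eq_abs] at this
  exact this.trans_eq (by ring)

end IsMixingProcess
end


/-! ### Stationary mixing random fields and their correlation function -/

noncomputable section

/-- Translation is continuous in `L¹(ℝ)`. -/
lemma tendsto_integral_abs_translate_sub {f : ℝ → ℝ} (hf : Integrable f) :
    Tendsto (fun z : ℝ => ∫ x, |f (z + x) - f x|) (𝓝 0) (𝓝 0) := by
  have hf1 : MemLp f 1 volume := memLp_one_iff_integrable.2 hf
  have : Fact ((1 : ℝ≥0∞) ≠ ∞) := ⟨ENNReal.one_ne_top⟩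
  set G : ℝ → Lp ℝ 1 (volume : Measure ℝ) := fun z => DomAddAct.mk z +ᵥ hf1.toLp f with hG
  have hc : Continuous G := by fun_prop
  have hG0 : G 0 = hf1.toLp f := by simp [hG]
  have h0 : Tendsto (fun z : ℝ => ‖G z - hf1.toLp f‖) (𝓝 0) (𝓝 0) := by
    have h1 : Continuous (fun z => ‖G z - hf1.toLp f‖) := by fun_prop
    have := h1.tendsto 0
    rwa [hG0, sub_self, norm_zero] at this
  refine h0.congr fun z => ?_
  have hz : MemLp (fun x => f (z + x)) 1 volume :=
    memLp_one_iff_integrable.2 (hf.comp_add_left z)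
  have e : G z = hz.toLp (fun x => f (z + x)) :=
    DomAddAct.mk_vadd_toLp z hf1
  rw [e, ← MemLp.toLp_sub, L1.norm_eq_integral_norm]
  refine integral_congr_ae ?_
  filter_upwards [(hz.sub hf1).coeFn_toLp] with x hx
  rw [hx]; rfl

lemma fieldSigma_le {S : Type*} [mS : MeasurableSpace S] {c : ℝ≥0 → ℝ → S → ℝ}
    (hc : Measurable (fun p : ℝ≥0 × ℝ × S => c p.1 p.2.1 p.2.2)) (A : Set (ℝ≥0 × ℝ)) :
    fieldSigma c A ≤ mS := by
  refine iSup₂_le fun p _ => ?_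
  have : Measurable (c p.1 p.2) :=
    hc.comp (measurable_const.prodMk (measurable_const.prodMk measurable_id))
  exact this.comap_le

lemma fieldSigma_mono {S : Type*} (c : ℝ≥0 → ℝ → S → ℝ) {A A' : Set (ℝ≥0 × ℝ)} (h : A ⊆ A') :
    fieldSigma c A ≤ fieldSigma c A' :=
  biSup_mono fun _ hp => h hp

lemma measurable_fieldSigma {S : Type*} (c : ℝ≥0 → ℝ → S → ℝ) {A : Set (ℝ≥0 × ℝ)} {t : ℝ≥0} {x : ℝ}
    (h : (t, x) ∈ A) : Measurable[fieldSigma c A] (c t x) := by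
  rw [measurable_iff_comap_le]
  exact le_iSup₂_of_le (f := fun (p : ℝ≥0 × ℝ) (_ : p ∈ A) =>
    MeasurableSpace.comap (c p.1 p.2) inferInstance) (t, x) h le_rfl

/-- A bounded, centered, stationary and uniformly mixing random field with rate `φ`. -/
structure IsMixingField {S : Type*} [MeasurableSpace S] (c : ℝ≥0 → ℝ → S → ℝ) (P : Measure S)
    (φ : ℝ → ℝ) (M : ℝ) : Prop where
  measurable : Measurable (fun p : ℝ≥0 × ℝ × S => c p.1 p.2.1 p.2.2)
  bdd : ∀ t x s, |c t x s| ≤ M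
  stationary : IsStationaryField c P
  centered : ∀ t x, ∫ s, c t x s ∂P = 0
  mixing : ∀ A A' r, 0 ≤ r → (∀ p ∈ A, ∀ q ∈ A', r ≤ planeDist p q) →
    UniformMixing P (fieldSigma c A) (fieldSigma c A') (φ r)
  antitone : AntitoneOn φ (Ici 0)
  nonneg : ∀ r, 0 ≤ r → 0 ≤ φ r
  integrable : IntegrableOn φ (Ioi 0)

/-- Multiplying by `P S₂` clears the conditional probability and also admits null sets `S₂`. The
supremum is a genuine upper bound because the set is bounded by 1. -/
lemma uniformMixing_fieldSigma {S : Type*} [MeasurableSpace S] {c : ℝ≥0 → ℝ → S → ℝ}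
    {P : Measure S} [IsProbabilityMeasure P]
    (hc : Measurable (fun p : ℝ≥0 × ℝ × S => c p.1 p.2.1 p.2.2)) {r : ℝ}
    {A A' : Set (ℝ≥0 × ℝ)} (h : ∀ p ∈ A, ∀ q ∈ A', r ≤ planeDist p q) :
    UniformMixing P (fieldSigma c A) (fieldSigma c A') (uniformMixingCoeff c P r) := by
  intro S₁ S₂ h₁ h₂
  by_cases h0 : P S₂ = 0
  · have e1 : P.real S₂ = 0 := by simp [measureReal_def, h0]
    have e2 : P.real (S₁ ∩ S₂) = 0 := by
      simp [measureReal_def, measure_mono_null inter_subset_right h0]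
    simp [e1, e2]
  · have hpos : 0 < P.real S₂ := ENNReal.toReal_pos h0 (measure_ne_top _ _)
    have hle : |(ProbabilityTheory.cond P S₂).real S₁ - P.real S₁| ≤ uniformMixingCoeff c P r := by
      refine le_csSup ⟨1, ?_⟩ ⟨A, A', h, S₁, S₂, h₁, h₂, h0, rfl⟩
      rintro a ⟨_, _, _, T₁, T₂, _, _, h0', rfl⟩
      have := cond_isProbabilityMeasure (μ := P) h0'
      rw [abs_le]
      constructor <;> linarith [measureReal_nonneg (μ := P) (s := T₁),
        measureReal_nonneg (μ := ProbabilityTheory.cond P T₂) (s := T₁),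
        measureReal_le_one (μ := P) (s := T₁),
        measureReal_le_one (μ := ProbabilityTheory.cond P T₂) (s := T₁)]
    have e : (ProbabilityTheory.cond P S₂).real S₁ = (P.real S₂)⁻¹ * P.real (S₁ ∩ S₂) := by
      rw [measureReal_def, cond_apply (fieldSigma_le hc _ _ h₂), ENNReal.toReal_mul,
        ENNReal.toReal_inv, inter_comm]
      rfl
    rw [e] at hle
    have e3 : P.real (S₁ ∩ S₂) - P.real S₁ * P.real S₂ =
        ((P.real S₂)⁻¹ * P.real (S₁ ∩ S₂) - P.real S₁) * P.real S₂ := by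
      field_simp
    rw [e3, abs_mul, abs_of_pos hpos]
    exact mul_le_mul_of_nonneg_right hle hpos.le

/-- The rate in the mixing condition, and a lag `h` for which it makes the errors vanish. -/
lemma exists_isMixingField {S : Type*} [MeasurableSpace S] {c : ℝ≥0 → ℝ → S → ℝ}
    {P : Measure S} [IsProbabilityMeasure P]
    (hc : Measurable (fun p : ℝ≥0 × ℝ × S => c p.1 p.2.1 p.2.2)) {M : ℝ}
    (hbdd : ∀ t x s, |c t x s| ≤ M) (hstat : IsStationaryField c P)
    (hcent : ∀ t x, ∫ s, c t x s ∂P = 0) (hmix : MixingUm c P) :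
    ∃ φ h : ℝ → ℝ, IsMixingField c P φ M ∧ Tendsto h atTop atTop ∧ Tendsto φ atTop (𝓝 0) ∧
      Tendsto (fun Λ => Λ * φ (h Λ)) atTop (𝓝 0) ∧
      Tendsto (fun Λ => h Λ * φ (h Λ / 2)) atTop (𝓝 0) ∧
      Tendsto (fun Λ => h Λ ^ 2 / Λ) atTop (𝓝 0) := by
  obtain ⟨C, δ, hδ, hφ⟩ := hmix
  -- At `r = 0` the power equals 1, so `C` dominates a nonnegative coefficient.
  have hC : 0 ≤ C := by
    have h1 : 0 ≤ uniformMixingCoeff c P 0 := by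
      refine Real.sSup_nonneg ?_
      rintro a ⟨_, _, _, T₁, T₂, _, _, h0', rfl⟩
      exact abs_nonneg _
    simpa using h1.trans (hφ 0 le_rfl)
  set φ : ℝ → ℝ := fun r => C * (1 + r) ^ (-(2 + δ)) with hφdef
  -- With `h = Λ^θ` this exponent balances `Λφ(h)` and `h²/Λ`: both are of order `Λ^(-δ/(4+δ))`,
  -- which tends to zero because `δ > 0`.
  set θ : ℝ := 2 / (4 + δ) with hθ
  have hθ0 : 0 < θ := by positivity
  have hnn : ∀ r, 0 ≤ r → 0 ≤ φ r := fun r hr =>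
    mul_nonneg hC (Real.rpow_nonneg (by linarith) _)
  have hle : ∀ r, 0 < r → φ r ≤ C * r ^ (-(2 + δ)) := fun r hr => by
    refine mul_le_mul_of_nonneg_left ?_ hC
    exact Real.rpow_le_rpow_of_nonpos hr (by linarith) (by linarith)
  refine ⟨φ, fun Λ => Λ ^ θ, ⟨hc, hbdd, hstat, hcent, fun A A' r hr hA S₁ S₂ h₁ h₂ => ?_, ?_,
    hnn, ?_⟩, tendsto_rpow_atTop hθ0, ?_, ?_, ?_, ?_⟩
  · exact (uniformMixing_fieldSigma hc hA S₁ S₂ h₁ h₂).trans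
      (mul_le_mul_of_nonneg_right (hφ r hr) measureReal_nonneg)
  · intro r hr r' hr' hrr
    rw [mem_Ici] at hr hr'
    refine mul_le_mul_of_nonneg_left ?_ hC
    exact Real.rpow_le_rpow_of_nonpos (by linarith) (by linarith) (by linarith)
  · have := integrableOn_add_rpow_Ioi_of_lt (a := -(2 + δ)) (c := 0) (m := 1) (by linarith)
      (by norm_num)
    simp only [add_comm _ (1 : ℝ)] at this
    exact this.const_mul C
  · have h1 : Tendsto (fun r : ℝ => C * r ^ (-(2 + δ))) atTop (𝓝 (C * 0)) :=
      (tendsto_rpow_neg_atTop (by linarith)).const_mul C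
    rw [mul_zero] at h1
    refine squeeze_zero' ?_ ?_ h1
    · filter_upwards [eventually_ge_atTop 0] with r hr using hnn r hr
    · filter_upwards [eventually_gt_atTop 0] with r hr using hle r hr
  · have h1 : Tendsto (fun r : ℝ => C * r ^ (-(δ / (4 + δ)))) atTop (𝓝 (C * 0)) :=
      (tendsto_rpow_neg_atTop (by positivity)).const_mul C
    rw [mul_zero] at h1
    refine squeeze_zero' ?_ ?_ h1
    · filter_upwards [eventually_ge_atTop 0] with r hr
      exact mul_nonneg hr (hnn _ (Real.rpow_nonneg hr _))
    · filter_upwards [eventually_gt_atTop 0] with r hr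
      refine (mul_le_mul_of_nonneg_left (hle _ (Real.rpow_pos_of_pos hr _)) hr.le).trans_eq ?_
      rw [← Real.rpow_mul hr.le, mul_left_comm]
      congr 1
      conv_lhs => rw [← Real.rpow_one r, ← Real.rpow_mul hr.le, ← Real.rpow_add hr]
      congr 1
      rw [hθ]; field_simp; ring
  · have h1 : Tendsto (fun r : ℝ => C * 2 ^ (2 + δ) * r ^ (-(θ * (1 + δ)))) atTop
        (𝓝 (C * 2 ^ (2 + δ) * 0)) :=
      (tendsto_rpow_neg_atTop (by positivity)).const_mul _
    rw [mul_zero] at h1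
    refine squeeze_zero' ?_ ?_ h1
    · filter_upwards [eventually_ge_atTop 0] with r hr
      have := Real.rpow_nonneg hr θ
      exact mul_nonneg this (hnn _ (by positivity))
    · filter_upwards [eventually_gt_atTop 0] with r hr
      have hp := Real.rpow_pos_of_pos hr θ
      refine (mul_le_mul_of_nonneg_left (hle _ (by positivity)) hp.le).trans_eq ?_
      rw [Real.div_rpow hp.le (by norm_num), ← Real.rpow_mul hr.le, Real.rpow_neg (by norm_num : (0 : ℝ) ≤ 2)]
      rw [div_inv_eq_mul]
      have : r ^ θ * r ^ (θ * -(2 + δ)) = r ^ (-(θ * (1 + δ))) := by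
        rw [← Real.rpow_add hr]; congr 1; ring
      rw [← this]; ring
  · have h1 : Tendsto (fun r : ℝ => r ^ (-(δ / (4 + δ)))) atTop (𝓝 0) :=
      tendsto_rpow_neg_atTop (by positivity)
    refine h1.congr' ?_
    filter_upwards [eventually_gt_atTop 0] with r hr
    have : (r ^ θ) ^ 2 = r ^ (-(δ / (4 + δ))) * r := by
      rw [← Real.rpow_natCast, ← Real.rpow_mul hr.le, ← Real.rpow_add_one hr.ne']
      congr 1
      rw [hθ]; push_cast; field_simp; ring
    rw [this, mul_div_cancel_right₀ _ hr.ne']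

lemma le_planeDist_fst (p q : ℝ≥0 × ℝ) : |(p.1 : ℝ) - q.1| ≤ planeDist p q := by
  unfold planeDist
  exact Real.abs_le_sqrt (by nlinarith [sq_nonneg (p.2 - q.2)])

lemma le_planeDist_snd (p q : ℝ≥0 × ℝ) : |p.2 - q.2| ≤ planeDist p q := by
  unfold planeDist
  exact Real.abs_le_sqrt (by nlinarith [sq_nonneg ((p.1 : ℝ) - q.1)])

namespace IsMixingField

variable {S : Type*} [mS : MeasurableSpace S] {P : Measure S}
  {c : ℝ≥0 → ℝ → S → ℝ} {φ : ℝ → ℝ} {M : ℝ}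

lemma measurable_eval (H : IsMixingField c P φ M) (t : ℝ≥0) (x : ℝ) : Measurable (c t x) :=
  H.measurable.comp (measurable_const.prodMk (measurable_const.prodMk measurable_id))

lemma integral_comp_translate (H : IsMixingField c P φ M) {F : ℝ → ℝ → ℝ}
    (hF : Measurable (Function.uncurry F)) (t₁ t₂ h : ℝ≥0) (x₁ x₂ k : ℝ) :
    ∫ s, F (c (t₁ + h) (x₁ + k) s) (c (t₂ + h) (x₂ + k) s) ∂P =
      ∫ s, F (c t₁ x₁ s) (c t₂ x₂ s) ∂P := by
  have hG : Measurable (fun w : ℝ≥0 × ℝ → ℝ => F (w (t₁, x₁)) (w (t₂, x₂))) :=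
    hF.comp (f := fun w : ℝ≥0 × ℝ → ℝ => (w (t₁, x₁), w (t₂, x₂)))
      ((measurable_pi_apply _).prodMk (measurable_pi_apply _))
  have h1 : Measurable (fun s (p : ℝ≥0 × ℝ) => c (p.1 + h) (p.2 + k) s) :=
    measurable_pi_lambda _ fun p => H.measurable_eval _ _
  have h2 : Measurable (fun s (p : ℝ≥0 × ℝ) => c p.1 p.2 s) :=
    measurable_pi_lambda _ fun p => H.measurable_eval _ _
  have := integral_map (μ := P) h1.aemeasurable hG.aestronglyMeasurable
  rw [H.stationary h k, integral_map h2.aemeasurable hG.aestronglyMeasurable] at this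
  exact this.symm

lemma integral_mul_eq_fieldCorrelation (H : IsMixingField c P φ M) (t ρ : ℝ≥0) (x y : ℝ) :
    ∫ s, c (t + ρ) x s * c t y s ∂P = fieldCorrelation c P ρ (x - y) := by
  have := H.integral_comp_translate (F := fun u v => u * v)
    (measurable_fst.mul measurable_snd) 0 ρ t 0 (x - y) y
  simp only [zero_add, sub_add_cancel] at this
  rw [fieldCorrelation, ← this, add_comm ρ t]
  simp only [mul_comm]

/-- The mean size of the spatial increments of the field. -/
def meanIncrement (c : ℝ≥0 → ℝ → S → ℝ) (P : Measure S) (z : ℝ) : ℝ :=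
  ∫ s, |c 0 z s - c 0 0 s| ∂P

lemma integral_abs_increment (H : IsMixingField c P φ M) (t : ℝ≥0) (x z : ℝ) :
    ∫ s, |c t (z + x) s - c t x s| ∂P = meanIncrement c P z := by
  have := H.integral_comp_translate (F := fun u v => |u - v|)
    ((measurable_fst.sub measurable_snd).abs) 0 0 t z 0 x
  simpa only [zero_add, meanIncrement] using this

variable [IsProbabilityMeasure P]

lemma bound_nonneg (H : IsMixingField c P φ M) : 0 ≤ M := by
  obtain ⟨s⟩ := P.nonempty_of_neZero
  exact (abs_nonneg _).trans (H.bdd 0 0 s)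

lemma integrable_eval (H : IsMixingField c P φ M) (t : ℝ≥0) (x : ℝ) : Integrable (c t x) P :=
  Integrable.of_bound (H.measurable_eval t x).aestronglyMeasurable M
    (ae_of_all _ (H.bdd t x))

lemma meanIncrement_le (H : IsMixingField c P φ M) (z : ℝ) : meanIncrement c P z ≤ 2 * M := by
  have : meanIncrement c P z ≤ ∫ _, 2 * M ∂P := by
    refine integral_mono ((H.integrable_eval 0 z).sub (H.integrable_eval 0 0)).abs
      (integrable_const _) fun s => ?_
    exact (abs_sub _ _).trans (by linarith [H.bdd 0 z s, H.bdd 0 0 s])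
  simpa using this

/-- By stationarity the mean increment equals its average over base points in `(0, 1]`. For each
realization that average tends to zero by continuity of translations in `L¹`, and boundedness of the
field allows dominated convergence. -/
lemma tendsto_meanIncrement (H : IsMixingField c P φ M) :
    Tendsto (meanIncrement c P) (𝓝 0) (𝓝 0) := by
  have hM := H.bound_nonneg
  have hm0 : Measurable (fun p : S × ℝ => c 0 p.2 p.1) :=
    H.measurable.comp (measurable_const.prodMk (measurable_snd.prodMk measurable_fst))
  have hmz : ∀ z : ℝ, Measurable (fun p : S × ℝ => |c 0 (z + p.2) p.1 - c 0 p.2 p.1|) := fun z =>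
    ((H.measurable.comp (measurable_const.prodMk ((measurable_snd.const_add z).prodMk
      measurable_fst))).sub hm0).abs
  have hb2 : ∀ (z x : ℝ) (s : S), |c 0 (z + x) s - c 0 x s| ≤ 2 * M := fun z x s =>
    (abs_sub _ _).trans (by linarith [H.bdd 0 (z + x) s, H.bdd 0 x s])
  have e1 : ∀ z, meanIncrement c P z =
      ∫ s, (∫ x in Ioc (0 : ℝ) 1, |c 0 (z + x) s - c 0 x s|) ∂P := fun z => by
    rw [integral_integral_swap]
    · simp only [H.integral_abs_increment 0 _ z]
      simp
    · exact Integrable.of_bound (hmz z).aestronglyMeasurable (2 * M) (ae_of_all _ fun p => by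
        simp only [Function.uncurry, Real.norm_eq_abs, abs_abs]; exact hb2 _ _ _)
  have e2 : Tendsto (fun z => ∫ s, (∫ x in Ioc (0 : ℝ) 1, |c 0 (z + x) s - c 0 x s|) ∂P) (𝓝 0)
      (𝓝 (∫ _, (0 : ℝ) ∂P)) := by
    refine tendsto_integral_filter_of_dominated_convergence (fun _ => 2 * M) ?_ ?_
      (integrable_const _) (ae_of_all _ fun s => ?_)
    · exact Eventually.of_forall fun z =>
        (hmz z).stronglyMeasurable.integral_prod_right'.aestronglyMeasurable
    · refine Eventually.of_forall fun z => ae_of_all _ fun s => ?_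
      have := norm_setIntegral_le_of_norm_le_const (μ := volume) (s := Ioc (0 : ℝ) 1)
        (f := fun x => |c 0 (z + x) s - c 0 x s|) (C := 2 * M) measure_Ioc_lt_top
        (fun x _ => by rw [Real.norm_eq_abs, abs_abs]; exact hb2 _ _ _)
      simpa using this
    -- The window `[-1, 2]` contains `x` and `z + x` whenever `x ∈ (0, 1]` and `|z| ≤ 1`.
    · set f : ℝ → ℝ := (Icc (-1 : ℝ) 2).indicator (fun x => c 0 x s) with hf
      have hfi : Integrable f := by
        rw [hf, integrable_indicator_iff measurableSet_Icc]
        exact Integrable.of_bound (hm0.of_uncurry_left (f := fun s x => c 0 x s)).aestronglyMeasurable M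
          (ae_of_all _ fun x => H.bdd 0 x s)
      refine squeeze_zero' (Eventually.of_forall fun z => ?_) ?_
        (tendsto_integral_abs_translate_sub hfi)
      · exact integral_nonneg fun x => abs_nonneg _
      · have hev : ∀ᶠ z : ℝ in 𝓝 0, z ∈ Icc (-1 : ℝ) 1 := Icc_mem_nhds (by norm_num) (by norm_num)
        filter_upwards [hev] with z hz
        have hi : Integrable (fun x => |f (z + x) - f x|) := ((hfi.comp_add_left z).sub hfi).abs
        calc ∫ x in Ioc (0 : ℝ) 1, |c 0 (z + x) s - c 0 x s|
            = ∫ x in Ioc (0 : ℝ) 1, |f (z + x) - f x| := by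
              refine setIntegral_congr_fun measurableSet_Ioc fun x hx => ?_
              have h1 : z + x ∈ Icc (-1 : ℝ) 2 := ⟨by linarith [hz.1, hx.1], by linarith [hz.2, hx.2]⟩
              have h2 : x ∈ Icc (-1 : ℝ) 2 := ⟨by linarith [hx.1], by linarith [hx.2]⟩
              simp only [hf, indicator_of_mem h1, indicator_of_mem h2]
          _ ≤ ∫ x, |f (z + x) - f x| :=
              setIntegral_le_integral hi (ae_of_all _ fun x => abs_nonneg _)
  simp only [← e1, integral_zero] at e2
  exact e2

/-- The mean spatial increment is small plus a multiple of the squared displacement. -/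
lemma exists_meanIncrement_le_add_sq (H : IsMixingField c P φ M) {η : ℝ} (hη : 0 < η) :
    ∃ C : ℝ, 0 ≤ C ∧ ∀ z, meanIncrement c P z ≤ η + C * z ^ 2 := by
  have hM := H.bound_nonneg
  obtain ⟨r, hr, hrη⟩ := Metric.eventually_nhds_iff.1
    (H.tendsto_meanIncrement.eventually (gt_mem_nhds hη))
  -- Beyond distance `r` the trivial bound `2M` is absorbed by the square. Second moments of the
  -- displacement are then all that is needed of the paths.
  refine ⟨2 * M / r ^ 2, by positivity, fun z => ?_⟩
  rcases lt_or_ge |z| r with hz | hz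
  · have := hrη (y := z) (by simpa using hz)
    have : 0 ≤ 2 * M / r ^ 2 * z ^ 2 := by positivity
    linarith
  · refine (H.meanIncrement_le z).trans ?_
    have h1 : r ^ 2 ≤ z ^ 2 := by
      rw [← sq_abs z]; exact pow_le_pow_left₀ hr.le hz 2
    have h2 : 2 * M ≤ 2 * M / r ^ 2 * z ^ 2 := by
      rw [div_mul_eq_mul_div, le_div_iff₀ (by positivity)]
      exact mul_le_mul_of_nonneg_left h1 (by linarith)
    linarith

lemma abs_fieldCorrelation_sub_le (H : IsMixingField c P φ M) (ρ : ℝ≥0) (z : ℝ) :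
    |fieldCorrelation c P ρ z - fieldCorrelation c P ρ 0| ≤ M * meanIncrement c P z := by
  have hi : ∀ x, Integrable (fun s => c 0 0 s * c ρ x s) P := fun x =>
    (H.integrable_eval ρ x).bdd_mul (H.measurable_eval 0 0).aestronglyMeasurable
      (ae_of_all _ (H.bdd 0 0))
  unfold fieldCorrelation
  rw [← integral_sub (hi z) (hi 0), ← H.integral_abs_increment ρ 0 z, ← integral_const_mul,
    ← Real.norm_eq_abs, add_zero]
  refine norm_integral_le_of_norm_le
    (((H.integrable_eval ρ z).sub (H.integrable_eval ρ 0)).abs.const_mul M) (ae_of_all _ fun s => ?_)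
  rw [← mul_sub, norm_mul]
  exact mul_le_mul_of_nonneg_right (H.bdd 0 0 s) (norm_nonneg _)

/-- The covariance of the field at two points decays like the mixing rate in their distance. -/
lemma abs_integral_mul_le (H : IsMixingField c P φ M) {r : ℝ} (hr : 0 ≤ r) (t t' : ℝ≥0) (x x' : ℝ)
    (h : r ≤ planeDist (t, x) (t', x')) :
    |∫ s, c t x s * c t' x' s ∂P| ≤ 2 * M ^ 2 * φ r := by
  have hM := H.bound_nonneg
  have hmix := H.mixing {(t, x)} {(t', x')} r hr (fun p hp q hq => by
    rw [mem_singleton_iff] at hp hq; rwa [hp, hq])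
  have := hmix.abs_integral_mul_sub_le (fieldSigma_le H.measurable _) (fieldSigma_le H.measurable _)
    (measurable_fieldSigma c (mem_singleton (t, x))).stronglyMeasurable.aestronglyMeasurable
    (H.bdd t x)
    (measurable_fieldSigma c (mem_singleton (t', x'))).stronglyMeasurable.aestronglyMeasurable
    (H.integrable_eval t' x')
  rw [H.centered t x, zero_mul, sub_zero] at this
  have h1 : ∫ s, |c t' x' s| ∂P ≤ ∫ _, M ∂P :=
    integral_mono (H.integrable_eval t' x').abs (integrable_const _) (H.bdd t' x')
  simp only [integral_const, probReal_univ, smul_eq_mul, one_mul] at h1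
  calc _ ≤ 2 * M * φ r * ∫ s, |c t' x' s| ∂P := this
    _ ≤ 2 * M * φ r * M := mul_le_mul_of_nonneg_left h1 (mul_nonneg (by linarith) (H.nonneg r hr))
    _ = _ := by ring

lemma abs_fieldCorrelation_le (H : IsMixingField c P φ M) (ρ : ℝ≥0) (z : ℝ) :
    |fieldCorrelation c P ρ z| ≤ 2 * M ^ 2 * φ ρ := by
  refine H.abs_integral_mul_le ρ.2 0 ρ 0 z ?_
  have := le_planeDist_fst (0, 0) (ρ, z)
  simpa using this

lemma integrableOn_fieldCorrelation (H : IsMixingField c P φ M) :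
    IntegrableOn (fun r : ℝ => fieldCorrelation c P r.toNNReal 0) (Ioi 0) := by
  refine Integrable.mono' (H.integrable.const_mul (2 * M ^ 2)) ?_ ?_
  · have h1 : Measurable (fun p : ℝ × S => c 0 0 p.2 * c p.1.toNNReal 0 p.2) :=
      ((H.measurable_eval 0 0).comp measurable_snd).mul (H.measurable.comp
        (measurable_fst.real_toNNReal.prodMk (measurable_const.prodMk measurable_snd)))
    exact h1.stronglyMeasurable.integral_prod_right'.aestronglyMeasurable
  · refine (ae_restrict_iff' measurableSet_Ioi).2 (ae_of_all _ fun r hr => ?_)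
    have := H.abs_fieldCorrelation_le r.toNNReal 0
    rwa [Real.coe_toNNReal r (le_of_lt hr)] at this

/-- The combination of the values of the field along two paths. -/
def alongPaths (c : ℝ≥0 → ℝ → S → ℝ) (a b : ℝ) (p q : ℝ → ℝ) (r : ℝ) (s : S) : ℝ :=
  a * c r.toNNReal (p r) s + b * c r.toNNReal (q r) s

/-- To a set of times is attached the sigma-algebra of the field on the whole strip over it. Strips
are at least as far apart as their times, so the rate does not depend on the paths. -/
lemma isMixingProcess_alongPaths (H : IsMixingField c P φ M) {a b : ℝ} (ha : |a| ≤ 1)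
    (hb : |b| ≤ 1) {p q : ℝ → ℝ} (hp : Measurable p) (hq : Measurable q) :
    IsMixingProcess P (fun A => fieldSigma c {x | (x.1 : ℝ) ∈ A}) φ (alongPaths c a b p q)
      (2 * M) where
  le A := fieldSigma_le H.measurable _
  mono A A' h := fieldSigma_mono c fun x hx => h hx
  mixing A A' r hr h := H.mixing _ _ r hr fun x hx y hy =>
    (h _ hx _ hy).trans (le_planeDist_fst x y)
  antitone := H.antitone
  nonneg := H.nonneg
  measurable := by
    have h1 : ∀ p : ℝ → ℝ, Measurable p →
        Measurable (fun x : ℝ × S => c x.1.toNNReal (p x.1) x.2) := fun p hp =>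
      H.measurable.comp (measurable_fst.real_toNNReal.prodMk
        ((hp.comp measurable_fst).prodMk measurable_snd))
    exact ((h1 p hp).const_mul a).add ((h1 q hq).const_mul b)
  bdd r s := by
    refine (abs_add_le _ _).trans ?_
    rw [abs_mul, abs_mul]
    nlinarith [H.bdd r.toNNReal (p r) s, H.bdd r.toNNReal (q r) s, abs_nonneg a, abs_nonneg b,
      abs_nonneg (c r.toNNReal (p r) s), abs_nonneg (c r.toNNReal (q r) s), H.bound_nonneg]
  adapted r hr := by
    have h1 : ∀ x, Measurable[fieldSigma c {x | (x.1 : ℝ) ∈ ({r} : Set ℝ)}] (c r.toNNReal x) :=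
      fun x => measurable_fieldSigma c (by simp [Real.coe_toNNReal r hr])
    exact ((h1 _).const_mul a).add ((h1 _).const_mul b)
  centered r hr := by
    unfold alongPaths
    rw [integral_add ((H.integrable_eval _ _).const_mul _) ((H.integrable_eval _ _).const_mul _),
      integral_const_mul, integral_const_mul, H.centered, H.centered]
    ring

lemma integral_alongPaths_mul (H : IsMixingField c P φ M) (a b : ℝ) (p q : ℝ → ℝ) {t ρ : ℝ}
    (hρ : 0 ≤ ρ) (ht : ρ ≤ t) :
    ∫ s, alongPaths c a b p q t s * alongPaths c a b p q (t - ρ) s ∂P =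
      a ^ 2 * fieldCorrelation c P ρ.toNNReal (p t - p (t - ρ)) +
      b ^ 2 * fieldCorrelation c P ρ.toNNReal (q t - q (t - ρ)) +
      a * b * (fieldCorrelation c P ρ.toNNReal (p t - q (t - ρ)) +
        fieldCorrelation c P ρ.toNNReal (q t - p (t - ρ))) := by
  have ht' : t.toNNReal = (t - ρ).toNNReal + ρ.toNNReal := by
    rw [← Real.toNNReal_add (by linarith) hρ]; congr 1; ring
  have hi : ∀ (k : ℝ) (x y : ℝ), Integrable (fun s => k * (c t.toNNReal x s * c (t - ρ).toNNReal y s)) P :=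
    fun k x y => ((H.integrable_eval _ y).bdd_mul (H.measurable_eval _ x).aestronglyMeasurable
      (ae_of_all _ (H.bdd _ x))).const_mul k
  have he : ∀ x y, ∫ s, c t.toNNReal x s * c (t - ρ).toNNReal y s ∂P =
      fieldCorrelation c P ρ.toNNReal (x - y) := fun x y => by
    rw [ht']; exact H.integral_mul_eq_fieldCorrelation _ _ _ _
  have : ∀ s, alongPaths c a b p q t s * alongPaths c a b p q (t - ρ) s =
      a ^ 2 * (c t.toNNReal (p t) s * c (t - ρ).toNNReal (p (t - ρ)) s) +
      b ^ 2 * (c t.toNNReal (q t) s * c (t - ρ).toNNReal (q (t - ρ)) s) +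
      (a * b * (c t.toNNReal (p t) s * c (t - ρ).toNNReal (q (t - ρ)) s) +
      a * b * (c t.toNNReal (q t) s * c (t - ρ).toNNReal (p (t - ρ)) s)) := fun s => by
    unfold alongPaths; ring
  simp only [this]
  rw [integral_add (by exact (hi _ _ _).add (hi _ _ _)) (by exact (hi _ _ _).add (hi _ _ _)),
    integral_add (hi _ _ _) (hi _ _ _), integral_add (hi _ _ _) (hi _ _ _)]
  simp only [integral_const_mul, he]
  ring

/-- Only the spatial part of the distance is kept. This is where decorrelation in space enters; it
removes the cross terms of two distinct paths. -/
lemma abs_fieldCorrelation_le_abs (H : IsMixingField c P φ M) (ρ : ℝ≥0) (z : ℝ) :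
    |fieldCorrelation c P ρ z| ≤ 2 * M ^ 2 * φ |z| := by
  refine H.abs_integral_mul_le (abs_nonneg z) 0 ρ 0 z ?_
  have := le_planeDist_snd (0, 0) (ρ, z)
  simpa using this

end IsMixingField
end


/-! ### The field along a pair of rescaled paths -/

noncomputable section

lemma abs_exp_sub_exp_le {x y L : ℝ} (hx : x ≤ L) (hy : y ≤ L) :
    |Real.exp x - Real.exp y| ≤ Real.exp L * |x - y| := by
  have key : ∀ u v : ℝ, u ≤ L → Real.exp u - Real.exp v ≤ Real.exp L * |u - v| := fun u v hu => by
    have h1 := Real.add_one_le_exp (v - u)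
    have h2 : Real.exp v = Real.exp u * Real.exp (v - u) := by rw [← Real.exp_add]; ring_nf
    have h3 : Real.exp u - Real.exp v ≤ Real.exp u * (u - v) := by
      rw [h2]; nlinarith [Real.exp_pos u]
    refine h3.trans ((mul_le_mul_of_nonneg_left (le_abs_self _) (Real.exp_pos _).le).trans ?_)
    exact mul_le_mul_of_nonneg_right (Real.exp_le_exp.2 hu) (abs_nonneg _)
  rw [abs_le]
  constructor
  · have := key y x hy
    rw [abs_sub_comm y x] at this
    linarith
  · exact key x y hx

/-- The microscopic path `r ↦ W(r / Λ²) / δ` of a macroscopic path `W`. -/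
def microPath {Ω : Type*} (W : ℝ → Ω → ℝ) (Λ δ : ℝ) (ω : Ω) (r : ℝ) : ℝ :=
  W (r / Λ ^ 2) ω / δ

namespace IsMixingField

variable {S : Type*} [mS : MeasurableSpace S] {P : Measure S}
  {c : ℝ≥0 → ℝ → S → ℝ} {φ : ℝ → ℝ} {M : ℝ}
  {Ω : Type*} [MeasurableSpace Ω]

lemma measurable_alongPaths_microPath (H : IsMixingField c P φ M) (a b : ℝ)
    {W W' : ℝ → Ω → ℝ} (hW : Measurable (Function.uncurry W))
    (hW' : Measurable (Function.uncurry W')) (Λ δ : ℝ) :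
    Measurable (fun x : (ℝ × Ω) × S =>
      alongPaths c a b (microPath W Λ δ x.1.2) (microPath W' Λ δ x.1.2) x.1.1 x.2) := by
  have h1 : ∀ W : ℝ → Ω → ℝ, Measurable (Function.uncurry W) → Measurable
      (fun x : (ℝ × Ω) × S => c x.1.1.toNNReal (microPath W Λ δ x.1.2 x.1.1) x.2) := fun W hW => by
    refine H.measurable.comp (measurable_fst.fst.real_toNNReal.prodMk (Measurable.prodMk ?_
      measurable_snd))
    exact (hW.comp ((measurable_fst.fst.div_const _).prodMk measurable_fst.snd)).div_const _
  exact ((h1 W hW).const_mul a).add ((h1 W' hW').const_mul b)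

lemma measurable_fieldCorrelation (H : IsMixingField c P φ M) [SFinite P] (ρ : ℝ≥0) :
    Measurable (fieldCorrelation c P ρ) := by
  have h1 : Measurable (fun p : ℝ × S => c 0 0 p.2 * c ρ p.1 p.2) :=
    ((H.measurable_eval 0 0).comp measurable_snd).mul (H.measurable.comp
      (measurable_const.prodMk (measurable_fst.prodMk measurable_snd)))
  exact h1.stronglyMeasurable.integral_prod_right'.measurable

/-- The covariance of the field along a pair of paths at the macroscopic time `τ` and the
microscopic lag `ρ`, cut off at the lag `h`. -/
def pathCovariance (c : ℝ≥0 → ℝ → S → ℝ) (P : Measure S) (a b : ℝ) (W W' : ℝ → Ω → ℝ)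
    (Λ δ h : ℝ) (ω : Ω) (τ ρ : ℝ) : ℝ :=
  if ρ ≤ min h (Λ ^ 2 * τ) then
    ∫ s, alongPaths c a b (microPath W Λ δ ω) (microPath W' Λ δ ω) (Λ ^ 2 * τ) s *
      alongPaths c a b (microPath W Λ δ ω) (microPath W' Λ δ ω) (Λ ^ 2 * τ - ρ) s ∂P
  else 0

/-- With the cutoff moved into the integrand, the lags range over a domain that does not change in
the limit, as dominated convergence requires. -/
lemma truncatedCovariance_eq {Ω : Type*} (P : Measure S) (c : ℝ≥0 → ℝ → S → ℝ) (a b : ℝ)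
    (W W' : ℝ → Ω → ℝ) (Λ δ : ℝ) {h : ℝ} (hh : 0 ≤ h) (ω : Ω) {τ : ℝ} (hτ : 0 ≤ τ) :
    truncatedCovariance P (alongPaths c a b (microPath W Λ δ ω) (microPath W' Λ δ ω)) h (Λ ^ 2 * τ) =
      ∫ ρ in Ioi 0, pathCovariance c P a b W W' Λ δ h ω τ ρ := by
  unfold truncatedCovariance
  rw [intervalIntegral.integral_of_le (le_min hh (by positivity)),
    ← integral_indicator measurableSet_Ioc, ← integral_indicator measurableSet_Ioi]
  congr 1
  ext ρ
  unfold pathCovariance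
  simp only [indicator, mem_Ioc, mem_Ioi]
  split_ifs <;> simp_all

lemma measurable_pathCovariance [SFinite P] (H : IsMixingField c P φ M) (a b : ℝ)
    {W W' : ℝ → Ω → ℝ} (hW : Measurable (Function.uncurry W))
    (hW' : Measurable (Function.uncurry W')) (Λ δ h : ℝ) :
    Measurable (fun x : Ω × ℝ × ℝ => pathCovariance c P a b W W' Λ δ h x.1 x.2.1 x.2.2) := by
  have hm := H.measurable_alongPaths_microPath a b hW hW' Λ δ
  unfold pathCovariance
  refine Measurable.ite ?_ ?_ measurable_const
  · exact measurableSet_le measurable_snd.snd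
      (measurable_const.min (measurable_snd.fst.const_mul _))
  · have h1 : Measurable (fun y : (Ω × ℝ × ℝ) × S =>
        alongPaths c a b (microPath W Λ δ y.1.1) (microPath W' Λ δ y.1.1) (Λ ^ 2 * y.1.2.1) y.2) :=
      hm.comp (((measurable_fst.snd.fst.const_mul _).prodMk measurable_fst.fst).prodMk
        measurable_snd)
    have h2 : Measurable (fun y : (Ω × ℝ × ℝ) × S =>
        alongPaths c a b (microPath W Λ δ y.1.1) (microPath W' Λ δ y.1.1)
          (Λ ^ 2 * y.1.2.1 - y.1.2.2) y.2) :=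
      hm.comp ((((measurable_fst.snd.fst.const_mul _).sub measurable_fst.snd.snd).prodMk
        measurable_fst.fst).prodMk measurable_snd)
    exact (h1.mul h2).stronglyMeasurable.integral_prod_right'.measurable

variable [IsProbabilityMeasure P]

lemma measurable_microPath {W : ℝ → Ω → ℝ} (hW : Measurable (Function.uncurry W)) (Λ δ : ℝ) (ω : Ω) :
    Measurable (microPath W Λ δ ω) :=
  (hW.comp ((measurable_id.div_const _).prodMk measurable_const)).div_const _

/-- The process along two paths is bounded by `2M`, whence the constant `2(2M)²`. The majorant is
integrable in the lag and free of the paths and of the scales. -/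
lemma abs_pathCovariance_le (H : IsMixingField c P φ M) {a b : ℝ} (ha : |a| ≤ 1) (hb : |b| ≤ 1)
    {W W' : ℝ → Ω → ℝ} (hW : Measurable (Function.uncurry W))
    (hW' : Measurable (Function.uncurry W')) (Λ δ h : ℝ) (ω : Ω) (τ : ℝ) {ρ : ℝ} (hρ : 0 ≤ ρ) :
    |pathCovariance c P a b W W' Λ δ h ω τ ρ| ≤ 8 * M ^ 2 * φ ρ := by
  unfold pathCovariance
  split_ifs with hc
  · have := (H.isMixingProcess_alongPaths ha hb (measurable_microPath hW Λ δ ω)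
      (measurable_microPath hW' Λ δ ω)).abs_covariance_le hρ (hc.trans (min_le_right _ _))
    exact this.trans_eq (by ring)
  · rw [abs_zero]
    have := H.nonneg ρ hρ
    positivity

/-- The asymptotic variance along the paths, compared with the lag by lag covariances. -/
lemma enorm_integral_truncatedCovariance_sub_le (H : IsMixingField c P φ M) {a b : ℝ}
    (ha : |a| ≤ 1) (hb : |b| ≤ 1)
    {W W' : ℝ → Ω → ℝ} (hW : Measurable (Function.uncurry W))
    (hW' : Measurable (Function.uncurry W')) (Λ δ : ℝ) {h : ℝ} (hh : 0 ≤ h) (ω : Ω) {t : ℝ}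
    (ht : 0 ≤ t) :
    ‖(∫ τ in (0 : ℝ)..t, truncatedCovariance P
        (alongPaths c a b (microPath W Λ δ ω) (microPath W' Λ δ ω)) h (Λ ^ 2 * τ)) -
      (a ^ 2 + b ^ 2) * t * ∫ ρ in Ioi (0 : ℝ), fieldCorrelation c P ρ.toNNReal 0‖ₑ ≤
    ∫⁻ x, ‖pathCovariance c P a b W W' Λ δ h ω x.1 x.2 -
        (a ^ 2 + b ^ 2) * fieldCorrelation c P x.2.toNNReal 0‖ₑ
      ∂((volume.restrict (Ioc 0 t)).prod (volume.restrict (Ioi 0))) := by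
  have hm : Measurable (fun x : ℝ × ℝ => pathCovariance c P a b W W' Λ δ h ω x.1 x.2) :=
    (H.measurable_pathCovariance a b hW hW' Λ δ h).comp measurable_prodMk_left
  have hi0 : Integrable (fun ρ : ℝ => 8 * M ^ 2 * φ ρ) (volume.restrict (Ioi 0)) :=
    H.integrable.const_mul _
  have hi1 : Integrable (fun x : ℝ × ℝ => pathCovariance c P a b W W' Λ δ h ω x.1 x.2)
      ((volume.restrict (Ioc 0 t)).prod (volume.restrict (Ioi 0))) := by
    refine Integrable.mono' (hi0.comp_snd _) hm.aestronglyMeasurable ?_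
    have : ∀ᵐ x : ℝ × ℝ ∂((volume.restrict (Ioc 0 t)).prod (volume.restrict (Ioi 0))),
        x.2 ∈ Ioi (0 : ℝ) :=
      Measure.quasiMeasurePreserving_snd.ae (ae_restrict_mem measurableSet_Ioi)
    filter_upwards [this] with x hx
    exact H.abs_pathCovariance_le ha hb hW hW' Λ δ h ω x.1 (le_of_lt hx)
  have hi2 : Integrable (fun x : ℝ × ℝ => (a ^ 2 + b ^ 2) * fieldCorrelation c P x.2.toNNReal 0)
      ((volume.restrict (Ioc 0 t)).prod (volume.restrict (Ioi 0))) := by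
    have : Integrable (fun ρ : ℝ => (a ^ 2 + b ^ 2) * fieldCorrelation c P ρ.toNNReal 0)
        (volume.restrict (Ioi 0)) := H.integrableOn_fieldCorrelation.const_mul _
    exact this.comp_snd _
  have e1 : (∫ τ in (0 : ℝ)..t, truncatedCovariance P
        (alongPaths c a b (microPath W Λ δ ω) (microPath W' Λ δ ω)) h (Λ ^ 2 * τ)) =
      ∫ x, pathCovariance c P a b W W' Λ δ h ω x.1 x.2
        ∂((volume.restrict (Ioc 0 t)).prod (volume.restrict (Ioi 0))) := by
    rw [integral_prod _ hi1, intervalIntegral.integral_of_le ht]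
    refine setIntegral_congr_fun measurableSet_Ioc fun τ hτ => ?_
    exact truncatedCovariance_eq P c a b W W' Λ δ hh ω hτ.1.le
  have e2 : (a ^ 2 + b ^ 2) * t * ∫ ρ in Ioi (0 : ℝ), fieldCorrelation c P ρ.toNNReal 0 =
      ∫ x : ℝ × ℝ, (a ^ 2 + b ^ 2) * fieldCorrelation c P x.2.toNNReal 0
        ∂((volume.restrict (Ioc 0 t)).prod (volume.restrict (Ioi 0))) := by
    rw [integral_prod _ hi2]
    simp only [integral_const_mul, integral_const, smul_eq_mul, measureReal_restrict_apply_univ,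
      Real.volume_real_Ioc, sub_zero, max_eq_left ht]
    ring
  rw [e1, e2, ← integral_sub hi1 hi2]
  exact enorm_integral_le_lintegral_enorm _

/-- The logarithm of the exponential moment of the rescaled field along a pair of paths. -/
lemma exists_integral_exp_alongPaths (H : IsMixingField c P φ M) {a b : ℝ} (ha : |a| ≤ 1)
    (hb : |b| ≤ 1) {W W' : ℝ → Ω → ℝ} (hW : Measurable (Function.uncurry W))
    (hW' : Measurable (Function.uncurry W')) {Λ : ℝ} (hΛ : 0 < Λ) (δ : ℝ) {h : ℝ} (hh : 0 ≤ h)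
    (hMh : 2 * M * h ≤ Λ) (ω : Ω) {t : ℝ} (ht : 0 ≤ t) :
    ∃ κ, ∫ s, Real.exp (scaledPrimitive
        (alongPaths c a b (microPath W Λ δ ω) (microPath W' Λ δ ω)) Λ (Λ ^ 2 * t) s) ∂P =
        Real.exp κ ∧
      |κ - ∫ τ in (0 : ℝ)..t, truncatedCovariance P
        (alongPaths c a b (microPath W Λ δ ω) (microPath W' Λ δ ω)) h (Λ ^ 2 * τ)| ≤
      3 * t * (4 * M * (Λ * φ h) + 16 * M ^ 2 * (h * φ (h / 2)) + 24 * M ^ 3 * (h ^ 2 / Λ)) := by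
  obtain ⟨κ, h1, h2⟩ := (H.isMixingProcess_alongPaths ha hb (measurable_microPath hW Λ δ ω)
    (measurable_microPath hW' Λ δ ω)).exists_integral_exp_eq hΛ hh
      (T := Λ ^ 2 * t) (by positivity) hMh
  refine ⟨κ, h1, ?_⟩
  -- The microscopic duration `Λ²t` over `Λ` multiplies the error per unit time by `Λt`; the
  -- constants are those of a process bounded by `2M`.
  have e := intervalIntegral.integral_comp_mul_left (a := 0) (b := t) (c := Λ ^ 2)
    (truncatedCovariance P (alongPaths c a b (microPath W Λ δ ω) (microPath W' Λ δ ω)) h)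
    (by positivity)
  rw [mul_zero, smul_eq_mul] at e
  rw [e]
  refine h2.trans_eq ?_
  field_simp
  ring

lemma abs_integral_truncatedCovariance_le (H : IsMixingField c P φ M) {a b : ℝ} (ha : |a| ≤ 1)
    (hb : |b| ≤ 1) {W W' : ℝ → Ω → ℝ} (hW : Measurable (Function.uncurry W))
    (hW' : Measurable (Function.uncurry W')) (Λ δ : ℝ) {h : ℝ} (hh : 0 ≤ h)
    (ω : Ω) {t : ℝ} (ht : 0 ≤ t) :
    |∫ τ in (0 : ℝ)..t, truncatedCovariance P
        (alongPaths c a b (microPath W Λ δ ω) (microPath W' Λ δ ω)) h (Λ ^ 2 * τ)| ≤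
      2 * (2 * M) ^ 2 * (∫ r in Ioi 0, φ r) * t := by
  have := intervalIntegral.norm_integral_le_of_norm_le_const (a := 0) (b := t)
    (f := fun τ => truncatedCovariance P
        (alongPaths c a b (microPath W Λ δ ω) (microPath W' Λ δ ω)) h (Λ ^ 2 * τ))
    (C := 2 * (2 * M) ^ 2 * (∫ r in Ioi 0, φ r)) fun τ hτ => by
      rw [uIoc_of_le ht] at hτ
      have h0 := hτ.1.le
      exact (H.isMixingProcess_alongPaths ha hb (measurable_microPath hW Λ δ ω)
        (measurable_microPath hW' Λ δ ω)).abs_truncatedCovariance_le_integral H.integrable hh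
          (by positivity)
  rwa [sub_zero, abs_of_nonneg ht, Real.norm_eq_abs] at this

variable {μ : Measure Ω} [IsProbabilityMeasure μ] {ι : Type*} {l : Filter ι}

/-- The bound `η' + C z²` on the mean increment reduces the claim to mean square convergence of the
displacement; no almost sure convergence of `Z` is used. -/
lemma tendsto_lintegral_fieldCorrelation_sub (H : IsMixingField c P φ M) (ρ : ℝ≥0) {Z : ι → Ω → ℝ}
    (hZ : Tendsto (fun i => ∫⁻ ω, ENNReal.ofReal (Z i ω ^ 2) ∂μ) l (𝓝 0)) :
    Tendsto (fun i => ∫⁻ ω, ‖fieldCorrelation c P ρ (Z i ω) - fieldCorrelation c P ρ 0‖ₑ ∂μ) l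
      (𝓝 0) := by
  have hM := H.bound_nonneg
  rw [ENNReal.tendsto_nhds_zero]
  intro η hη
  obtain ⟨η', hη', hηη'⟩ : ∃ η' : ℝ, 0 < η' ∧ ENNReal.ofReal (M * η') ≤ η / 2 := by
    have h1 : Tendsto (fun x : ℝ => ENNReal.ofReal (M * x)) (𝓝[>] 0) (𝓝 (ENNReal.ofReal (M * 0))) :=
      ((ENNReal.continuous_ofReal.comp (continuous_const_mul M)).tendsto 0).mono_left
        nhdsWithin_le_nhds
    rw [mul_zero, ENNReal.ofReal_zero] at h1
    obtain ⟨x, hx, hx'⟩ := ((ENNReal.tendsto_nhds_zero.1 h1 (η / 2) (ENNReal.half_pos hη.ne')).and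
      self_mem_nhdsWithin).exists
    exact ⟨x, hx', hx⟩
  obtain ⟨C, hC, hψ⟩ := H.exists_meanIncrement_le_add_sq hη'
  have h2 : Tendsto (fun i => ENNReal.ofReal (M * C) * ∫⁻ ω, ENNReal.ofReal (Z i ω ^ 2) ∂μ) l
      (𝓝 (ENNReal.ofReal (M * C) * 0)) := ENNReal.Tendsto.const_mul hZ (Or.inr ENNReal.ofReal_ne_top)
  rw [mul_zero] at h2
  filter_upwards [ENNReal.tendsto_nhds_zero.1 h2 (η / 2) (ENNReal.half_pos hη.ne')] with i hi
  calc ∫⁻ ω, ‖fieldCorrelation c P ρ (Z i ω) - fieldCorrelation c P ρ 0‖ₑ ∂μ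
      ≤ ∫⁻ ω, (ENNReal.ofReal (M * η') + ENNReal.ofReal (M * C) * ENNReal.ofReal (Z i ω ^ 2)) ∂μ := by
        refine lintegral_mono fun ω => ?_
        rw [← ENNReal.ofReal_mul (by positivity), ← ENNReal.ofReal_add (by positivity)
          (by positivity), Real.enorm_eq_ofReal_abs]
        refine ENNReal.ofReal_le_ofReal ((H.abs_fieldCorrelation_sub_le ρ _).trans ?_)
        refine (mul_le_mul_of_nonneg_left (hψ _) hM).trans_eq (by ring)
    _ = ENNReal.ofReal (M * η') + ENNReal.ofReal (M * C) * ∫⁻ ω, ENNReal.ofReal (Z i ω ^ 2) ∂μ := by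
        rw [lintegral_add_left measurable_const, lintegral_const_mul' _ _ ENNReal.ofReal_ne_top]
        simp
    _ ≤ η / 2 + η / 2 := add_le_add hηη' hi
    _ = η := ENNReal.add_halves η

/-- Decay in time at the fixed lag supplies the constant majorant, and decay in space the pointwise
limit. -/
lemma tendsto_lintegral_fieldCorrelation [l.IsCountablyGenerated] (H : IsMixingField c P φ M)
    (hφ : Tendsto φ atTop (𝓝 0)) (ρ : ℝ≥0) {Z : ι → Ω → ℝ} (hZm : ∀ i, Measurable (Z i))
    (hZ : ∀ᵐ ω ∂μ, Tendsto (fun i => |Z i ω|) l atTop) :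
    Tendsto (fun i => ∫⁻ ω, ‖fieldCorrelation c P ρ (Z i ω)‖ₑ ∂μ) l (𝓝 0) := by
  have := tendsto_lintegral_filter_of_dominated_convergence (μ := μ) (l := l)
    (F := fun i ω => ‖fieldCorrelation c P ρ (Z i ω)‖ₑ) (f := fun _ => 0)
    (fun _ => ENNReal.ofReal (2 * M ^ 2 * φ ρ))
    (Eventually.of_forall fun i => ((H.measurable_fieldCorrelation ρ).comp (hZm i)).enorm)
    (Eventually.of_forall fun i => ae_of_all _ fun ω => by
      rw [Real.enorm_eq_ofReal_abs]
      exact ENNReal.ofReal_le_ofReal (H.abs_fieldCorrelation_le ρ _)) (by simp) ?_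
  · simpa using this
  · filter_upwards [hZ] with ω hω
    have h1 : Tendsto (fun i => ENNReal.ofReal (2 * M ^ 2 * φ |Z i ω|)) l (𝓝 0) := by
      have := ENNReal.tendsto_ofReal ((hφ.comp hω).const_mul (2 * M ^ 2))
      simpa using this
    refine tendsto_of_tendsto_of_tendsto_of_le_of_le tendsto_const_nhds h1 (fun _ => zero_le)
      fun i => ?_
    simp only
    rw [Real.enorm_eq_ofReal_abs]
    exact ENNReal.ofReal_le_ofReal (H.abs_fieldCorrelation_le_abs ρ _)

end IsMixingField
end


/-! ### Convergence of covariances and exponential moments along diffusive pairs -/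

noncomputable section

/-- A pair of continuous processes on `[0, t]` with the increments of a Brownian motion, which
almost surely do not meet at a given time. -/
structure IsDiffusivePair {Ω : Type*} [MeasurableSpace Ω] (W W' : ℝ → Ω → ℝ) (μ : Measure Ω)
    (t : ℝ) : Prop where
  measurable : Measurable (Function.uncurry W)
  measurable' : Measurable (Function.uncurry W')
  continuous : ∀ ω, Continuous fun τ => W τ ω
  continuous' : ∀ ω, Continuous fun τ => W' τ ω
  sq_increment : ∀ τ ∈ Icc 0 t, ∀ τ' ∈ Icc 0 t,
    ∫⁻ ω, ENNReal.ofReal ((W τ ω - W τ' ω) ^ 2) ∂μ ≤ ENNReal.ofReal |τ - τ'|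
  sq_increment' : ∀ τ ∈ Icc 0 t, ∀ τ' ∈ Icc 0 t,
    ∫⁻ ω, ENNReal.ofReal ((W' τ ω - W' τ' ω) ^ 2) ∂μ ≤ ENNReal.ofReal |τ - τ'|
  ne : ∀ τ ∈ Ioo 0 t, ∀ᵐ ω ∂μ, W τ ω ≠ W' τ ω

section Limits

variable {Ω : Type*} {ι : Type*} {l : Filter ι} {Λ δ : ι → ℝ}

lemma tendsto_sub_div_sq (hΛ : Tendsto Λ l atTop) (τ ρ : ℝ) :
    Tendsto (fun i => τ - ρ / Λ i ^ 2) l (𝓝 τ) := by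
  have h1 : Tendsto (fun i => Λ i ^ 2) l atTop := (tendsto_pow_atTop two_ne_zero).comp hΛ
  have := (tendsto_const_nhds (x := τ)).sub ((tendsto_const_nhds (x := ρ)).div_atTop h1)
  simpa using this

/-- The rescaled distance of two paths that do not meet tends to infinity. -/
lemma tendsto_abs_sub_div_atTop {W W' : ℝ → Ω → ℝ} {ω : Ω} (hW' : Continuous fun τ => W' τ ω)
    (hΛ : Tendsto Λ l atTop) (hδ : Tendsto δ l (𝓝[>] 0)) {τ : ℝ} (ρ : ℝ)
    (hne : W τ ω ≠ W' τ ω) :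
    Tendsto (fun i => |(W τ ω - W' (τ - ρ / Λ i ^ 2) ω) / δ i|) l atTop := by
  have h1 : Tendsto (fun i => |W τ ω - W' (τ - ρ / Λ i ^ 2) ω|) l (𝓝 |W τ ω - W' τ ω|) :=
    ((tendsto_const_nhds.sub ((hW'.tendsto τ).comp (tendsto_sub_div_sq hΛ τ ρ)))).abs
  have h2 : Tendsto (fun i => |δ i|⁻¹) l atTop := by
    have := tendsto_inv_nhdsGT_zero.comp hδ
    refine this.congr' ?_
    filter_upwards [hδ.eventually self_mem_nhdsWithin] with i hi
    rw [Function.comp_apply, abs_of_pos hi]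
  have := h1.pos_mul_atTop (abs_pos.2 (sub_ne_zero.2 hne)) h2
  exact this.congr fun i => by rw [abs_div, div_eq_mul_inv |_|]

variable [MeasurableSpace Ω] {μ : Measure Ω}

/-- The rescaled increments over a fixed microscopic lag vanish in mean square. -/
lemma tendsto_lintegral_sq_increment {W : ℝ → Ω → ℝ} {t : ℝ}
    (hW : ∀ τ ∈ Icc 0 t, ∀ τ' ∈ Icc 0 t,
      ∫⁻ ω, ENNReal.ofReal ((W τ ω - W τ' ω) ^ 2) ∂μ ≤ ENNReal.ofReal |τ - τ'|)
    (hΛ : Tendsto Λ l atTop) (hΛδ : Tendsto (fun i => Λ i * δ i) l atTop)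
    {τ ρ : ℝ} (hτ : τ ∈ Ioo 0 t) (hρ : 0 < ρ) :
    Tendsto (fun i => ∫⁻ ω, ENNReal.ofReal (((W τ ω - W (τ - ρ / Λ i ^ 2) ω) / δ i) ^ 2) ∂μ) l
      (𝓝 0) := by
  -- The mean square displacement over the time `ρ/Λ²` is at most `ρ/Λ²`; it is negligible against
  -- `δ²` because `Λδ` tends to infinity.
  have h1 : Tendsto (fun i => ENNReal.ofReal (ρ / (Λ i * δ i) ^ 2)) l (𝓝 0) := by
    have h2 : Tendsto (fun i => (Λ i * δ i) ^ 2) l atTop :=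
      (tendsto_pow_atTop two_ne_zero).comp hΛδ
    have := ENNReal.tendsto_ofReal ((tendsto_const_nhds (x := ρ)).div_atTop h2)
    simpa using this
  refine tendsto_of_tendsto_of_tendsto_of_le_of_le' tendsto_const_nhds h1
    (Eventually.of_forall fun _ => zero_le) ?_
  filter_upwards [(tendsto_sub_div_sq hΛ τ ρ).eventually (Icc_mem_nhds hτ.1 hτ.2),
    hΛ.eventually_gt_atTop 0, hΛδ.eventually_gt_atTop 0] with i hi hΛi hδi
  have hδ : 0 < δ i := (mul_pos_iff_of_pos_left hΛi).1 hδi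
  calc ∫⁻ ω, ENNReal.ofReal (((W τ ω - W (τ - ρ / Λ i ^ 2) ω) / δ i) ^ 2) ∂μ
      = ENNReal.ofReal ((δ i ^ 2)⁻¹) *
          ∫⁻ ω, ENNReal.ofReal ((W τ ω - W (τ - ρ / Λ i ^ 2) ω) ^ 2) ∂μ := by
        rw [← lintegral_const_mul' _ _ ENNReal.ofReal_ne_top]
        refine lintegral_congr fun ω => ?_
        rw [← ENNReal.ofReal_mul (by positivity), div_pow, div_eq_inv_mul]
    _ ≤ ENNReal.ofReal ((δ i ^ 2)⁻¹) * ENNReal.ofReal |τ - (τ - ρ / Λ i ^ 2)| := by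
        gcongr
        exact hW _ ⟨hτ.1.le, hτ.2.le⟩ _ hi
    _ = ENNReal.ofReal (ρ / (Λ i * δ i) ^ 2) := by
        rw [← ENNReal.ofReal_mul (by positivity), sub_sub_cancel, abs_of_pos (by positivity)]
        congr 1
        field_simp

end Limits

namespace IsMixingField

variable {S : Type*} [mS : MeasurableSpace S] {P : Measure S} [IsProbabilityMeasure P]
  {c : ℝ≥0 → ℝ → S → ℝ} {φ : ℝ → ℝ} {M : ℝ}
  {Ω : Type*} [MeasurableSpace Ω] {μ : Measure Ω} [IsProbabilityMeasure μ]
  {ι : Type*} {l : Filter ι} [l.IsCountablyGenerated] {Λ δ h : ι → ℝ}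

/-- At a fixed time and lag the covariance splits into two diagonal and two cross correlations. The
diagonal displacements vanish in mean square, and the cross displacements tend to infinity almost
surely since the paths differ at time `τ`. -/
lemma tendsto_lintegral_pathCovariance_sub (H : IsMixingField c P φ M)
    (hφ : Tendsto φ atTop (𝓝 0)) {a b : ℝ} (ha : |a| ≤ 1) (hb : |b| ≤ 1) {W W' : ℝ → Ω → ℝ} {t : ℝ}
    (D : IsDiffusivePair W W' μ t) (hΛ : Tendsto Λ l atTop) (hδ : Tendsto δ l (𝓝[>] 0))
    (hΛδ : Tendsto (fun i => Λ i * δ i) l atTop) (hh : Tendsto h l atTop)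
    {τ ρ : ℝ} (hτ : τ ∈ Ioo 0 t) (hρ : 0 < ρ) :
    Tendsto (fun i => ∫⁻ ω, ‖pathCovariance c P a b W W' (Λ i) (δ i) (h i) ω τ ρ -
        (a ^ 2 + b ^ 2) * fieldCorrelation c P ρ.toNNReal 0‖ₑ ∂μ) l (𝓝 0) := by
  set Φ := fieldCorrelation c P ρ.toNNReal with hΦ
  have hΦm : Measurable Φ := H.measurable_fieldCorrelation _
  have hWm : ∀ τ, Measurable (W τ) := fun τ => D.measurable.of_uncurry_left
  have hWm' : ∀ τ, Measurable (W' τ) := fun τ => D.measurable'.of_uncurry_left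
  have t1 := H.tendsto_lintegral_fieldCorrelation_sub ρ.toNNReal
    (tendsto_lintegral_sq_increment D.sq_increment hΛ hΛδ hτ hρ)
  have t2 := H.tendsto_lintegral_fieldCorrelation_sub ρ.toNNReal
    (tendsto_lintegral_sq_increment D.sq_increment' hΛ hΛδ hτ hρ)
  have t3 := H.tendsto_lintegral_fieldCorrelation (μ := μ) hφ ρ.toNNReal
    (Z := fun i ω => (W τ ω - W' (τ - ρ / Λ i ^ 2) ω) / δ i)
    (fun i => ((hWm _).sub (hWm' _)).div_const _) ((D.ne τ hτ).mono fun ω hω =>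
      tendsto_abs_sub_div_atTop (D.continuous' ω) hΛ hδ ρ hω)
  have t4 := H.tendsto_lintegral_fieldCorrelation (μ := μ) hφ ρ.toNNReal
    (Z := fun i ω => (W' τ ω - W (τ - ρ / Λ i ^ 2) ω) / δ i)
    (fun i => ((hWm' _).sub (hWm _)).div_const _) ((D.ne τ hτ).mono fun ω hω =>
      tendsto_abs_sub_div_atTop (D.continuous ω) hΛ hδ ρ hω.symm)
  have tsum := (t1.add t2).add (t3.add t4)
  simp only [add_zero] at tsum
  have hΛ2 : Tendsto (fun i => Λ i ^ 2 * τ) l atTop :=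
    ((tendsto_pow_atTop two_ne_zero).comp hΛ).atTop_mul_const hτ.1
  refine tendsto_of_tendsto_of_tendsto_of_le_of_le' tendsto_const_nhds tsum
    (Eventually.of_forall fun _ => zero_le) ?_
  -- Eventually the cutoff is inactive at the given lag.
  filter_upwards [hh.eventually_ge_atTop ρ, hΛ2.eventually_ge_atTop ρ, hΛ.eventually_gt_atTop 0]
    with i hi hi2 hΛi
  rw [← lintegral_add_left, ← lintegral_add_left, ← lintegral_add_left]
  rotate_left
  · exact (((hΦm.comp (((hWm _).sub (hWm _)).div_const _)).sub_const _).enorm).add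
      (((hΦm.comp (((hWm' _).sub (hWm' _)).div_const _)).sub_const _).enorm)
  · exact (hΦm.comp (((hWm _).sub (hWm' _)).div_const _)).enorm
  · exact ((hΦm.comp (((hWm _).sub (hWm _)).div_const _)).sub_const _).enorm
  refine lintegral_mono fun ω => ?_
  have e0 : Λ i ^ 2 * τ / Λ i ^ 2 = τ := by field_simp
  have e1 : (Λ i ^ 2 * τ - ρ) / Λ i ^ 2 = τ - ρ / Λ i ^ 2 := by field_simp
  unfold pathCovariance
  rw [if_pos (le_min hi hi2), H.integral_alongPaths_mul a b _ _ hρ.le hi2]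
  simp only [microPath, e0, e1, ← sub_div, ← hΦ]
  set x1 := Φ ((W τ ω - W (τ - ρ / Λ i ^ 2) ω) / δ i)
  set x2 := Φ ((W' τ ω - W' (τ - ρ / Λ i ^ 2) ω) / δ i)
  set x3 := Φ ((W τ ω - W' (τ - ρ / Λ i ^ 2) ω) / δ i)
  set x4 := Φ ((W' τ ω - W (τ - ρ / Λ i ^ 2) ω) / δ i)
  have e2 : a ^ 2 * x1 + b ^ 2 * x2 + a * b * (x3 + x4) - (a ^ 2 + b ^ 2) * Φ 0 =
      a ^ 2 * (x1 - Φ 0) + b ^ 2 * (x2 - Φ 0) + (a * b * x3 + a * b * x4) := by ring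
  have hmul : ∀ k x : ℝ, |k| ≤ 1 → ‖k * x‖ₑ ≤ ‖x‖ₑ := fun k x hk => by
    rw [enorm_mul, Real.enorm_eq_ofReal_abs k]
    refine (mul_le_mul_left (ENNReal.ofReal_le_ofReal hk) _).trans ?_
    simp
  have ha2 : |a ^ 2| ≤ 1 := by rw [abs_pow]; exact pow_le_one₀ (abs_nonneg _) ha
  have hb2 : |b ^ 2| ≤ 1 := by rw [abs_pow]; exact pow_le_one₀ (abs_nonneg _) hb
  have hab : |a * b| ≤ 1 := by rw [abs_mul]; exact mul_le_one₀ ha (abs_nonneg _) hb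
  rw [e2]
  refine (enorm_add_le _ _).trans (add_le_add ((enorm_add_le _ _).trans (add_le_add
    (hmul _ _ ha2) (hmul _ _ hb2))) ((enorm_add_le _ _).trans (add_le_add
    (hmul _ _ hab) (hmul _ _ hab))))

/-- Convergence in mean of the asymptotic variance along a pair of paths. -/
lemma tendsto_lintegral_truncatedCovariance_sub (H : IsMixingField c P φ M)
    (hφ : Tendsto φ atTop (𝓝 0)) {a b : ℝ} (ha : |a| ≤ 1) (hb : |b| ≤ 1) {W W' : ℝ → Ω → ℝ} {t : ℝ}
    (ht : 0 ≤ t) (D : IsDiffusivePair W W' μ t) (hΛ : Tendsto Λ l atTop)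
    (hδ : Tendsto δ l (𝓝[>] 0)) (hΛδ : Tendsto (fun i => Λ i * δ i) l atTop)
    (hh : Tendsto h l atTop) :
    Tendsto (fun i => ∫⁻ ω, ‖(∫ τ in (0 : ℝ)..t, truncatedCovariance P
        (alongPaths c a b (microPath W (Λ i) (δ i) ω) (microPath W' (Λ i) (δ i) ω)) (h i)
          (Λ i ^ 2 * τ)) -
      (a ^ 2 + b ^ 2) * t * ∫ ρ in Ioi (0 : ℝ), fieldCorrelation c P ρ.toNNReal 0‖ₑ ∂μ) l (𝓝 0) := by
  set ν : Measure (ℝ × ℝ) := (volume.restrict (Ioc 0 t)).prod (volume.restrict (Ioi 0)) with hν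
  set F : ι → Ω → ℝ × ℝ → ℝ≥0∞ := fun i ω x =>
    ‖pathCovariance c P a b W W' (Λ i) (δ i) (h i) ω x.1 x.2 -
        (a ^ 2 + b ^ 2) * fieldCorrelation c P x.2.toNNReal 0‖ₑ with hF
  have hΦm : Measurable (fun x : Ω × ℝ × ℝ => fieldCorrelation c P x.2.2.toNNReal 0) := by
    have h1 : Measurable (fun p : (Ω × ℝ × ℝ) × S => c 0 0 p.2 * c p.1.2.2.toNNReal 0 p.2) :=
      ((H.measurable_eval 0 0).comp measurable_snd).mul (H.measurable.comp
        (measurable_fst.snd.snd.real_toNNReal.prodMk (measurable_const.prodMk measurable_snd)))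
    exact h1.stronglyMeasurable.integral_prod_right'.measurable
  have hFm : ∀ i, Measurable (Function.uncurry (F i)) := fun i =>
    ((H.measurable_pathCovariance a b D.measurable D.measurable' (Λ i) (δ i) (h i)).sub
      (hΦm.const_mul _)).enorm
  have hs1 : ∀ᵐ x : ℝ × ℝ ∂ν, x.2 ∈ Ioi (0 : ℝ) :=
    Measure.quasiMeasurePreserving_snd.ae (ae_restrict_mem measurableSet_Ioi)
  have hs2 : ∀ᵐ x : ℝ × ℝ ∂ν, x.1 ∈ Ioo (0 : ℝ) t := by
    refine Measure.quasiMeasurePreserving_fst.ae ?_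
    rw [← restrict_Ioo_eq_restrict_Ioc]
    exact ae_restrict_mem measurableSet_Ioo
  -- Taking the mean over the paths first, one applies dominated convergence in `(τ, ρ)`. The
  -- majorant adds `8M²φ` for the path covariance and twice `2M²φ` for the limit.
  have key : Tendsto (fun i => ∫⁻ x, ∫⁻ ω, F i ω x ∂μ ∂ν) l (𝓝 (∫⁻ _, 0 ∂ν)) := by
    refine tendsto_lintegral_filter_of_dominated_convergence
      (fun x => ENNReal.ofReal (12 * M ^ 2 * φ x.2))
      (Eventually.of_forall fun i => (hFm i).lintegral_prod_left') ?_ ?_ ?_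
    · refine Eventually.of_forall fun i => ?_
      filter_upwards [hs1] with x hx
      have hx' : (0 : ℝ) ≤ x.2 := le_of_lt hx
      have : ∀ ω, F i ω x ≤ ENNReal.ofReal (12 * M ^ 2 * φ x.2) := fun ω => by
        rw [hF]
        simp only
        rw [Real.enorm_eq_ofReal_abs]
        refine ENNReal.ofReal_le_ofReal ((abs_sub _ _).trans ?_)
        have h1 := H.abs_pathCovariance_le ha hb D.measurable D.measurable' (Λ i) (δ i) (h i) ω x.1
          hx'
        have h2 := H.abs_fieldCorrelation_le x.2.toNNReal 0
        rw [Real.coe_toNNReal _ hx'] at h2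
        have ha2 : a ^ 2 ≤ 1 := by rw [← sq_abs]; exact pow_le_one₀ (abs_nonneg _) ha
        have hb2 : b ^ 2 ≤ 1 := by rw [← sq_abs]; exact pow_le_one₀ (abs_nonneg _) hb
        rw [abs_mul, abs_of_nonneg (by positivity : 0 ≤ a ^ 2 + b ^ 2)]
        have h3 : (a ^ 2 + b ^ 2) * |fieldCorrelation c P x.2.toNNReal 0| ≤
            2 * (2 * M ^ 2 * φ x.2) :=
          mul_le_mul (by linarith) h2 (abs_nonneg _) (by norm_num)
        linarith
      calc ∫⁻ ω, F i ω x ∂μ ≤ ∫⁻ _, ENNReal.ofReal (12 * M ^ 2 * φ x.2) ∂μ := lintegral_mono this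
        _ = _ := by simp
    · have hi0 : Integrable (fun ρ : ℝ => 12 * M ^ 2 * φ ρ) (volume.restrict (Ioi 0)) :=
        H.integrable.const_mul _
      exact (hi0.comp_snd (volume.restrict (Ioc 0 t))).lintegral_lt_top.ne
    · filter_upwards [hs1, hs2] with x hx1 hx2
      exact H.tendsto_lintegral_pathCovariance_sub hφ ha hb D hΛ hδ hΛδ hh hx2 hx1
  rw [lintegral_zero] at key
  refine tendsto_of_tendsto_of_tendsto_of_le_of_le' tendsto_const_nhds key
    (Eventually.of_forall fun _ => zero_le) ?_
  filter_upwards [hh.eventually_ge_atTop 0] with i hi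
  rw [← lintegral_lintegral_swap (hFm i).aemeasurable]
  exact lintegral_mono fun ω => H.enorm_integral_truncatedCovariance_sub_le ha hb D.measurable
    D.measurable' (Λ i) (δ i) hi ω ht

/-- The exponential moments of the rescaled field along a pair of diffusive paths are bounded and
converge in mean to the exponential moments of independent Gaussian variables. -/
theorem tendsto_lintegral_exp_alongPaths (H : IsMixingField c P φ M)
    (hφ : Tendsto φ atTop (𝓝 0)) {a b : ℝ} (ha : |a| ≤ 1) (hb : |b| ≤ 1) {W W' : ℝ → Ω → ℝ} {t : ℝ}
    (ht : 0 ≤ t) (D : IsDiffusivePair W W' μ t) (hΛ : Tendsto Λ l atTop)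
    (hδ : Tendsto δ l (𝓝[>] 0)) (hΛδ : Tendsto (fun i => Λ i * δ i) l atTop)
    (hh : Tendsto h l atTop) (h1 : Tendsto (fun i => Λ i * φ (h i)) l (𝓝 0))
    (h2 : Tendsto (fun i => h i * φ (h i / 2)) l (𝓝 0))
    (h3 : Tendsto (fun i => h i ^ 2 / Λ i) l (𝓝 0)) :
    (∃ K : ℝ, ∀ᶠ i in l, ∀ ω, ∫ s, Real.exp (scaledPrimitive (alongPaths c a b
      (microPath W (Λ i) (δ i) ω) (microPath W' (Λ i) (δ i) ω)) (Λ i) (Λ i ^ 2 * t) s) ∂P ≤ K) ∧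
    Tendsto (fun i => ∫⁻ ω, ‖(∫ s, Real.exp (scaledPrimitive (alongPaths c a b
      (microPath W (Λ i) (δ i) ω) (microPath W' (Λ i) (δ i) ω)) (Λ i) (Λ i ^ 2 * t) s) ∂P) -
      Real.exp ((a ^ 2 + b ^ 2) * t * ∫ ρ in Ioi (0 : ℝ), fieldCorrelation c P ρ.toNNReal 0)‖ₑ ∂μ)
      l (𝓝 0) := by
  have hM := H.bound_nonneg
  set E : ι → ℝ := fun i => 3 * t * (4 * M * (Λ i * φ (h i)) + 16 * M ^ 2 * (h i * φ (h i / 2)) +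
    24 * M ^ 3 * (h i ^ 2 / Λ i)) with hE
  have hE0 : Tendsto E l (𝓝 0) := by
    have := (((h1.const_mul (4 * M)).add (h2.const_mul (16 * M ^ 2))).add
      (h3.const_mul (24 * M ^ 3))).const_mul (3 * t)
    simpa using this
  set κ₀ := (a ^ 2 + b ^ 2) * t * ∫ ρ in Ioi (0 : ℝ), fieldCorrelation c P ρ.toNNReal 0 with hκ₀
  -- A common upper bound for the logarithms and their limit, uniform in the paths, on which the
  -- exponential is Lipschitz.
  set L := max (2 * (2 * M) ^ 2 * (∫ r in Ioi 0, φ r) * t + 1) κ₀ with hL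
  -- Since `h ≥ 1` eventually, `2Mh ≤ 2Mh²`, and this is below `Λ` because `h²/Λ` tends to zero.
  have hsmall : ∀ᶠ i in l, 2 * M * h i ≤ Λ i := by
    have h4 : Tendsto (fun i => 2 * M * (h i ^ 2 / Λ i)) l (𝓝 0) := by
      simpa using h3.const_mul (2 * M)
    filter_upwards [h4.eventually (gt_mem_nhds one_pos), hΛ.eventually_gt_atTop 0,
      hh.eventually_ge_atTop 1] with i hi hΛi hhi
    rw [← mul_div_assoc, div_lt_one hΛi] at hi
    nlinarith [mul_nonneg hM (by linarith : (0 : ℝ) ≤ h i)]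
  have hmain : ∀ᶠ i in l, ∀ ω, ∃ κ ≤ L,
      ∫ s, Real.exp (scaledPrimitive (alongPaths c a b (microPath W (Λ i) (δ i) ω)
        (microPath W' (Λ i) (δ i) ω)) (Λ i) (Λ i ^ 2 * t) s) ∂P = Real.exp κ ∧
      |κ - ∫ τ in (0 : ℝ)..t, truncatedCovariance P (alongPaths c a b (microPath W (Λ i) (δ i) ω)
        (microPath W' (Λ i) (δ i) ω)) (h i) (Λ i ^ 2 * τ)| ≤ E i := by
    filter_upwards [hsmall, hΛ.eventually_gt_atTop 0, hh.eventually_ge_atTop 0,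
      hE0.eventually (gt_mem_nhds one_pos)] with i hi hΛi hhi hEi ω
    obtain ⟨κ, e1, e2⟩ := H.exists_integral_exp_alongPaths ha hb D.measurable D.measurable' hΛi
      (δ i) hhi hi ω ht
    refine ⟨κ, ?_, e1, e2⟩
    have e3 := H.abs_integral_truncatedCovariance_le ha hb D.measurable D.measurable' (Λ i)
      (δ i) hhi ω ht
    refine le_trans ?_ (le_max_left _ _)
    have := le_of_abs_le e3
    have := le_of_abs_le e2
    linarith
  refine ⟨⟨Real.exp L, ?_⟩, ?_⟩
  · filter_upwards [hmain] with i hi ω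
    obtain ⟨κ, hκ, e1, -⟩ := hi ω
    rw [e1]
    exact Real.exp_le_exp.2 hκ
  · have t1 := H.tendsto_lintegral_truncatedCovariance_sub (μ := μ) hφ ha hb ht D hΛ hδ hΛδ hh
    have t2 : Tendsto (fun i => ENNReal.ofReal (Real.exp L) * (ENNReal.ofReal (E i) +
        ∫⁻ ω, ‖(∫ τ in (0 : ℝ)..t, truncatedCovariance P
          (alongPaths c a b (microPath W (Λ i) (δ i) ω) (microPath W' (Λ i) (δ i) ω)) (h i)
            (Λ i ^ 2 * τ)) - κ₀‖ₑ ∂μ)) l (𝓝 0) := by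
      have := ENNReal.Tendsto.const_mul ((ENNReal.tendsto_ofReal hE0).add t1)
        (Or.inr (ENNReal.ofReal_ne_top (r := Real.exp L)))
      simpa using this
    refine tendsto_of_tendsto_of_tendsto_of_le_of_le' tendsto_const_nhds t2
      (Eventually.of_forall fun _ => zero_le) ?_
    filter_upwards [hmain] with i hi
    have hone : ENNReal.ofReal (E i) = ∫⁻ _, ENNReal.ofReal (E i) ∂μ := by simp
    rw [hone, ← lintegral_add_left measurable_const, ← lintegral_const_mul' _ _ ENNReal.ofReal_ne_top]
    refine lintegral_mono fun ω => ?_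
    obtain ⟨κ, hκ, e1, e2⟩ := hi ω
    simp only [e1]
    rw [Real.enorm_eq_ofReal_abs, Real.enorm_eq_ofReal_abs]
    rw [← ENNReal.ofReal_add ((abs_nonneg _).trans e2) (abs_nonneg _),
      ← ENNReal.ofReal_mul (Real.exp_pos _).le]
    refine ENNReal.ofReal_le_ofReal ((abs_exp_sub_exp_le hκ (le_max_right _ _)).trans ?_)
    refine mul_le_mul_of_nonneg_left ?_ (Real.exp_pos _).le
    refine (abs_sub_le _ _ _).trans (add_le_add e2 le_rfl)

end IsMixingField
end


/-! ### Mean square convergence of the weighted exponential functionals -/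

noncomputable section

/-- Bounded functions that converge to zero in mean also do so against a square integrable
weight. -/
lemma tendsto_integral_mul_of_lintegral {Ω : Type*} [MeasurableSpace Ω] {μ : Measure Ω} {ι : Type*}
    {l : Filter ι} {f : Ω → ℝ} (hf : MemLp f 2 μ) {H : ι → Ω → ℝ} (hH : ∀ i, Measurable (H i))
    {K : ℝ} (hK : ∀ᶠ i in l, ∀ ω, |H i ω| ≤ K)
    (hlim : Tendsto (fun i => ∫⁻ ω, ‖H i ω‖ₑ ∂μ) l (𝓝 0)) :
    Tendsto (fun i => ∫ ω, f ω * H i ω ∂μ) l (𝓝 0) := by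
  have hA : (∫⁻ ω, ‖f ω‖ₑ ^ (2 : ℝ) ∂μ) ^ (1 / 2 : ℝ) ≠ ∞ := by
    have := (lintegral_rpow_enorm_lt_top_of_eLpNorm_lt_top (by norm_num) (by norm_num) hf.2).ne
    refine ENNReal.rpow_ne_top_of_nonneg (by norm_num) ?_
    simpa using this
  -- Cauchy–Schwarz together with `|H|² ≤ K|H|`.
  have h1 : Tendsto (fun i => (∫⁻ ω, ‖f ω‖ₑ ^ (2 : ℝ) ∂μ) ^ (1 / 2 : ℝ) *
      (ENNReal.ofReal K * ∫⁻ ω, ‖H i ω‖ₑ ∂μ) ^ (1 / 2 : ℝ)) l (𝓝 0) := by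
    have h2 := (ENNReal.Tendsto.const_mul hlim (Or.inr (ENNReal.ofReal_ne_top (r := K))))
    have h3 := ((ENNReal.continuous_rpow_const (y := (1 / 2 : ℝ))).tendsto _).comp h2
    have h4 := ENNReal.Tendsto.const_mul h3 (Or.inr hA)
    simpa using h4
  rw [tendsto_zero_iff_enorm_tendsto_zero]
  refine tendsto_of_tendsto_of_tendsto_of_le_of_le' tendsto_const_nhds h1
    (Eventually.of_forall fun _ => zero_le) ?_
  filter_upwards [hK] with i hi
  refine (enorm_integral_le_lintegral_enorm _).trans ?_
  simp only [enorm_mul]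
  refine (ENNReal.lintegral_mul_le_Lp_mul_Lq μ (p := 2) (q := 2) ⟨by norm_num, by norm_num, by norm_num⟩
    hf.1.enorm (hH i).enorm.aemeasurable).trans ?_
  gcongr
  rw [← lintegral_const_mul' _ _ ENNReal.ofReal_ne_top]
  refine lintegral_mono fun ω => ?_
  rw [ENNReal.rpow_two, sq]
  gcongr
  rw [Real.enorm_eq_ofReal_abs]
  exact ENNReal.ofReal_le_ofReal (hi ω)

/-- The action `∫₀ᵗ V(r, W_r) dr` of the rescaled field along a path. -/
def fieldAction {S Ω : Type*} (α β ε : ℝ) (c : ℝ≥0 → ℝ → S → ℝ) (W : ℝ → Ω → ℝ) (t : ℝ) (ω : Ω)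
    (s : S) : ℝ :=
  ∫ r in (0 : ℝ)..t, rescaledPotential α β (α / 2) ε (fun t x => c t x s) r (W r ω)

namespace IsMixingField

variable {S : Type*} [mS : MeasurableSpace S] {P : Measure S}
  {c : ℝ≥0 → ℝ → S → ℝ} {φ : ℝ → ℝ} {M : ℝ} {Ω : Type*}

lemma measurable_rescaledPotential (H : IsMixingField c P φ M) (α β ε : ℝ) :
    Measurable (fun x : ℝ × ℝ × S =>
      rescaledPotential α β (α / 2) ε (fun t x' => c t x' x.2.2) x.1 x.2.1) :=
  (H.measurable.comp ((measurable_fst.div_const _).real_toNNReal.prodMk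
    ((measurable_snd.fst.div_const _).prodMk measurable_snd.snd))).const_mul _

lemma abs_rescaledPotential_le (H : IsMixingField c P φ M) (α β : ℝ) {ε : ℝ} (hε : 0 < ε) (s : S)
    (r x : ℝ) : |rescaledPotential α β (α / 2) ε (fun t x => c t x s) r x| ≤ ε ^ (-(α / 2)) * M := by
  unfold rescaledPotential
  rw [abs_mul, abs_of_pos (Real.rpow_pos_of_pos hε _)]
  exact mul_le_mul_of_nonneg_left (H.bdd _ _ _) (Real.rpow_pos_of_pos hε _).le

lemma abs_fieldAction_le (H : IsMixingField c P φ M) (α β : ℝ) {ε : ℝ} (hε : 0 < ε)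
    (W : ℝ → Ω → ℝ) (t : ℝ) (ω : Ω) (s : S) :
    |fieldAction α β ε c W t ω s| ≤ ε ^ (-(α / 2)) * M * |t| := by
  have := intervalIntegral.norm_integral_le_of_norm_le_const (a := 0) (b := t)
    (f := fun r => rescaledPotential α β (α / 2) ε (fun t x => c t x s) r (W r ω))
    fun r _ => H.abs_rescaledPotential_le α β hε s r (W r ω)
  rwa [sub_zero] at this

/-- The substitution `r ↦ Λ²r` with `Λ² = ε^(-α)` passes from the macroscopic action to the
microscopic time of the mixing process; the prefactor `ε^(-α/2)` is what remains of the Jacobian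
after the factor `Λ⁻¹`. -/
lemma scaledPrimitive_alongPaths [MeasurableSpace Ω] (H : IsMixingField c P φ M) (α β : ℝ)
    {ε : ℝ} (hε : 0 < ε) (a b : ℝ) {W W' : ℝ → Ω → ℝ} (hW : Measurable (Function.uncurry W))
    (hW' : Measurable (Function.uncurry W')) (t : ℝ) (ω : Ω) (s : S) :
    scaledPrimitive (alongPaths c a b (microPath W (ε ^ (-(α / 2))) (ε ^ β) ω)
      (microPath W' (ε ^ (-(α / 2))) (ε ^ β) ω)) (ε ^ (-(α / 2))) ((ε ^ (-(α / 2))) ^ 2 * t) s =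
      a * fieldAction α β ε c W t ω s + b * fieldAction α β ε c W' t ω s := by
  set Λ := ε ^ (-(α / 2)) with hΛ
  have hΛ0 : 0 < Λ := Real.rpow_pos_of_pos hε _
  have hα : ε ^ α = (Λ ^ 2)⁻¹ := by
    rw [hΛ, ← Real.rpow_natCast, ← Real.rpow_mul hε.le, ← Real.rpow_neg hε.le]
    congr 1; push_cast; ring
  have hV : ∀ W : ℝ → Ω → ℝ, Measurable (Function.uncurry W) → IntervalIntegrable
      (fun r => rescaledPotential α β (α / 2) ε (fun t x => c t x s) r (W r ω)) volume 0 t :=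
    fun W hW => intervalIntegrable_of_abs_le ((H.measurable_rescaledPotential α β ε).comp
      (measurable_id.prodMk ((hW.comp (measurable_id.prodMk measurable_const)).prodMk
        measurable_const))) (fun r => H.abs_rescaledPotential_le α β hε s r (W r ω)) _ _
  unfold scaledPrimitive fieldAction
  rw [← intervalIntegral.integral_const_mul a, ← intervalIntegral.integral_const_mul b,
    ← intervalIntegral.integral_add ((hV W hW).const_mul a) ((hV W' hW').const_mul b)]
  have e := intervalIntegral.integral_comp_mul_left (a := 0) (b := t) (c := Λ ^ 2)
    (fun r => alongPaths c a b (microPath W Λ (ε ^ β) ω) (microPath W' Λ (ε ^ β) ω) r s)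
    (by positivity)
  rw [mul_zero, smul_eq_mul] at e
  have e2 : ∀ x : ℝ, Λ⁻¹ * x = Λ * ((Λ ^ 2)⁻¹ * x) := fun x => by field_simp
  rw [e2, ← e, ← intervalIntegral.integral_const_mul]
  refine intervalIntegral.integral_congr fun r _ => ?_
  have e3 : Λ ^ 2 * r / Λ ^ 2 = r := by field_simp
  have e4 : r / ε ^ α = Λ ^ 2 * r := by rw [hα]; field_simp
  simp only [alongPaths, microPath, rescaledPotential, e3, e4, ← hΛ]
  ring

variable [MeasurableSpace Ω]

lemma measurable_fieldAction (H : IsMixingField c P φ M) (α β ε : ℝ) {W : ℝ → Ω → ℝ}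
    (hW : Measurable (Function.uncurry W)) (t : ℝ) :
    Measurable (fun x : Ω × S => fieldAction α β ε c W t x.1 x.2) := by
  have h1 : Measurable (fun y : (Ω × S) × ℝ =>
      rescaledPotential α β (α / 2) ε (fun t x => c t x y.1.2) y.2 (W y.2 y.1.1)) :=
    (H.measurable_rescaledPotential α β ε).comp (measurable_snd.prodMk
      ((hW.comp (measurable_snd.prodMk measurable_fst.fst)).prodMk measurable_fst.snd))
  unfold fieldAction
  simp only [intervalIntegral]
  exact (h1.stronglyMeasurable.integral_prod_right'.sub
    h1.stronglyMeasurable.integral_prod_right').measurable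

variable {Q : Measure Ω}

lemma abs_integral_fieldAction_le (H : IsMixingField c P φ M) (α β : ℝ) {ε : ℝ} (hε : 0 < ε)
    (W : ℝ → Ω → ℝ) (t : ℝ) {w : Ω → ℝ} (hw : Integrable w Q) (s : S) :
    |∫ ω, w ω * Real.exp (fieldAction α β ε c W t ω s) ∂Q| ≤
      (∫ ω, |w ω| ∂Q) * Real.exp (ε ^ (-(α / 2)) * M * |t|) := by
  rw [← integral_mul_const, ← Real.norm_eq_abs]
  refine norm_integral_le_of_norm_le (hw.abs.mul_const _) (ae_of_all _ fun ω => ?_)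
  rw [norm_mul, Real.norm_of_nonneg (Real.exp_pos _).le]
  exact mul_le_mul_of_nonneg_left (Real.exp_le_exp.2 ((le_abs_self _).trans
    (H.abs_fieldAction_le α β hε W t ω s))) (norm_nonneg _)

lemma measurable_integral_fieldAction [SFinite Q] (H : IsMixingField c P φ M) (α β ε : ℝ) {W : ℝ → Ω → ℝ}
    (hW : Measurable (Function.uncurry W)) (t : ℝ) {w : Ω → ℝ} (hw : AEStronglyMeasurable w Q) :
    AEStronglyMeasurable (fun s => ∫ ω, w ω * Real.exp (fieldAction α β ε c W t ω s) ∂Q) P := by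
  have h1 : AEStronglyMeasurable
      (fun x : S × Ω => w x.2 * Real.exp (fieldAction α β ε c W t x.2 x.1)) (P.prod Q) :=
    hw.comp_snd.mul (((H.measurable_fieldAction α β ε hW t).comp
      measurable_swap).exp.aestronglyMeasurable)
  exact h1.integral_prod_right'

variable [IsProbabilityMeasure P] [IsProbabilityMeasure Q]

lemma memLp_integral_fieldAction (H : IsMixingField c P φ M) (α β : ℝ) {ε : ℝ} (hε : 0 < ε)
    {W : ℝ → Ω → ℝ} (hW : Measurable (Function.uncurry W)) (t : ℝ) {w : Ω → ℝ}
    (hw : Integrable w Q) :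
    MemLp (fun s => ∫ ω, w ω * Real.exp (fieldAction α β ε c W t ω s) ∂Q) 2 P :=
  MemLp.of_bound (H.measurable_integral_fieldAction α β ε hW t hw.1) _
    (ae_of_all _ fun s => H.abs_integral_fieldAction_le α β hε W t hw s)

/-- The second moment of a weighted exponential functional, centered at its limit. -/
lemma integral_sq_sub_eq (H : IsMixingField c P φ M) (α β : ℝ) {ε : ℝ} (hε : 0 < ε)
    {W : ℝ → Ω → ℝ} (hW : Measurable (Function.uncurry W)) (t κ : ℝ) {w : Ω → ℝ}
    (hw : Integrable w Q) :
    ∫ s, ((∫ ω, w ω * Real.exp (fieldAction α β ε c W t ω s) ∂Q) -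
      (∫ ω, w ω ∂Q) * Real.exp κ) ^ 2 ∂P =
    ∫ x : Ω × Ω, w x.1 * w x.2 * ∫ s, (Real.exp (fieldAction α β ε c W t x.1 s) - Real.exp κ) *
      (Real.exp (fieldAction α β ε c W t x.2 s) - Real.exp κ) ∂P ∂(Q.prod Q) := by
  set A : Ω → S → ℝ := fun ω s => Real.exp (fieldAction α β ε c W t ω s) - Real.exp κ with hA
  set C := Real.exp (ε ^ (-(α / 2)) * M * |t|) + Real.exp κ with hC
  have hAm : Measurable (fun x : Ω × S => A x.1 x.2) :=
    (H.measurable_fieldAction α β ε hW t).exp.sub_const _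
  have hAb : ∀ ω s, |A ω s| ≤ C := fun ω s => by
    refine (abs_sub _ _).trans (add_le_add ?_ (abs_of_pos (Real.exp_pos _)).le)
    rw [abs_of_pos (Real.exp_pos _)]
    exact Real.exp_le_exp.2 ((le_abs_self _).trans (H.abs_fieldAction_le α β hε W t ω s))
  have hC0 : 0 ≤ C := by positivity
  have hwe : ∀ s, Integrable (fun ω => w ω * Real.exp (fieldAction α β ε c W t ω s)) Q := fun s => by
    refine hw.mul_bdd (c := Real.exp (ε ^ (-(α / 2)) * M * |t|))
      ((H.measurable_fieldAction α β ε hW t).comp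
        (measurable_id.prodMk measurable_const)).exp.aestronglyMeasurable (ae_of_all _ fun ω => ?_)
    rw [Real.norm_of_nonneg (Real.exp_pos _).le]
    exact Real.exp_le_exp.2 ((le_abs_self _).trans (H.abs_fieldAction_le α β hε W t ω s))
  have e1 : ∀ s, (∫ ω, w ω * Real.exp (fieldAction α β ε c W t ω s) ∂Q) -
      (∫ ω, w ω ∂Q) * Real.exp κ = ∫ ω, w ω * A ω s ∂Q := fun s => by
    rw [← integral_mul_const, ← integral_sub (hwe s) (hw.mul_const _)]
    simp only [hA, mul_sub]
  -- The square becomes an integral over two independent copies of the path in the same realization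
  -- of the field.
  have e2 : ∀ s, (∫ ω, w ω * A ω s ∂Q) ^ 2 =
      ∫ x : Ω × Ω, w x.1 * w x.2 * (A x.1 s * A x.2 s) ∂(Q.prod Q) := fun s => by
    rw [sq, ← integral_prod_mul]
    congr 1 with x
    ring
  simp only [e1, e2]
  rw [integral_integral_swap]
  · simp only [integral_const_mul, hA]
  · have hww : Integrable (fun x : Ω × Ω => w x.1 * w x.2) (Q.prod Q) := hw.mul_prod hw
    have h2 : Integrable (fun y : S × (Ω × Ω) => w y.2.1 * w y.2.2) (P.prod (Q.prod Q)) :=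
      hww.comp_snd P
    refine h2.mul_bdd (c := C * C) ?_ (ae_of_all _ fun y => ?_)
    · exact ((hAm.comp (measurable_snd.fst.prodMk measurable_fst)).mul
        (hAm.comp (measurable_snd.snd.prodMk measurable_fst))).aestronglyMeasurable
    · rw [norm_mul]
      exact mul_le_mul (hAb _ _) (hAb _ _) (norm_nonneg _) hC0

/-- Mean square convergence of weighted exponential functionals of the field along independent
copies of a diffusive path. -/
theorem tendsto_eLpNorm_integral_fieldAction (H : IsMixingField c P φ M) {h : ℝ → ℝ}
    (hφ : Tendsto φ atTop (𝓝 0)) (hh : Tendsto h atTop atTop)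
    (h1 : Tendsto (fun Λ => Λ * φ (h Λ)) atTop (𝓝 0))
    (h2 : Tendsto (fun Λ => h Λ * φ (h Λ / 2)) atTop (𝓝 0))
    (h3 : Tendsto (fun Λ => h Λ ^ 2 / Λ) atTop (𝓝 0)) {α β : ℝ} (hβ : 0 < 2 * β)
    (hαβ : 2 * β < α) {W : ℝ → Ω → ℝ} {t : ℝ} (ht : 0 ≤ t)
    (D : IsDiffusivePair (fun r (x : Ω × Ω) => W r x.1) (fun r (x : Ω × Ω) => W r x.2)
      (Q.prod Q) t) (hW : Measurable (Function.uncurry W)) {w : Ω → ℝ} (hw : MemLp w 2 Q) :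
    Tendsto (fun ε : ℝ => eLpNorm (fun s => (∫ ω, w ω * Real.exp (fieldAction α β ε c W t ω s) ∂Q) -
      (∫ ω, w ω ∂Q) * Real.exp (t * ∫ ρ in Ioi (0 : ℝ), fieldCorrelation c P ρ.toNNReal 0)) 2 P)
      (𝓝[>] 0) (𝓝 0) := by
  set σ := ∫ ρ in Ioi (0 : ℝ), fieldCorrelation c P ρ.toNNReal 0 with hσ
  set W₁ : ℝ → Ω × Ω → ℝ := fun r x => W r x.1 with hW₁
  set W₂ : ℝ → Ω × Ω → ℝ := fun r x => W r x.2 with hW₂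
  set Λ : ℝ → ℝ := fun ε => ε ^ (-(α / 2)) with hΛdef
  have hΛ : Tendsto Λ (𝓝[>] 0) atTop := tendsto_rpow_neg_nhdsGT_zero (by linarith)
  have hδ : Tendsto (fun ε : ℝ => ε ^ β) (𝓝[>] 0) (𝓝[>] 0) := by
    refine tendsto_nhdsWithin_iff.2 ⟨?_, ?_⟩
    · have := (Real.continuousAt_rpow_const 0 β (Or.inr (by linarith))).tendsto
      rw [Real.zero_rpow (by linarith)] at this
      exact this.mono_left nhdsWithin_le_nhds
    · filter_upwards [self_mem_nhdsWithin] with ε hε using Real.rpow_pos_of_pos hε _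
  -- The hypothesis `2β < α` says that the exponent `α/2 - β` is positive.
  have hΛδ : Tendsto (fun ε => Λ ε * ε ^ β) (𝓝[>] 0) atTop := by
    have : Tendsto (fun ε : ℝ => ε ^ (-(α / 2 - β))) (𝓝[>] 0) atTop :=
      tendsto_rpow_neg_nhdsGT_zero (by linarith)
    refine this.congr' ?_
    filter_upwards [self_mem_nhdsWithin] with ε hε
    rw [hΛdef]
    simp only
    rw [← Real.rpow_add hε]
    congr 1; ring
  -- the exponential moments along the pair of paths
  set E : ℝ → ℝ → ℝ → Ω × Ω → ℝ := fun a b ε x => ∫ s, Real.exp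
    (a * fieldAction α β ε c W t x.1 s + b * fieldAction α β ε c W t x.2 s) ∂P with hE
  have hEm : ∀ a b ε, Measurable (E a b ε) := fun a b ε => by
    have hm := H.measurable_fieldAction α β ε hW t
    exact (((hm.comp (measurable_fst.fst.prodMk measurable_snd)).const_mul a).add
      ((hm.comp (measurable_fst.snd.prodMk measurable_snd)).const_mul b)).exp.stronglyMeasurable.integral_prod_right'.measurable
  have hE0 : ∀ a b ε x, 0 ≤ E a b ε x := fun a b ε x =>
    integral_nonneg fun s => (Real.exp_pos _).le
  have hlim : ∀ a b : ℝ, |a| ≤ 1 → |b| ≤ 1 →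
      (∃ K : ℝ, ∀ᶠ ε in 𝓝[>] (0 : ℝ), ∀ x, E a b ε x ≤ K) ∧
      Tendsto (fun ε => ∫⁻ x, ‖E a b ε x - Real.exp ((a ^ 2 + b ^ 2) * t * σ)‖ₑ ∂(Q.prod Q))
        (𝓝[>] 0) (𝓝 0) := fun a b ha hb => by
    obtain ⟨⟨K, hK⟩, hL⟩ := H.tendsto_lintegral_exp_alongPaths hφ ha hb ht D hΛ hδ hΛδ
      (hh.comp hΛ) (h1.comp hΛ) (h2.comp hΛ) (h3.comp hΛ)
    have hEeq : ∀ᶠ ε in 𝓝[>] (0 : ℝ), ∀ x, ∫ s, Real.exp (scaledPrimitive (alongPaths c a b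
      (microPath W₁ (Λ ε) (ε ^ β) x) (microPath W₂ (Λ ε) (ε ^ β) x)) (Λ ε) (Λ ε ^ 2 * t) s) ∂P =
        E a b ε x := by
      filter_upwards [self_mem_nhdsWithin] with ε hε x
      simp only [hΛdef, H.scaledPrimitive_alongPaths α β hε a b D.measurable D.measurable' t x]
      rfl
    refine ⟨⟨K, ?_⟩, hL.congr' ?_⟩
    · filter_upwards [hK, hEeq] with ε h1 h2 x
      rw [← h2]; exact h1 x
    · filter_upwards [hEeq] with ε h2
      simp only [h2, hσ]
  obtain ⟨⟨K₁, hK₁⟩, hL₁⟩ := hlim 1 1 (by simp) (by simp)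
  obtain ⟨⟨K₂, hK₂⟩, hL₂⟩ := hlim 1 0 (by simp) (by simp)
  obtain ⟨⟨K₃, hK₃⟩, hL₃⟩ := hlim 0 1 (by simp) (by simp)
  set κ := t * σ with hκ
  have k1 : (1 ^ 2 + 1 ^ 2 : ℝ) * t * σ = κ + κ := by rw [hκ]; ring
  have k2 : (1 ^ 2 + 0 ^ 2 : ℝ) * t * σ = κ := by rw [hκ]; ring
  have k3 : (0 ^ 2 + 1 ^ 2 : ℝ) * t * σ = κ := by rw [hκ]; ring
  rw [k1] at hL₁
  rw [k2] at hL₂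
  rw [k3] at hL₃
  -- Expansion of `E[(e^A - e^κ)(e^{A'} - e^κ)]` with each moment centered at its own limit; the
  -- leftover constants `-e^{2κ} + e^κe^κ + e^κe^κ` cancel against the last term of the product.
  set G : ℝ → Ω × Ω → ℝ := fun ε x => (E 1 1 ε x - Real.exp (κ + κ)) -
    Real.exp κ * (E 1 0 ε x - Real.exp κ) - Real.exp κ * (E 0 1 ε x - Real.exp κ) with hG
  have hGm : ∀ ε, Measurable (G ε) := fun ε =>
    (((hEm 1 1 ε).sub_const _).sub (((hEm 1 0 ε).sub_const _).const_mul _)).sub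
      (((hEm 0 1 ε).sub_const _).const_mul _)
  have hGK : ∀ᶠ ε in 𝓝[>] (0 : ℝ), ∀ x, |G ε x| ≤ (K₁ + Real.exp (κ + κ)) +
      Real.exp κ * (K₂ + Real.exp κ) + Real.exp κ * (K₃ + Real.exp κ) := by
    have hb : ∀ u K y : ℝ, 0 ≤ u → u ≤ K → |u - Real.exp y| ≤ K + Real.exp y := fun u K y h0 hu => by
      refine (abs_sub _ _).trans ?_
      rw [abs_of_nonneg h0, abs_of_pos (Real.exp_pos _)]
      linarith
    filter_upwards [hK₁, hK₂, hK₃] with ε e1 e2 e3 x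
    refine (abs_sub _ _).trans (add_le_add ((abs_sub _ _).trans (add_le_add
      (hb _ _ _ (hE0 _ _ _ _) (e1 x)) ?_)) ?_)
    · rw [abs_mul, abs_of_pos (Real.exp_pos _)]
      exact mul_le_mul_of_nonneg_left (hb _ _ _ (hE0 _ _ _ _) (e2 x)) (Real.exp_pos _).le
    · rw [abs_mul, abs_of_pos (Real.exp_pos _)]
      exact mul_le_mul_of_nonneg_left (hb _ _ _ (hE0 _ _ _ _) (e3 x)) (Real.exp_pos _).le
  have hGlim : Tendsto (fun ε => ∫⁻ x, ‖G ε x‖ₑ ∂(Q.prod Q)) (𝓝[>] 0) (𝓝 0) := by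
    have ht : Tendsto (fun ε => (∫⁻ x, ‖E 1 1 ε x - Real.exp (κ + κ)‖ₑ ∂(Q.prod Q)) +
        ‖Real.exp κ‖ₑ * (∫⁻ x, ‖E 1 0 ε x - Real.exp κ‖ₑ ∂(Q.prod Q)) +
        ‖Real.exp κ‖ₑ * ∫⁻ x, ‖E 0 1 ε x - Real.exp κ‖ₑ ∂(Q.prod Q)) (𝓝[>] 0) (𝓝 0) := by
      have := (hL₁.add (ENNReal.Tendsto.const_mul hL₂
        (Or.inr (enorm_ne_top (x := Real.exp κ))))).add
        (ENNReal.Tendsto.const_mul hL₃ (Or.inr (enorm_ne_top (x := Real.exp κ))))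
      simpa using this
    refine tendsto_of_tendsto_of_tendsto_of_le_of_le tendsto_const_nhds ht (fun _ => zero_le)
      fun ε => ?_
    simp only
    rw [← lintegral_const_mul _ (((hEm 1 0 ε).sub_const _).enorm),
      ← lintegral_const_mul _ (((hEm 0 1 ε).sub_const _).enorm),
      ← lintegral_add_left (((hEm 1 1 ε).sub_const _).enorm), ← lintegral_add_left
      (by exact (((hEm 1 1 ε).sub_const _).enorm).add ((((hEm 1 0 ε).sub_const _).enorm).const_mul _))]
    refine lintegral_mono fun x => ?_
    simp only [← enorm_mul]
    exact enorm_sub_le.trans (add_le_add enorm_sub_le le_rfl)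
  have hwi : Integrable w Q := hw.integrable one_le_two
  -- By independence of the two copies, square integrability of `w` passes to the product weight.
  have hww : MemLp (fun x : Ω × Ω => w x.1 * w x.2) 2 (Q.prod Q) := by
    rw [memLp_two_iff_integrable_sq (by exact hw.1.comp_fst.mul hw.1.comp_snd)]
    simp only [mul_pow]
    exact hw.integrable_sq.mul_prod hw.integrable_sq
  have hmain := tendsto_integral_mul_of_lintegral hww hGm hGK hGlim
  have hsq : Tendsto (fun ε => ∫ s, ((∫ ω, w ω * Real.exp (fieldAction α β ε c W t ω s) ∂Q) -
      (∫ ω, w ω ∂Q) * Real.exp κ) ^ 2 ∂P) (𝓝[>] 0) (𝓝 0) := by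
    refine hmain.congr' ?_
    filter_upwards [self_mem_nhdsWithin] with ε hε
    rw [H.integral_sq_sub_eq α β hε hW t κ hwi]
    congr 1 with x
    congr 1
    have hi : ∀ a b : ℝ, Integrable (fun s => Real.exp
        (a * fieldAction α β ε c W t x.1 s + b * fieldAction α β ε c W t x.2 s)) P := fun a b => by
      have hm := H.measurable_fieldAction α β ε hW t
      set B := ε ^ (-(α / 2)) * M * |t|
      refine Integrable.of_bound (C := Real.exp (|a| * B + |b| * B))
        (((hm.comp (measurable_const.prodMk measurable_id)).const_mul a).add
        ((hm.comp (measurable_const.prodMk measurable_id)).const_mul b)).exp.aestronglyMeasurable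
        (ae_of_all _ fun s => ?_)
      rw [Real.norm_of_nonneg (Real.exp_pos _).le]
      refine Real.exp_le_exp.2 ((le_abs_self _).trans ((abs_add_le _ _).trans ?_))
      rw [abs_mul, abs_mul]
      exact add_le_add
        (mul_le_mul_of_nonneg_left (H.abs_fieldAction_le α β hε W t _ s) (abs_nonneg _))
        (mul_le_mul_of_nonneg_left (H.abs_fieldAction_le α β hε W t _ s) (abs_nonneg _))
    have e : ∀ s, (Real.exp (fieldAction α β ε c W t x.1 s) - Real.exp κ) *
        (Real.exp (fieldAction α β ε c W t x.2 s) - Real.exp κ) =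
        Real.exp (1 * fieldAction α β ε c W t x.1 s + 1 * fieldAction α β ε c W t x.2 s) -
        Real.exp κ * Real.exp (1 * fieldAction α β ε c W t x.1 s + 0 * fieldAction α β ε c W t x.2 s) -
        Real.exp κ * Real.exp (0 * fieldAction α β ε c W t x.1 s + 1 * fieldAction α β ε c W t x.2 s) +
        Real.exp κ * Real.exp κ := fun s => by
      rw [one_mul, one_mul, zero_mul, zero_mul, add_zero, zero_add, Real.exp_add]; ring
    simp only [e]
    rw [integral_add (by exact ((hi 1 1).sub ((hi 1 0).const_mul _)).sub ((hi 0 1).const_mul _))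
      (integrable_const _), integral_sub (by exact (hi 1 1).sub ((hi 1 0).const_mul _))
      ((hi 0 1).const_mul _), integral_sub (hi 1 1) ((hi 1 0).const_mul _), integral_const_mul,
      integral_const_mul]
    simp only [hG, hE, integral_const, probReal_univ, smul_eq_mul, one_mul, Real.exp_add]
    ring
  have hroot : Tendsto (fun ε => ENNReal.ofReal (√(∫ s,
      ((∫ ω, w ω * Real.exp (fieldAction α β ε c W t ω s) ∂Q) -
      (∫ ω, w ω ∂Q) * Real.exp κ) ^ 2 ∂P))) (𝓝[>] 0) (𝓝 0) := by
    have := ENNReal.tendsto_ofReal ((Real.continuous_sqrt.tendsto 0).comp hsq)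
    simpa using this
  refine hroot.congr' ?_
  filter_upwards [self_mem_nhdsWithin] with ε hε
  have hmem : MemLp (fun s => (∫ ω, w ω * Real.exp (fieldAction α β ε c W t ω s) ∂Q) -
      (∫ ω, w ω ∂Q) * Real.exp κ) 2 P :=
    (H.memLp_integral_fieldAction α β hε hW t hwi).sub (memLp_const _)
  rw [hmem.eLpNorm_eq_integral_rpow_norm (by norm_num) (by norm_num), Real.sqrt_eq_rpow]
  simp

end IsMixingField
end


/-! ### Gaussian laws, continuous versions and independent Brownian pairs -/

noncomputable section

section HeatKernel

lemma heatKernel_eq_gaussianPDFReal {t : ℝ} (ht : 0 ≤ t) (x y : ℝ) :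
    heatKernel t (x - y) = gaussianPDFReal x t.toNNReal y := by
  rw [heatKernel, gaussianPDFReal, Real.coe_toNNReal t ht]
  congr 3
  ring

lemma heatKernel_nonneg (t z : ℝ) : 0 ≤ heatKernel t z := by
  unfold heatKernel; positivity

lemma heatKernel_le {t : ℝ} (ht : 0 ≤ t) (z : ℝ) : heatKernel t z ≤ (√(2 * Real.pi * t))⁻¹ := by
  unfold heatKernel
  refine mul_le_of_le_one_right (by positivity) (Real.exp_le_one_iff.2 ?_)
  exact div_nonpos_of_nonpos_of_nonneg (by nlinarith [sq_nonneg z]) (by positivity)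

lemma measurable_heatKernel : Measurable (Function.uncurry heatKernel) := by
  unfold heatKernel Function.uncurry
  fun_prop

end HeatKernel

section GaussianVariable

variable {Ω : Type*} [MeasurableSpace Ω] {Q : Measure Ω} {X : Ω → ℝ} {t : ℝ}

lemma ProbabilityTheory.HasLaw.const_add_gaussianReal {v : ℝ≥0} (hX : HasLaw X (gaussianReal 0 v) Q) (x : ℝ) :
    HasLaw (fun ω => x + X ω) (gaussianReal x v) Q := by
  have h := gaussianReal_const_add hX x
  simpa using h

/-- The Gaussian density is bounded by its maximum, so a function in `L²(ℝ)` evaluated at `x + B_t`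
stays square integrable for `t > 0`. -/
lemma gaussianReal_le_smul_volume (ht : 0 < t) (x : ℝ) :
    gaussianReal x t.toNNReal ≤ ENNReal.ofReal (√(2 * Real.pi * t))⁻¹ • (volume : Measure ℝ) := by
  rw [gaussianReal_of_var_ne_zero _ (by simpa using ht), ← withDensity_const]
  refine withDensity_mono (Eventually.of_forall fun y => ?_)
  rw [gaussianPDF, ← heatKernel_eq_gaussianPDFReal ht.le]
  exact ENNReal.ofReal_le_ofReal (heatKernel_le ht.le _)

lemma gaussianReal_absolutelyContinuous_volume (ht : 0 < t) (x : ℝ) :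
    gaussianReal x t.toNNReal ≪ volume := by
  rw [gaussianReal_of_var_ne_zero _ (by simpa using ht)]
  exact withDensity_absolutelyContinuous _ _

lemma ProbabilityTheory.HasLaw.memLp_comp_const_add (hX : HasLaw X (gaussianReal 0 t.toNNReal) Q) (ht : 0 < t)
    {f : ℝ → ℝ} (hf : MemLp f 2 volume) (x : ℝ) : MemLp (fun ω => f (x + X ω)) 2 Q := by
  have h := hX.const_add_gaussianReal x
  have h1 : MemLp f 2 (Q.map fun ω => x + X ω) := by
    rw [h.map_eq]
    exact (hf.smul_measure ENNReal.ofReal_ne_top).mono_measure (gaussianReal_le_smul_volume ht x)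
  exact h1.comp_of_map h.aemeasurable

lemma ProbabilityTheory.HasLaw.integral_comp_const_add (hX : HasLaw X (gaussianReal 0 t.toNNReal) Q) (ht : 0 < t)
    {f : ℝ → ℝ} (hf : AEStronglyMeasurable f volume) (x : ℝ) :
    ∫ ω, f (x + X ω) ∂Q = ∫ y, heatKernel t (x - y) * f y := by
  have h := hX.const_add_gaussianReal x
  have h1 : ∫ ω, f (x + X ω) ∂Q = ∫ y, f y ∂(gaussianReal x t.toNNReal) :=
    h.integral_comp (hf.mono_ac (gaussianReal_absolutelyContinuous_volume ht x))
  rw [h1, integral_gaussianReal_eq_integral_smul (by simpa using ht)]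
  simp_rw [heatKernel_eq_gaussianPDFReal ht.le, smul_eq_mul]

end GaussianVariable

section ContinuousVersion

variable {Ω : Type*} [MeasurableSpace Ω] {Q : Measure Ω} {B : ℝ≥0 → Ω → ℝ}

/-- Paths are continuous only almost surely and marginals only almost everywhere measurable. One
discards a measurable null set outside which the path is continuous and agrees with measurable
representatives on a countable dense set of times; the other times are limits of these. -/
lemma ProbabilityTheory.IsBrownianReal.exists_continuous_version (hB : IsBrownianReal B Q) :
    ∃ B' : ℝ≥0 → Ω → ℝ, (∀ t, Measurable (B' t)) ∧ (∀ ω, Continuous fun t => B' t ω) ∧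
      ∀ᵐ ω ∂Q, ∀ t, B' t ω = B t ω := by
  classical
  have hm := fun t => hB.aemeasurable t
  let D := TopologicalSpace.denseSeq ℝ≥0
  have hG : ∀ᵐ ω ∂Q, (Continuous fun t => B t ω) ∧ ∀ n, B (D n) ω = (hm (D n)).mk _ ω :=
    hB.cont.and (ae_all_iff.2 fun n => (hm (D n)).ae_eq_mk)
  let N := toMeasurable Q {ω | ¬ ((Continuous fun t => B t ω) ∧
    ∀ n, B (D n) ω = (hm (D n)).mk _ ω)}
  have hN : MeasurableSet N := measurableSet_toMeasurable _ _
  have hN0 : Q N = 0 := by rw [measure_toMeasurable]; exact hG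
  have hNc : ∀ ω, ω ∉ N → (Continuous fun t => B t ω) ∧ ∀ n, B (D n) ω = (hm (D n)).mk _ ω := by
    intro ω hω
    by_contra hcon
    exact hω (subset_toMeasurable _ _ hcon)
  refine ⟨fun t ω => if ω ∈ N then 0 else B t ω, fun t => ?_, fun ω => ?_, ?_⟩
  · have hcl : t ∈ closure (range D) := (TopologicalSpace.denseRange_denseSeq ℝ≥0) t
    obtain ⟨q, hq, hlim⟩ := mem_closure_iff_seq_limit.1 hcl
    choose k hk using hq
    refine measurable_of_tendsto_metrizable
      (f := fun n ω => if ω ∈ N then 0 else (hm (D (k n))).mk _ ω)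
      (fun n => Measurable.ite hN measurable_const (hm _).measurable_mk) ?_
    rw [tendsto_pi_nhds]
    intro ω
    by_cases hω : ω ∈ N
    · simp [hω]
    · simp only [hω, if_false]
      have h1 := hNc ω hω
      simp_rw [← h1.2, hk]
      exact (h1.1.tendsto t).comp hlim
  · by_cases hω : ω ∈ N
    · simp only [hω, if_true]; exact continuous_const
    · simp only [hω, if_false]; exact (hNc ω hω).1
  · have : ∀ᵐ ω ∂Q, ω ∉ N := measure_eq_zero_iff_ae_notMem.1 hN0
    filter_upwards [this] with ω hω t
    simp [hω]

lemma ProbabilityTheory.IsPreBrownianReal.lintegral_sq_sub (hB : IsPreBrownianReal B Q) (s t : ℝ≥0) :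
    ∫⁻ ω, ENNReal.ofReal ((B s ω - B t ω) ^ 2) ∂Q = ENNReal.ofReal |(s : ℝ) - t| := by
  have hlaw := hB.hasLaw_sub s t
  have hL : MemLp (B s - B t) 2 Q := hlaw.hasGaussianLaw.memLp_two
  have hv := hlaw.variance_eq
  rw [variance_id_gaussianReal, variance_of_integral_eq_zero hlaw.aemeasurable
    (by rw [hlaw.integral_eq, integral_id_gaussianReal])] at hv
  calc ∫⁻ ω, ENNReal.ofReal ((B s ω - B t ω) ^ 2) ∂Q
      = ENNReal.ofReal (∫ ω, (B s - B t) ω ^ 2 ∂Q) :=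
        (ofReal_integral_eq_lintegral_ofReal hL.integrable_sq
          (Eventually.of_forall fun ω => sq_nonneg _)).symm
    _ = ENNReal.ofReal |(s : ℝ) - t| := by rw [hv]; rfl

lemma ProbabilityTheory.IsPreBrownianReal.ae_ne (hB : IsPreBrownianReal B Q) {t : ℝ≥0} (ht : t ≠ 0) (y : ℝ) :
    ∀ᵐ ω ∂Q, B t ω ≠ y := by
  have := nullSingletonClass_gaussianReal (μ := 0) ht
  refine ((hB.hasLaw_eval t).ae_iff (p := fun z => z ≠ y) ?_).2 ?_
  · exact (measurableSet_singleton y).compl.mem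
  · exact ae_iff.2 (by simp)

end ContinuousVersion

section DiffusivePair

variable {Ω : Type*} [MeasurableSpace Ω] {Q : Measure Ω} [IsProbabilityMeasure Q]

/-- Two independent copies of a path with diffusive increments and diffuse marginals. -/
lemma isDiffusivePair_prod {W : ℝ → Ω → ℝ} {t : ℝ} (hW : Measurable (Function.uncurry W))
    (hcont : ∀ ω, Continuous fun τ => W τ ω)
    (hsq : ∀ τ ∈ Icc 0 t, ∀ τ' ∈ Icc 0 t,
      ∫⁻ ω, ENNReal.ofReal ((W τ ω - W τ' ω) ^ 2) ∂Q ≤ ENNReal.ofReal |τ - τ'|)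
    (hne : ∀ τ ∈ Ioo 0 t, ∀ y, ∀ᵐ ω ∂Q, W τ ω ≠ y) :
    IsDiffusivePair (fun r (x : Ω × Ω) => W r x.1) (fun r (x : Ω × Ω) => W r x.2)
      (Q.prod Q) t := by
  have hWτ : ∀ τ, Measurable (W τ) := fun τ => hW.comp measurable_prodMk_left
  have h1 : Measurable (Function.uncurry fun r (x : Ω × Ω) => W r x.1) :=
    hW.comp (measurable_fst.prodMk (measurable_fst.comp measurable_snd))
  have h2 : Measurable (Function.uncurry fun r (x : Ω × Ω) => W r x.2) :=
    hW.comp (measurable_fst.prodMk (measurable_snd.comp measurable_snd))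
  have hm : ∀ τ τ', Measurable fun ω => ENNReal.ofReal ((W τ ω - W τ' ω) ^ 2) := fun τ τ' =>
    (((hWτ τ).sub (hWτ τ')).pow_const 2).ennreal_ofReal
  refine ⟨h1, h2, fun x => hcont _, fun x => hcont _, fun τ hτ τ' hτ' => ?_,
    fun τ hτ τ' hτ' => ?_, fun τ hτ => ?_⟩
  · exact ((measurePreserving_fst (μ := Q) (ν := Q)).lintegral_comp (hm τ τ')).trans_le
      (hsq τ hτ τ' hτ')
  · exact ((measurePreserving_snd (μ := Q) (ν := Q)).lintegral_comp (hm τ τ')).trans_le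
      (hsq τ hτ τ' hτ')
  -- Given the first copy, the second has to avoid a single point.
  · have hs : MeasurableSet {x : Ω × Ω | W τ x.1 ≠ W τ x.2} :=
      (measurableSet_eq_fun ((hWτ τ).comp measurable_fst) ((hWτ τ).comp measurable_snd)).compl
    refine (Measure.ae_prod_iff_ae_ae hs).2 (Eventually.of_forall fun a => ?_)
    filter_upwards [hne τ hτ (W τ a)] with b hb
    exact hb.symm

variable {B : ℝ≥0 → Ω → ℝ}

lemma measurable_brownianPath (hm : ∀ t, Measurable (B t)) (hcont : ∀ ω, Continuous fun t => B t ω) :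
    Measurable (Function.uncurry B) :=
  measurable_uncurry_of_continuous_of_measurable hcont hm

/-- The clock `T` is `r ↦ t - r` for the mild solution and the identity for the forward functional.
An isometric clock preserves the mean squares of increments, and its positivity inside the interval
keeps the marginals diffuse. -/
lemma ProbabilityTheory.IsPreBrownianReal.isDiffusivePair (hB : IsPreBrownianReal B Q) (hm : ∀ t, Measurable (B t))
    (hcont : ∀ ω, Continuous fun t => B t ω) (x t : ℝ) {T : ℝ → ℝ} (hT : Continuous T)
    (hT0 : ∀ τ ∈ Icc 0 t, 0 ≤ T τ) (hTpos : ∀ τ ∈ Ioo 0 t, 0 < T τ)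
    (hTiso : ∀ τ τ', |T τ - T τ'| = |τ - τ'|) :
    IsDiffusivePair (fun r (p : Ω × Ω) => x + B (T r).toNNReal p.1)
      (fun r (p : Ω × Ω) => x + B (T r).toNNReal p.2) (Q.prod Q) t := by
  refine isDiffusivePair_prod (W := fun r ω => x + B (T r).toNNReal ω) ?_ (fun ω => ?_)
    (fun τ hτ τ' hτ' => ?_) (fun τ hτ y => ?_)
  · exact ((measurable_brownianPath hm hcont).comp
      (((continuous_real_toNNReal.comp hT).measurable.comp measurable_fst).prodMk
        measurable_snd)).const_add x
  · exact continuous_const.add ((hcont ω).comp (continuous_real_toNNReal.comp hT))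
  · simp only [add_sub_add_left_eq_sub]
    rw [hB.lintegral_sq_sub, Real.coe_toNNReal _ (hT0 τ hτ), Real.coe_toNNReal _ (hT0 τ' hτ'),
      hTiso]
  · filter_upwards [hB.ae_ne (t := (T τ).toNNReal) (by simpa using hTpos τ hτ) (y - x)] with ω hω h
    exact hω (by linarith)

end DiffusivePair
end


/-! ### The Markov property and Gaussian moment bounds -/

noncomputable section

section Markov

variable {Ω : Type*} {B : ℝ≥0 → Ω → ℝ}

/-- The sigma-algebra generated by a process up to time `r`. -/
@[reducible] def pastSigma (B : ℝ≥0 → Ω → ℝ) (r : ℝ≥0) : MeasurableSpace Ω :=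
  MeasurableSpace.comap (fun ω (s : Iic r) => B s ω) inferInstance

lemma measurable_pastSigma {r s : ℝ≥0} (h : s ≤ r) : Measurable[pastSigma B r] (B s) :=
  (measurable_pi_apply (⟨s, h⟩ : Iic r)).comp (comap_measurable (fun ω (s : Iic r) => B s ω))

variable [mΩ : MeasurableSpace Ω] {Q : Measure Ω}

lemma pastSigma_le (hm : ∀ t, Measurable (B t)) (r : ℝ≥0) : pastSigma B r ≤ mΩ :=
  (measurable_pi_lambda _ fun s : Iic r => hm s).comap_le

lemma measurable_integral_heatKernel {F : ℝ → ℝ → ℝ} (hF : Measurable (Function.uncurry F)) :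
    Measurable fun p : ℝ × ℝ => ∫ y, heatKernel p.1 (p.2 - y) * F p.1 y := by
  have h : Measurable fun p : (ℝ × ℝ) × ℝ => heatKernel p.1.1 (p.1.2 - p.2) * F p.1.1 p.2 :=
    (measurable_heatKernel.comp (by fun_prop : Measurable fun p : (ℝ × ℝ) × ℝ =>
      (p.1.1, p.1.2 - p.2))).mul
      (hF.comp (by fun_prop : Measurable fun p : (ℝ × ℝ) × ℝ => (p.1.1, p.2)))
  exact (h.stronglyMeasurable.integral_prod_right (ν := volume)).measurable

lemma ProbabilityTheory.IsPreBrownianReal.hasLaw_sub_toNNReal (hB : IsPreBrownianReal B Q) {r q : ℝ} (hr : 0 ≤ r)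
    (hrq : r ≤ q) :
    HasLaw (fun ω => B q.toNNReal ω - B r.toNNReal ω) (gaussianReal 0 (q - r).toNNReal) Q := by
  have h := (hB.shift r.toNNReal).hasLaw_eval (q - r).toNNReal
  rwa [← Real.toNNReal_add hr (sub_nonneg.2 hrq), add_sub_cancel] at h

variable [IsProbabilityMeasure Q]

/-- The Markov property of Brownian motion in integrated form. -/
lemma ProbabilityTheory.IsPreBrownianReal.integral_mul_comp (hB : IsPreBrownianReal B Q) (hm : ∀ t, Measurable (B t))
    {r q : ℝ} (hr : 0 ≤ r) (hrq : r < q) {f : ℝ → ℝ} (hf : Measurable f) (x : ℝ)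
    (hint : Integrable (fun ω => f (x + B q.toNNReal ω)) Q) {W : Ω → ℝ} {C : ℝ}
    (hW : AEStronglyMeasurable[pastSigma B r.toNNReal] W Q) (hC : ∀ ω, |W ω| ≤ C) :
    ∫ ω, W ω * f (x + B q.toNNReal ω) ∂Q =
      ∫ ω, W ω * (∫ y, heatKernel (q - r) (x + B r.toNNReal ω - y) * f y) ∂Q := by
  set r' := r.toNNReal with hr'
  set W' := hW.mk W with hW'
  have hW'm : Measurable[pastSigma B r'] W' := hW.stronglyMeasurable_mk.measurable
  have hle := pastSigma_le hm r'
  have hW'm' : Measurable W' := hW'm.mono hle le_rfl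
  have hae : W =ᵐ[Q] W' := hW.ae_eq_mk
  set D : Ω → ℝ := fun ω => B q.toNNReal ω - B r' ω with hD
  have hDlaw : HasLaw D (gaussianReal 0 (q - r).toNNReal) Q := hB.hasLaw_sub_toNNReal hr hrq.le
  set Z : Ω → ℝ × ℝ := fun ω => (W' ω, B r' ω) with hZ
  have hZm : Measurable[pastSigma B r'] Z := hW'm.prodMk (measurable_pastSigma le_rfl)
  have hZm' : Measurable Z := hZm.mono hle le_rfl
  have hDm : Measurable D := (hm _).sub (hm _)
  -- Both the weight and `B_r` belong to the past, so the pair is independent of the increment from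
  -- `r` to `q`, and the increment can be integrated out with the heat kernel.
  have hind : IndepFun Z D Q := by
    have h1 := hB.indepFun_shift r'
    have hev : Measurable fun w : ℝ≥0 → ℝ => w (q - r).toNNReal :=
      measurable_pi_apply (q - r).toNNReal
    have h2 : IndepFun D (fun ω (t : Iic r') => B t ω) Q := by
      have h3 := h1.comp (φ := fun w : ℝ≥0 → ℝ => w (q - r).toNNReal)
        hev measurable_id
      have h4 : ((fun w : ℝ≥0 → ℝ => w (q - r).toNNReal) ∘
          fun ω t => B (r' + t) ω - B r' ω) = D := by
        ext ω
        simp only [Function.comp, hD, hr']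
        rw [← Real.toNNReal_add hr (sub_nonneg.2 hrq.le), add_sub_cancel]
      rwa [h4] at h3
    rw [IndepFun_iff_Indep] at h2 ⊢
    exact (indep_of_indep_of_le_right h2 hZm.comap_le).symm
  have hprod := (indepFun_iff_map_prod_eq_prod_map_map hZm'.aemeasurable hDm.aemeasurable).1 hind
  set φ : (ℝ × ℝ) × ℝ → ℝ := fun p => p.1.1 * f (x + p.1.2 + p.2) with hφ
  have hφm : Measurable φ := by
    refine Measurable.mul (by fun_prop) (hf.comp (by fun_prop))
  have hfac : ∀ ω, φ (Z ω, D ω) = W' ω * f (x + B q.toNNReal ω) := by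
    intro ω
    simp only [hφ, hZ, hD]
    congr 2
    ring
  have hZD : Measurable fun ω => (Z ω, D ω) := hZm'.prodMk hDm
  have hi : Integrable (fun ω => W' ω * f (x + B q.toNNReal ω)) Q := by
    refine hint.bdd_mul (c := C) hW'm'.aestronglyMeasurable ?_
    filter_upwards [hae] with ω hω
    rw [← hω]; exact hC ω
  have hi' : Integrable φ ((Q.map Z).prod (Q.map D)) := by
    rw [← hprod, integrable_map_measure hφm.aestronglyMeasurable hZD.aemeasurable]
    exact hi.congr (Eventually.of_forall fun ω => (hfac ω).symm)
  have hZprob : IsProbabilityMeasure (Q.map Z) := Measure.isProbabilityMeasure_map hZm'.aemeasurable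
  have hDprob : IsProbabilityMeasure (Q.map D) := Measure.isProbabilityMeasure_map hDm.aemeasurable
  have hinner : ∀ z : ℝ × ℝ, ∫ d, φ (z, d) ∂(Q.map D) =
      z.1 * ∫ y, heatKernel (q - r) (x + z.2 - y) * f y := by
    intro z
    simp only [hφ]
    have hfm : Measurable fun a => f (x + z.2 + a) := hf.comp (measurable_const_add _)
    rw [integral_const_mul, integral_map hDm.aemeasurable hfm.aestronglyMeasurable,
      hDlaw.integral_comp_const_add (sub_pos.2 hrq) hf.aestronglyMeasurable]
  have hHm : Measurable fun z : ℝ × ℝ => z.1 * ∫ y, heatKernel (q - r) (x + z.2 - y) * f y := by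
    refine measurable_fst.mul ?_
    exact (measurable_integral_heatKernel (F := fun _ => f) (hf.comp measurable_snd)).comp
      (by fun_prop : Measurable fun z : ℝ × ℝ => (q - r, x + z.2))
  calc ∫ ω, W ω * f (x + B q.toNNReal ω) ∂Q
      = ∫ ω, φ (Z ω, D ω) ∂Q := by
        refine integral_congr_ae ?_
        filter_upwards [hae] with ω hω
        rw [hfac, hω]
    _ = ∫ z, ∫ d, φ (z, d) ∂(Q.map D) ∂(Q.map Z) := by
        rw [← integral_prod _ hi', ← hprod, integral_map hZD.aemeasurable hφm.aestronglyMeasurable]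
    _ = ∫ ω, W' ω * (∫ y, heatKernel (q - r) (x + B r' ω - y) * f y) ∂Q := by
        simp_rw [hinner]
        rw [integral_map hZm'.aemeasurable hHm.aestronglyMeasurable]
    _ = _ := by
        refine integral_congr_ae ?_
        filter_upwards [hae] with ω hω
        rw [hω]

end Markov

section Moments

variable {Ω : Type*} [MeasurableSpace Ω] {Q : Measure Ω} [IsProbabilityMeasure Q] {X : Ω → ℝ}

/-- The inequality `a ≤ 1 + a²` trades the first moment for the `L²` norm. The resulting singularity
`t^(-1/2)` is integrable at zero. -/
lemma ProbabilityTheory.HasLaw.lintegral_enorm_comp_const_add_le {t : ℝ} (hX : HasLaw X (gaussianReal 0 t.toNNReal) Q)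
    (ht : 0 < t) {f : ℝ → ℝ} (hf : Measurable f) (x : ℝ) :
    ∫⁻ ω, ‖f (x + X ω)‖ₑ ∂Q ≤
      1 + ENNReal.ofReal (√(2 * Real.pi * t))⁻¹ * ∫⁻ y, ‖f y‖ₑ ^ 2 := by
  have h := hX.const_add_gaussianReal x
  have h1 : ∀ a : ℝ≥0∞, a ≤ 1 + a ^ 2 := by
    intro a
    rcases le_total a 1 with h | h
    · exact h.trans le_self_add
    · refine le_trans ?_ le_add_self
      rw [sq]
      exact le_mul_of_one_le_left' h
  calc ∫⁻ ω, ‖f (x + X ω)‖ₑ ∂Q ≤ ∫⁻ ω, (1 + ‖f (x + X ω)‖ₑ ^ 2) ∂Q :=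
        lintegral_mono fun ω => h1 _
    _ = 1 + ∫⁻ ω, ‖f (x + X ω)‖ₑ ^ 2 ∂Q := by
        rw [lintegral_add_left measurable_const]; simp
    _ ≤ _ := by
        gcongr
        have h2 := h.lintegral_comp (f := fun y => ‖f y‖ₑ ^ 2) (hf.enorm.pow_const 2).aemeasurable
        rw [h2]
        refine (lintegral_mono' (gaussianReal_le_smul_volume ht x) le_rfl).trans ?_
        rw [lintegral_smul_measure, smul_eq_mul]

lemma enorm_integral_heatKernel_le {t : ℝ} (ht : 0 < t) {f : ℝ → ℝ} (hf : Measurable f) (x : ℝ) :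
    ‖∫ y, heatKernel t (x - y) * f y‖ₑ ≤
      1 + ENNReal.ofReal (√(2 * Real.pi * t))⁻¹ * ∫⁻ y, ‖f y‖ₑ ^ 2 := by
  have hid : HasLaw (fun y : ℝ => y) (gaussianReal 0 t.toNNReal) (gaussianReal 0 t.toNNReal) :=
    HasLaw.id
  rw [← hid.integral_comp_const_add ht hf.aestronglyMeasurable x]
  exact (enorm_integral_le_lintegral_enorm _).trans (hid.lintegral_enorm_comp_const_add_le ht hf x)

lemma exists_abs_integral_heatKernel_le {t : ℝ} (ht : 0 < t) {f : ℝ → ℝ} (hf : Measurable f)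
    (hf2 : MemLp f 2 volume) : ∃ D : ℝ, ∀ x, |∫ y, heatKernel t (x - y) * f y| ≤ D := by
  have h2 : ∫⁻ y, ‖f y‖ₑ ^ 2 < ∞ := by
    have := (eLpNorm_lt_top_iff_lintegral_rpow_enorm_lt_top two_ne_zero ENNReal.ofNat_ne_top).1 hf2.2
    simpa using this
  refine ⟨(1 + ENNReal.ofReal (√(2 * Real.pi * t))⁻¹ * ∫⁻ y, ‖f y‖ₑ ^ 2).toReal, fun x => ?_⟩
  rw [← Real.norm_eq_abs, ← toReal_enorm]
  exact ENNReal.toReal_mono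
    (ENNReal.add_lt_top.2 ⟨ENNReal.one_lt_top, ENNReal.mul_lt_top ENNReal.ofReal_lt_top h2⟩).ne
    (enorm_integral_heatKernel_le ht hf x)

lemma intervalIntegrable_inv_sqrt {t : ℝ} (ht : 0 ≤ t) :
    IntervalIntegrable (fun s => (√(2 * Real.pi * s))⁻¹) volume 0 t := by
  have h := (intervalIntegral.intervalIntegrable_rpow' (a := 0) (b := t) (r := -(1 / 2))
    (by norm_num)).const_mul (√(2 * Real.pi))⁻¹
  refine h.congr fun s hs => ?_
  rw [uIoc_of_le ht] at hs
  rw [Real.sqrt_mul (by positivity : (0 : ℝ) ≤ 2 * Real.pi) s, mul_inv, Real.rpow_neg hs.1.le, ← Real.sqrt_eq_rpow]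

end Moments
end


/-! ### Duhamel's formula along a Brownian path -/

noncomputable section

/-- Duhamel's formula on `[0, t]` for a potential bounded by `K` and a measurable solution for which
the source term has squared spatial norm at most `C`. -/
structure IsDuhamelSolution (V : ℝ → ℝ → ℝ) (g : ℝ → ℝ) (u : ℝ → ℝ → ℝ) (t K : ℝ) (C : ℝ≥0) :
    Prop where
  measurable_potential : Measurable (Function.uncurry V)
  abs_potential_le : ∀ s y, |V s y| ≤ K
  measurable : Measurable (Function.uncurry u)
  lintegral_sq_le : ∀ s ∈ Icc 0 t, ∫⁻ y, ‖V s y * u s y‖ₑ ^ 2 ≤ C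
  continuous_initial : Continuous g
  memLp_initial : MemLp g 2 volume
  duhamel : ∀ τ : ℝ, 0 < τ → τ ≤ t → ∀ x : ℝ,
    u τ x = (∫ y, heatKernel τ (x - y) * g y) +
      ∫ s in (0 : ℝ)..τ, ∫ y, heatKernel (τ - s) (x - y) * (V s y * u s y)

namespace IsDuhamelSolution

variable {Ω : Type*} [MeasurableSpace Ω] {Q : Measure Ω} [IsProbabilityMeasure Q]
  {B : ℝ≥0 → Ω → ℝ} {V : ℝ → ℝ → ℝ} {g : ℝ → ℝ} {u : ℝ → ℝ → ℝ} {t K : ℝ} {C : ℝ≥0}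

/-- A bound for the mean of the source term after time `s`. -/
def meanBound (C : ℝ≥0) (s : ℝ) : ℝ := 1 + (√(2 * Real.pi * s))⁻¹ * C

lemma intervalIntegrable_meanBound (C : ℝ≥0) {t : ℝ} (ht : 0 ≤ t) :
    IntervalIntegrable (meanBound C) volume 0 t :=
  intervalIntegrable_const.add ((intervalIntegrable_inv_sqrt ht).mul_const _)

lemma measurable_source (h : IsDuhamelSolution V g u t K C) :
    Measurable (Function.uncurry fun s y => V s y * u s y) :=
  h.measurable_potential.mul h.measurable

lemma memLp_source (h : IsDuhamelSolution V g u t K C) {s : ℝ} (hs : s ∈ Icc 0 t) :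
    MemLp (fun y => V s y * u s y) 2 volume := by
  refine ⟨(h.measurable_source.comp measurable_prodMk_left).aestronglyMeasurable, ?_⟩
  rw [eLpNorm_lt_top_iff_lintegral_rpow_enorm_lt_top two_ne_zero ENNReal.ofNat_ne_top]
  have := (h.lintegral_sq_le s hs).trans_lt ENNReal.coe_lt_top
  simpa using this

lemma lintegral_enorm_source_le (h : IsDuhamelSolution V g u t K C) {X : Ω → ℝ} {q : ℝ}
    (hX : HasLaw X (gaussianReal 0 q.toNNReal) Q) (hq : 0 < q) {s : ℝ} (hs : s ∈ Icc 0 t) (x : ℝ) :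
    ∫⁻ ω, ‖V s (x + X ω) * u s (x + X ω)‖ₑ ∂Q ≤ ENNReal.ofReal (meanBound C q) := by
  refine (hX.lintegral_enorm_comp_const_add_le hq (f := fun y => V s y * u s y)
    (h.measurable_source.comp measurable_prodMk_left) x).trans ?_
  rw [meanBound, ENNReal.ofReal_add zero_le_one (by positivity), ENNReal.ofReal_one,
    ENNReal.ofReal_mul (by positivity), ENNReal.ofReal_coe_nnreal]
  gcongr
  exact h.lintegral_sq_le s hs

lemma abs_integral_heatKernel_source_le (h : IsDuhamelSolution V g u t K C) {q : ℝ} (hq : 0 < q)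
    {s : ℝ} (hs : s ∈ Icc 0 t) (x : ℝ) :
    |∫ y, heatKernel q (x - y) * (V s y * u s y)| ≤ meanBound C q := by
  have h2 := enorm_integral_heatKernel_le hq (f := fun y => V s y * u s y)
    (h.measurable_source.comp measurable_prodMk_left) x
  have h0 : 0 ≤ meanBound C q := by unfold meanBound; positivity
  rw [← Real.norm_eq_abs, ← toReal_enorm]
  refine ENNReal.toReal_le_of_le_ofReal h0 (h2.trans ?_)
  rw [meanBound, ENNReal.ofReal_add zero_le_one (by positivity), ENNReal.ofReal_one,
    ENNReal.ofReal_mul (by positivity), ENNReal.ofReal_coe_nnreal]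
  gcongr
  exact h.lintegral_sq_le s hs

/-- The source term seen by the path run backwards in time. -/
def pathSource (V u : ℝ → ℝ → ℝ) (B : ℝ≥0 → Ω → ℝ) (t x : ℝ) (p : ℝ × Ω) : ℝ :=
  V (t - p.1) (x + B p.1.toNNReal p.2) * u (t - p.1) (x + B p.1.toNNReal p.2)

lemma measurable_reversed (hBm : Measurable (Function.uncurry B)) (t x : ℝ) :
    Measurable fun p : ℝ × Ω => (t - p.1, x + B p.1.toNNReal p.2) := by
  have : Measurable fun p : ℝ × Ω => B p.1.toNNReal p.2 :=
    hBm.comp ((measurable_real_toNNReal.comp measurable_fst).prodMk measurable_snd)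
  fun_prop

lemma measurable_pathSource (h : IsDuhamelSolution V g u t K C)
    (hBm : Measurable (Function.uncurry B)) (x : ℝ) :
    Measurable (pathSource V u B t x) :=
  h.measurable_source.comp (measurable_reversed hBm t x)

lemma integrable_pathSource (h : IsDuhamelSolution V g u t K C) (ht : 0 ≤ t)
    (hB : IsPreBrownianReal B Q) (hBm : Measurable (Function.uncurry B)) (x : ℝ) :
    Integrable (pathSource V u B t x) ((volume.restrict (Ioo 0 t)).prod Q) := by
  have hm := h.measurable_pathSource hBm x
  refine ⟨hm.aestronglyMeasurable, ?_⟩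
  rw [HasFiniteIntegral, lintegral_prod _ hm.enorm.aemeasurable]
  have hi : IntegrableOn (meanBound C) (Ioo 0 t) :=
    ((intervalIntegrable_iff_integrableOn_Ioo_of_le ht).1 (intervalIntegrable_meanBound C ht))
  refine lt_of_le_of_lt (setLIntegral_mono' measurableSet_Ioo fun q hq => ?_)
    hi.lintegral_lt_top
  exact h.lintegral_enorm_source_le (hB.hasLaw_eval q.toNNReal) hq.1
    (s := t - q) ⟨by linarith [hq.2], by linarith [hq.1]⟩ x

lemma integrable_initial (h : IsDuhamelSolution V g u t K C) (ht : 0 < t)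
    (hB : IsPreBrownianReal B Q) (x : ℝ) : Integrable (fun ω => g (x + B t.toNNReal ω)) Q :=
  ((hB.hasLaw_eval t.toNNReal).memLp_comp_const_add ht h.memLp_initial x).integrable one_le_two

/-- The substitution `s = t - q` turns the source integral into one over path times after `r`. -/
lemma eq_add_integral (h : IsDuhamelSolution V g u t K C) {r : ℝ} (hr : 0 ≤ r) (hrt : r < t)
    (z : ℝ) :
    u (t - r) z = (∫ y, heatKernel (t - r) (z - y) * g y) +
      ∫ q in Ioo r t, ∫ y, heatKernel (q - r) (z - y) * (V (t - q) y * u (t - q) y) := by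
  rw [h.duhamel (t - r) (by linarith) (by linarith) z, ← integral_Ioc_eq_integral_Ioo,
    ← intervalIntegral.integral_of_le hrt.le]
  congr 1
  have := intervalIntegral.integral_comp_sub_left (a := r) (b := t)
    (fun s => ∫ y, heatKernel (t - r - s) (z - y) * (V s y * u s y)) t
  rw [sub_self] at this
  rw [← this]
  refine intervalIntegral.integral_congr fun q _ => ?_
  congr! 4
  ring

/-- Duhamel's formula along a Brownian path, tested against a bounded variable that depends on the
path up to time `r`. -/
lemma integral_mul_path (h : IsDuhamelSolution V g u t K C) (hB : IsPreBrownianReal B Q)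
    (hm : ∀ t, Measurable (B t)) (hBm : Measurable (Function.uncurry B)) (x : ℝ)
    {r : ℝ} (hr : 0 ≤ r) (hrt : r < t) {W : Ω → ℝ} (hWm : Measurable W) {D : ℝ}
    (hW : AEStronglyMeasurable[pastSigma B r.toNNReal] W Q) (hD : ∀ ω, |W ω| ≤ D) :
    ∫ ω, W ω * u (t - r) (x + B r.toNNReal ω) ∂Q = (∫ ω, W ω * g (x + B t.toNNReal ω) ∂Q) +
      ∫ p, (if r < p.1 then W p.2 * pathSource V u B t x p else 0)
        ∂((volume.restrict (Ioo 0 t)).prod Q) := by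
  have ht : 0 < t := hr.trans_lt hrt
  set b := pathSource V u B t x with hb
  set F : ℝ → ℝ → ℝ := fun q z =>
    ∫ y, heatKernel (q - r) (z - y) * (V (t - q) y * u (t - q) y) with hF
  have hbm : Measurable b := h.measurable_pathSource hBm x
  have hbi : Integrable b ((volume.restrict (Ioo 0 t)).prod Q) :=
    h.integrable_pathSource ht.le hB hBm x
  have hFm : Measurable (Function.uncurry F) := by
    have h1 : Measurable (Function.uncurry fun s y => V (t - (s + r)) y * u (t - (s + r)) y) :=
      h.measurable_source.comp (by fun_prop : Measurable fun p : ℝ × ℝ => (t - (p.1 + r), p.2))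
    have h2 := (measurable_integral_heatKernel h1).comp
      (by fun_prop : Measurable fun p : ℝ × ℝ => (p.1 - r, p.2))
    convert h2 using 1
    ext p
    simp [hF, Function.uncurry]
  have hBr : Measurable fun ω => x + B r.toNNReal ω := (hm _).const_add x
  have hWF : Integrable (fun p : ℝ × Ω => W p.2 * F p.1 (x + B r.toNNReal p.2))
      ((volume.restrict (Ioo r t)).prod Q) := by
    have hi : IntegrableOn (fun q => D * meanBound C (q - r)) (Ioo r t) := by
      have h1 := (intervalIntegrable_meanBound C (t := t - r) (by linarith)).comp_sub_right r
      rw [zero_add, sub_add_cancel] at h1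
      exact ((intervalIntegrable_iff_integrableOn_Ioo_of_le hrt.le).1 h1).const_mul D
    refine (hi.comp_fst Q).mono' ?_ ?_
    · exact ((hWm.comp measurable_snd).mul (hFm.comp
        (measurable_fst.prodMk (hBr.comp measurable_snd)))).aestronglyMeasurable
    · have hmem : ∀ᵐ p ∂((volume.restrict (Ioo r t)).prod Q), p.1 ∈ Ioo r t :=
        Measure.quasiMeasurePreserving_fst.ae (ae_restrict_mem measurableSet_Ioo)
      filter_upwards [hmem] with p hp
      rw [Real.norm_eq_abs, abs_mul]
      exact mul_le_mul (hD _) (h.abs_integral_heatKernel_source_le (sub_pos.2 hp.1)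
        ⟨by linarith [hp.2], by linarith [hp.1]⟩ _) (abs_nonneg _) ((abs_nonneg _).trans (hD p.2))
  have hWg : Integrable (fun ω => W ω * ∫ y, heatKernel (t - r) (x + B r.toNNReal ω - y) * g y) Q := by
    obtain ⟨D', hD'⟩ := exists_abs_integral_heatKernel_le (sub_pos.2 hrt)
      h.continuous_initial.measurable h.memLp_initial
    have h1 : Measurable fun z => ∫ y, heatKernel (t - r) (z - y) * g y :=
      (measurable_integral_heatKernel (F := fun _ => g)
        (h.continuous_initial.measurable.comp measurable_snd)).comp
        (by fun_prop : Measurable fun z : ℝ => (t - r, z))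
    exact Integrable.of_bound (hWm.mul (h1.comp hBr)).aestronglyMeasurable (D * D')
      (Eventually.of_forall fun ω => by
        rw [Real.norm_eq_abs, abs_mul]
        exact mul_le_mul (hD ω) (hD' _) (abs_nonneg _) ((abs_nonneg _).trans (hD ω)))
  -- The heat kernel over time `q - r` started at `x + B_r` is replaced by the path itself at time
  -- `q`.
  have hmarkov : ∀ q ∈ Ioo r t, ∫ ω, W ω * F q (x + B r.toNNReal ω) ∂Q = ∫ ω, W ω * b (q, ω) ∂Q := by
    intro q hq
    have hq0 : 0 < q := hr.trans_lt hq.1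
    have hs : t - q ∈ Icc 0 t := ⟨by linarith [hq.2], by linarith⟩
    exact (hB.integral_mul_comp hm hr hq.1 (f := fun y => V (t - q) y * u (t - q) y)
      (h.measurable_source.comp measurable_prodMk_left) x
      (((hB.hasLaw_eval q.toNNReal).memLp_comp_const_add hq0 (h.memLp_source hs) x).integrable
        one_le_two) hW hD).symm
  have hite : Integrable (fun p : ℝ × Ω => if r < p.1 then W p.2 * b p else 0)
      ((volume.restrict (Ioo 0 t)).prod Q) := by
    have h1 : Integrable (fun p : ℝ × Ω => W p.2 * b p) ((volume.restrict (Ioo 0 t)).prod Q) :=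
      hbi.bdd_mul (c := D) (hWm.comp measurable_snd).aestronglyMeasurable
        (Eventually.of_forall fun p => hD _)
    exact h1.indicator (measurable_fst measurableSet_Ioi : MeasurableSet {p : ℝ × Ω | r < p.1})
  have hsource : ∫ p, (if r < p.1 then W p.2 * b p else 0) ∂((volume.restrict (Ioo 0 t)).prod Q) =
      ∫ q in Ioo r t, ∫ ω, W ω * F q (x + B r.toNNReal ω) ∂Q := by
    rw [integral_prod _ hite, setIntegral_congr_fun measurableSet_Ioo hmarkov]
    have h1 : ∀ q, ∫ ω, (if r < q then W ω * b (q, ω) else 0) ∂Q =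
        (Ioi r).indicator (fun q => ∫ ω, W ω * b (q, ω) ∂Q) q := by
      intro q
      by_cases hq : r < q <;> simp [hq]
    simp_rw [h1]
    rw [setIntegral_indicator measurableSet_Ioi]
    have h2 : Ioo 0 t ∩ Ioi r = Ioo r t := by
      ext q
      simp only [mem_inter_iff, mem_Ioo, mem_Ioi]
      exact ⟨fun hq => ⟨hq.2, hq.1.2⟩, fun hq => ⟨⟨hr.trans_lt hq.1, hq.2⟩, hq.1⟩⟩
    rw [h2]
  rw [hsource, ← integral_integral_swap (f := fun ω q => W ω * F q (x + B r.toNNReal ω)) hWF.swap,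
    hB.integral_mul_comp hm hr hrt h.continuous_initial.measurable x (h.integrable_initial ht hB x)
      hW hD, ← integral_add hWg]
  · refine integral_congr_ae (Eventually.of_forall fun ω => ?_)
    simp only
    rw [h.eq_add_integral hr hrt, mul_add, integral_const_mul]
  · exact hWF.integral_prod_right

end IsDuhamelSolution
end


/-! ### The Feynman–Kac formula -/

noncomputable section

namespace IsDuhamelSolution

variable {Ω : Type*} [MeasurableSpace Ω] {Q : Measure Ω} [IsProbabilityMeasure Q]
  {B : ℝ≥0 → Ω → ℝ} {V : ℝ → ℝ → ℝ} {g : ℝ → ℝ} {u : ℝ → ℝ → ℝ} {t K : ℝ} {C : ℝ≥0}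

/-- The Feynman-Kac formula. The path starts at `x` and runs backwards in time. -/
theorem eq_integral_exp (h : IsDuhamelSolution V g u t K C) (ht : 0 < t)
    (hB : IsPreBrownianReal B Q) (hm : ∀ t, Measurable (B t))
    (hcont : ∀ ω, Continuous fun t => B t ω) (x : ℝ) :
    u t x = ∫ ω, g (x + B t.toNNReal ω) *
      Real.exp (∫ q in (0 : ℝ)..t, V (t - q) (x + B q.toNNReal ω)) ∂Q := by
  have hBm := measurable_brownianPath hm hcont
  set ν := (volume : Measure ℝ).restrict (Ioo 0 t) with hν
  set μ := ν.prod Q with hμ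
  set b := pathSource V u B t x with hb
  set Y : Ω → ℝ := fun ω => g (x + B t.toNNReal ω) with hY
  set v : ℝ → Ω → ℝ := fun q ω => V (t - q) (x + B q.toNNReal ω) with hv
  set E : ℝ → Ω → ℝ := fun r ω => Real.exp (∫ q in (0 : ℝ)..r, v q ω) with hE
  -- `a` is the time derivative of `E`. It depends on the past up to `r`, hence is an admissible
  -- test variable.
  set a : ℝ → Ω → ℝ := fun r ω => v r ω * E r ω with ha
  have hK0 : 0 ≤ K := (abs_nonneg _).trans (h.abs_potential_le 0 0)
  have hvm : Measurable (Function.uncurry v) :=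
    h.measurable_potential.comp (measurable_reversed hBm t x)
  have hvK : ∀ r ω, |v r ω| ≤ K := fun r ω => h.abs_potential_le _ _
  have hvω : ∀ ω, Measurable fun r => v r ω := fun ω => hvm.comp measurable_prodMk_right
  have hEm : Measurable (Function.uncurry E) := by
    refine Real.measurable_exp.comp (f := fun p : ℝ × Ω => ∫ q in (0 : ℝ)..p.1, v q p.2)
      (measurable_uncurry_of_continuous_of_measurable (u := fun r ω => ∫ q in (0 : ℝ)..r, v q ω)
        (fun ω => ?_) fun r => ?_)
    · exact intervalIntegral.continuous_primitive
        (fun a b => intervalIntegrable_of_abs_le (hvω ω) (fun r => hvK r ω) a b) 0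
    · have h1 : Measurable fun p : Ω × ℝ => v p.2 p.1 := hvm.comp measurable_swap
      simp only [intervalIntegral]
      exact (h1.stronglyMeasurable.integral_prod_right'.sub
        h1.stronglyMeasurable.integral_prod_right').measurable
  have hEK : ∀ r ω, 0 ≤ r → r ≤ t → |E r ω| ≤ Real.exp (K * t) := by
    intro r ω hr hrt
    rw [abs_of_pos (Real.exp_pos _), Real.exp_le_exp]
    have h1 := intervalIntegral.norm_integral_le_of_norm_le_const (a := 0) (b := r)
      (f := fun q => v q ω) (C := K) fun q _ => hvK q ω
    rw [sub_zero, abs_of_nonneg hr, Real.norm_eq_abs] at h1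
    exact (le_abs_self _).trans (h1.trans (mul_le_mul_of_nonneg_left hrt hK0))
  have ham : Measurable (Function.uncurry a) := hvm.mul hEm
  have haω : ∀ r, Measurable (a r) := fun r => ham.comp measurable_prodMk_left
  set D := K * Real.exp (K * t) with hD
  have haD : ∀ r ω, 0 ≤ r → r ≤ t → |a r ω| ≤ D := fun r ω hr hrt => by
    rw [ha, abs_mul]
    exact mul_le_mul (hvK r ω) (hEK r ω hr hrt) (abs_nonneg _) hK0
  have hadapt : ∀ r, 0 ≤ r → AEStronglyMeasurable[pastSigma B r.toNNReal] (a r) Q := by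
    intro r hr
    have hvr : ∀ q, 0 ≤ q → q ≤ r → Measurable[pastSigma B r.toNNReal] (v q) := by
      intro q _ hqr
      have h1 : Measurable[pastSigma B r.toNNReal] fun ω => x + B q.toNNReal ω :=
        (measurable_pastSigma (Real.toNNReal_le_toNNReal hqr)).const_add x
      exact (h.measurable_potential.comp (measurable_prodMk_left (x := t - q))).comp h1
    have hI := aestronglyMeasurable_intervalIntegral_of_forall (P := Q) (pastSigma_le hm r.toNNReal) hvm hvK hr
      (fun q hq hqr => (hvr q hq hqr).stronglyMeasurable.aestronglyMeasurable)
    exact (hvr r hr le_rfl).stronglyMeasurable.aestronglyMeasurable.mul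
      (Real.continuous_exp.comp_aestronglyMeasurable hI)
  have hYi : Integrable Y Q := h.integrable_initial ht hB x
  have hYm : Measurable Y := h.continuous_initial.measurable.comp ((hm _).const_add x)
  have hbm : Measurable b := h.measurable_pathSource hBm x
  have hbi : Integrable b μ := h.integrable_pathSource ht.le hB hBm x
  have hmem : ∀ᵐ p ∂μ, p.1 ∈ Ioo 0 t :=
    Measure.quasiMeasurePreserving_fst.ae (ae_restrict_mem measurableSet_Ioo)
  have hEb : Integrable (fun p : ℝ × Ω => E p.1 p.2 * b p) μ :=
    hbi.bdd_mul (c := Real.exp (K * t)) hEm.aestronglyMeasurable (by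
      filter_upwards [hmem] with p hp using hEK _ _ hp.1.le hp.2.le)
  have haY : Integrable (fun p : ℝ × Ω => a p.1 p.2 * Y p.2) μ :=
    (hYi.comp_snd ν).bdd_mul (c := D) ham.aestronglyMeasurable (by
      filter_upwards [hmem] with p hp using haD _ _ hp.1.le hp.2.le)
  set G : ℝ → ℝ × Ω → ℝ := fun r p => if r < p.1 then a r p.2 * b p else 0 with hG
  have hGm : Measurable (Function.uncurry G) := by
    refine Measurable.ite (measurableSet_lt measurable_fst (measurable_fst.comp measurable_snd))
      ((ham.comp (measurable_fst.prodMk (measurable_snd.comp measurable_snd))).mul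
        (hbm.comp measurable_snd)) measurable_const
  have hGi : Integrable (Function.uncurry G) (ν.prod μ) := by
    refine ((hbi.comp_snd ν).norm.const_mul D).mono' hGm.aestronglyMeasurable ?_
    have h1 : ∀ᵐ p ∂(ν.prod μ), p.1 ∈ Ioo 0 t :=
      Measure.quasiMeasurePreserving_fst.ae (ae_restrict_mem measurableSet_Ioo)
    filter_upwards [h1] with p hp
    have hD0 : 0 ≤ D := by positivity
    simp only [Function.uncurry, hG]
    split_ifs
    · rw [norm_mul]
      exact mul_le_mul_of_nonneg_right (haD _ _ hp.1.le hp.2.le) (norm_nonneg _)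
    · simpa using mul_nonneg hD0 (abs_nonneg _)
  -- The source `b` at time `r` contains `v r`, so `a r` times the solution at `x + B_r` equals `E
  -- r` times `b`.
  have hstep : ∀ r ∈ Ioo 0 t, ∫ ω, E r ω * b (r, ω) ∂Q = (∫ ω, a r ω * Y ω ∂Q) + ∫ p, G r p ∂μ := by
    intro r hr
    rw [← h.integral_mul_path hB hm hBm x hr.1.le hr.2 (haω r) (hadapt r hr.1.le)
      fun ω => haD r ω hr.1.le hr.2.le]
    refine integral_congr_ae (Eventually.of_forall fun ω => ?_)
    simp only [ha, hb, hv, pathSource]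
    ring
  -- Integrating `r` first over `(0, q)` gives `∫ a = E q - 1`.
  have hswap : ∫ r, ∫ p, G r p ∂μ ∂ν = ∫ p, (E p.1 p.2 * b p - b p) ∂μ := by
    rw [integral_integral_swap hGi]
    refine integral_congr_ae ?_
    filter_upwards [hmem] with p hp
    have h1 := exp_primitive (hvω p.2) (fun r => hvK r p.2) p.1
    have h2 : ∀ r, G r p = (Iio p.1).indicator (fun r => a r p.2) r * b p := by
      intro r
      by_cases hr : r < p.1 <;> simp [hG, hr]
    simp_rw [h2]
    rw [integral_mul_const, hν, setIntegral_indicator measurableSet_Iio,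
      show Ioo 0 t ∩ Iio p.1 = Ioo 0 p.1 by
        rw [Ioo_inter_Iio, min_eq_right hp.2.le], ← integral_Ioc_eq_integral_Ioo,
      ← intervalIntegral.integral_of_le hp.1.le]
    have h3 : E p.1 p.2 = 1 + ∫ r in (0 : ℝ)..p.1, a r p.2 := h1
    rw [h3]
    ring
  -- The terms with `E b` cancel after integrating `hstep` over `r`, and only the mean of the source
  -- remains.
  have htotal : ∫ r, ∫ ω, a r ω * Y ω ∂Q ∂ν = ∫ p, b p ∂μ := by
    have h1 : ∫ p, E p.1 p.2 * b p ∂μ =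
        (∫ r, ∫ ω, a r ω * Y ω ∂Q ∂ν) + ∫ r, ∫ p, G r p ∂μ ∂ν := by
      have h2 : Integrable (fun r => ∫ ω, a r ω * Y ω ∂Q) ν := haY.integral_prod_left
      have h3 : Integrable (fun r => ∫ p, G r p ∂μ) ν := hGi.integral_prod_left
      rw [← integral_add h2 h3]
      exact (integral_prod _ hEb).trans (setIntegral_congr_fun measurableSet_Ioo hstep)
    rw [hswap, integral_sub hEb hbi] at h1
    linarith
  -- The same tested formula at `r = 0` with weight 1. Substituting `htotal` leaves `Y (1 + ∫ a) = Y
  -- exp(∫ v)` under the Brownian mean.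
  have hstart : u t x = (∫ ω, Y ω ∂Q) + ∫ p, b p ∂μ := by
    have h1 := h.integral_mul_path hB hm hBm x le_rfl ht (W := fun _ => 1) measurable_const
      (D := 1) aestronglyMeasurable_const (fun _ => by simp)
    have h2 : ∫ ω, 1 * u (t - 0) (x + B (0 : ℝ).toNNReal ω) ∂Q = u t x := by
      have h3 : ∀ᵐ ω ∂Q, 1 * u (t - 0) (x + B (0 : ℝ).toNNReal ω) = u t x := by
        filter_upwards [hB.eval_zero_ae_eq_zero] with ω hω
        simp [hω]
      rw [integral_congr_ae h3]
      simp
    rw [h2] at h1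
    rw [h1]
    congr 1
    · simp [hY]
    · refine integral_congr_ae ?_
      filter_upwards [hmem] with p hp
      simp [hp.1, hb]
  have hYa : Integrable (fun ω => ∫ r, a r ω * Y ω ∂ν) Q := haY.swap.integral_prod_left
  rw [hstart, ← htotal, integral_integral_swap haY, ← integral_add hYi hYa]
  refine integral_congr_ae (Eventually.of_forall fun ω => ?_)
  have h1 := exp_primitive (hvω ω) (fun r => hvK r ω) t
  have h2 : Real.exp (∫ q in (0 : ℝ)..t, v q ω) = 1 + ∫ r in (0 : ℝ)..t, a r ω := h1
  simp only
  rw [h2, integral_mul_const, intervalIntegral.integral_of_le ht.le, integral_Ioc_eq_integral_Ioo]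
  ring

end IsDuhamelSolution
end


/-! ### From mild solutions to Brownian functionals of the field -/

noncomputable section

/-- Continuity is known only for nonnegative times; replacing `s` by `max s 0` gives a jointly
measurable function on the plane without affecting the formula on `[0, t]`. -/
lemma IsMildSolution.isDuhamelSolution {V : ℝ → ℝ → ℝ} {g : ℝ → ℝ} {u : ℝ → ℝ → ℝ}
    (h : IsMildSolution V g u) (hV : Measurable (Function.uncurry V)) {K : ℝ}
    (hK : ∀ s y, |V s y| ≤ K) (hg : Continuous g) (hg2 : MemLp g 2 volume) (t : ℝ) :
    ∃ C : ℝ≥0, IsDuhamelSolution V g (fun s y => u (max s 0) y) t K C := by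
  obtain ⟨K', hK'⟩ := h.bounded t
  refine ⟨K.toNNReal ^ 2 * K' ^ 2, hV, hK, ?_, fun s hs => ?_, hg, hg2, fun τ hτ hτt x => ?_⟩
  · have : Continuous fun p : ℝ × ℝ => u (max p.1 0) p.2 :=
      h.continuousOn.comp_continuous (f := fun p : ℝ × ℝ => (max p.1 0, p.2)) (by fun_prop)
        fun p => ⟨le_max_right p.1 0, mem_univ _⟩
    exact this.measurable
  · have h1 : ∫⁻ y, ‖u s y‖ₑ ^ 2 ≤ (K' : ℝ≥0∞) ^ 2 := by
      have h2 := eLpNorm_eq_lintegral_rpow_enorm_toReal (f := u s) (μ := volume) two_ne_zero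
        ENNReal.ofNat_ne_top
      have h3 : ∫⁻ y, ‖u s y‖ₑ ^ 2 = eLpNorm (u s) 2 volume ^ 2 := by
        rw [h2, ← ENNReal.rpow_natCast, ← ENNReal.rpow_mul]
        simp
      rw [h3]
      exact pow_le_pow_left' (hK' s hs) 2
    calc ∫⁻ y, ‖V s y * u (max s 0) y‖ₑ ^ 2 ≤ ∫⁻ y, (K.toNNReal : ℝ≥0∞) ^ 2 * ‖u s y‖ₑ ^ 2 := by
          refine lintegral_mono fun y => ?_
          rw [enorm_mul, mul_pow, max_eq_left hs.1]
          gcongr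
          rw [Real.enorm_eq_ofReal_abs]
          exact ENNReal.ofReal_le_ofReal (hK s y)
      _ = (K.toNNReal : ℝ≥0∞) ^ 2 * ∫⁻ y, ‖u s y‖ₑ ^ 2 := lintegral_const_mul' _ _ (by simp)
      _ ≤ ((K.toNNReal ^ 2 * K' ^ 2 : ℝ≥0) : ℝ≥0∞) := by
          push_cast
          gcongr
  · rw [max_eq_left hτ.le, h.duhamel τ hτ x]
    congr 1
    refine intervalIntegral.integral_congr fun s hs => ?_
    rw [uIcc_of_le hτ.le] at hs
    simp only [max_eq_left hs.1]

section Brownian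

variable {Ω : Type*} [MeasurableSpace Ω] {Q : Measure Ω} [IsProbabilityMeasure Q]
  {B : ℝ≥0 → Ω → ℝ} {g : ℝ → ℝ}

lemma ProbabilityTheory.IsPreBrownianReal.memLp_comp (hB : IsPreBrownianReal B Q) (hg : MemLp g 2 volume)
    (x : ℝ) {t : ℝ} (ht : 0 ≤ t) : MemLp (fun ω => g (x + B t.toNNReal ω)) 2 Q := by
  rcases ht.eq_or_lt with rfl | ht
  · have : (fun ω => g (x + B (0 : ℝ).toNNReal ω)) =ᵐ[Q] fun _ => g x := by
      filter_upwards [hB.eval_zero_ae_eq_zero] with ω hω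
      simp [hω]
    exact (memLp_congr_ae this).2 (memLp_const _)
  · exact (hB.hasLaw_eval _).memLp_comp_const_add ht hg x

variable {S : Type*} [MeasurableSpace S] {P : Measure S} {c : ℝ≥0 → ℝ → S → ℝ} {φ : ℝ → ℝ} {M : ℝ}

/-- The Feynman-Kac formula for the random potential. -/
lemma IsMixingField.mildSolution_eq (H : IsMixingField c P φ M) {α β ε : ℝ} (hε : 0 < ε)
    (hB : IsPreBrownianReal B Q) (hm : ∀ t, Measurable (B t))
    (hcont : ∀ ω, Continuous fun t => B t ω) (hg : Continuous g) (hg2 : MemLp g 2 volume)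
    {u : ℝ → ℝ → ℝ} {s : S}
    (hu : IsMildSolution (rescaledPotential α β (α / 2) ε (fun t x => c t x s)) g u)
    {t : ℝ} (ht : 0 ≤ t) (x : ℝ) :
    u t x = ∫ ω, g (x + B t.toNNReal ω) *
      Real.exp (fieldAction α β ε c (fun r ω => x + B (t - r).toNNReal ω) t ω s) ∂Q := by
  rcases ht.eq_or_lt with rfl | ht
  · have : ∀ᵐ ω ∂Q, g (x + B (0 : ℝ).toNNReal ω) * Real.exp
        (fieldAction α β ε c (fun r ω => x + B (0 - r).toNNReal ω) 0 ω s) = g x := by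
      filter_upwards [hB.eval_zero_ae_eq_zero] with ω hω
      simp [hω, fieldAction]
    rw [integral_congr_ae this, hu.initial]
    simp
  · have hV : Measurable (Function.uncurry
        (rescaledPotential α β (α / 2) ε (fun t x => c t x s))) :=
      (H.measurable_rescaledPotential α β ε).comp
        (by fun_prop : Measurable fun p : ℝ × ℝ => (p.1, p.2, s))
    obtain ⟨C, hC⟩ := hu.isDuhamelSolution hV (H.abs_rescaledPotential_le α β hε s) hg hg2 t
    have h1 := hC.eq_integral_exp ht hB hm hcont x
    simp only [max_eq_left ht.le] at h1
    rw [h1]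
    refine integral_congr_ae (Eventually.of_forall fun ω => ?_)
    simp only [fieldAction]
    congr 2
    -- Reversing time moves the reversal from the potential to the path.
    have h2 := intervalIntegral.integral_comp_sub_left (a := 0) (b := t)
      (fun q => rescaledPotential α β (α / 2) ε (fun t x => c t x s) (t - q)
        (x + B q.toNNReal ω)) t
    rw [sub_self, sub_zero] at h2
    rw [← h2]
    simp

end Brownian
end


/-! ### Smoothness of the heat semigroup at positive times -/

noncomputable section

/-- The moments `∫ (x - y) ^ n h_t(x - y) g(y) dy` of the heat kernel against `g`. -/
def heatMoment (g : ℝ → ℝ) (n : ℕ) (t x : ℝ) : ℝ :=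
  ∫ y, (x - y) ^ n * heatKernel t (x - y) * g y

section Derivatives

variable {g : ℝ → ℝ}

/-- The power is absorbed by `n! e^{|z|}`, the linear exponent by half of the Gaussian exponent
`z²/(4t₀)`, and the other half tolerates moving `z` to `w` through `w² ≤ 2z² + 2`. The majorant is
uniform for times near `t₀` and points within distance 1. -/
lemma pow_mul_heatKernel_le (n : ℕ) {t₀ t : ℝ} (ht₀ : 0 < t₀) (h1 : t₀ / 2 < t) (h2 : t < 2 * t₀)
    {z w : ℝ} (hzw : |z - w| < 1) :
    |z ^ n * heatKernel t z| ≤ n.factorial * (√(2 * Real.pi * (t₀ / 2)))⁻¹ *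
      Real.exp (2 * t₀ + 1 / (8 * t₀)) * Real.exp (-(1 / (16 * t₀)) * w ^ 2) := by
  have ht : 0 < t := by linarith
  have hpow : |z| ^ n ≤ n.factorial * Real.exp |z| := by
    have := Real.pow_div_factorial_le_exp |z| (abs_nonneg z) n
    rw [div_le_iff₀ (by positivity)] at this
    linarith
  have hw : w ^ 2 ≤ 2 * z ^ 2 + 2 := by
    have h3 : (z - w) ^ 2 ≤ 1 := by
      rw [← sq_abs]; nlinarith [abs_nonneg (z - w)]
    nlinarith [sq_nonneg (2 * z - w)]
  have hz : |z| ≤ z ^ 2 / (8 * t₀) + 2 * t₀ := by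
    have h3 : z ^ 2 / (8 * t₀) + 2 * t₀ - |z| = (|z| - 4 * t₀) ^ 2 / (8 * t₀) := by
      field_simp
      rw [sub_sq, sq_abs]
      ring
    have h4 : 0 ≤ (|z| - 4 * t₀) ^ 2 / (8 * t₀) := by positivity
    linarith
  have hexp : -z ^ 2 / (2 * t) ≤ -(z ^ 2 / (4 * t₀)) := by
    rw [neg_div, neg_le_neg_iff]
    exact div_le_div_of_nonneg_left (sq_nonneg z) (by positivity) (by linarith)
  have hker : heatKernel t z ≤ (√(2 * Real.pi * (t₀ / 2)))⁻¹ * Real.exp (-(z ^ 2 / (4 * t₀))) := by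
    unfold heatKernel
    gcongr
  have hsum : |z| + -(z ^ 2 / (4 * t₀)) ≤ (2 * t₀ + 1 / (8 * t₀)) + -(1 / (16 * t₀)) * w ^ 2 := by
    have h5 : 1 / (16 * t₀) * w ^ 2 ≤ 1 / (16 * t₀) * (2 * z ^ 2 + 2) :=
      mul_le_mul_of_nonneg_left hw (by positivity)
    have h6 : 1 / (16 * t₀) * (2 * z ^ 2 + 2) = z ^ 2 / (8 * t₀) + 1 / (8 * t₀) := by
      field_simp
      ring
    have h7 : z ^ 2 / (4 * t₀) = z ^ 2 / (8 * t₀) + z ^ 2 / (8 * t₀) := by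
      field_simp
      ring
    linarith
  rw [abs_mul, abs_pow, abs_of_nonneg (heatKernel_nonneg t z)]
  calc |z| ^ n * heatKernel t z
      ≤ (n.factorial * Real.exp |z|) *
        ((√(2 * Real.pi * (t₀ / 2)))⁻¹ * Real.exp (-(z ^ 2 / (4 * t₀)))) :=
        mul_le_mul hpow hker (heatKernel_nonneg t z) (by positivity)
    _ = n.factorial * (√(2 * Real.pi * (t₀ / 2)))⁻¹ *
        Real.exp (|z| + -(z ^ 2 / (4 * t₀))) := by rw [Real.exp_add]; ring
    _ ≤ n.factorial * (√(2 * Real.pi * (t₀ / 2)))⁻¹ *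
        Real.exp ((2 * t₀ + 1 / (8 * t₀)) + -(1 / (16 * t₀)) * w ^ 2) := by gcongr
    _ = _ := by rw [Real.exp_add]; ring

lemma exists_integrable_bound_heatMoment (hg : MemLp g 2 volume) (n : ℕ) {t₀ : ℝ} (ht₀ : 0 < t₀)
    (x₀ : ℝ) : ∃ b : ℝ → ℝ, Integrable b ∧ ∀ t x, t₀ / 2 < t → t < 2 * t₀ → |x - x₀| < 1 →
      ∀ y, |(x - y) ^ n * heatKernel t (x - y) * g y| ≤ b y := by
  set A := n.factorial * (√(2 * Real.pi * (t₀ / 2)))⁻¹ * Real.exp (2 * t₀ + 1 / (8 * t₀)) with hA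
  have hgauss : MemLp (fun y : ℝ => Real.exp (-(1 / (16 * t₀)) * (x₀ - y) ^ 2)) 2 volume := by
    refine (memLp_two_iff_integrable_sq (by fun_prop)).2 ?_
    have h1 := (integrable_exp_neg_mul_sq (b := 1 / (8 * t₀)) (by positivity)).comp_sub_left x₀
    refine h1.congr (Eventually.of_forall fun y => ?_)
    simp only
    rw [← Real.exp_nat_mul]
    congr 1
    push_cast
    field_simp
    ring
  refine ⟨fun y => A * (Real.exp (-(1 / (16 * t₀)) * (x₀ - y) ^ 2) * |g y|),
    (hgauss.integrable_mul hg.abs).const_mul A, fun t x h1 h2 hx y => ?_⟩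
  rw [abs_mul]
  simp only
  rw [← mul_assoc]
  refine mul_le_mul_of_nonneg_right ?_ (abs_nonneg _)
  exact pow_mul_heatKernel_le n ht₀ h1 h2 (by rwa [sub_sub_sub_cancel_right])

lemma aestronglyMeasurable_heatMoment (hg : MemLp g 2 volume) (n : ℕ) (t x : ℝ) :
    AEStronglyMeasurable (fun y => (x - y) ^ n * heatKernel t (x - y) * g y) volume := by
  have : Measurable fun y => heatKernel t (x - y) :=
    measurable_heatKernel.comp (by fun_prop : Measurable fun y : ℝ => (t, x - y))
  exact (Measurable.mul (by fun_prop) this).aestronglyMeasurable.mul hg.1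

lemma integrable_heatMoment (hg : MemLp g 2 volume) (n : ℕ) {t : ℝ} (ht : 0 < t) (x : ℝ) :
    Integrable fun y => (x - y) ^ n * heatKernel t (x - y) * g y := by
  obtain ⟨b, hb, hle⟩ := exists_integrable_bound_heatMoment hg n ht x
  exact hb.mono' (aestronglyMeasurable_heatMoment hg n t x) (Eventually.of_forall fun y =>
    hle t x (by linarith) (by linarith) (by simp) y)

lemma continuousAt_heatKernel {t : ℝ} (ht : 0 < t) (z : ℝ) :
    ContinuousAt (Function.uncurry heatKernel) (t, z) := by
  have h1 : √(2 * Real.pi * t) ≠ 0 := by positivity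
  have h2 : 2 * t ≠ 0 := by positivity
  unfold heatKernel Function.uncurry
  have c1 : ContinuousAt (fun p : ℝ × ℝ => √(2 * Real.pi * p.1)) (t, z) := by fun_prop
  have c2 : ContinuousAt (fun p : ℝ × ℝ => -p.2 ^ 2) (t, z) := by fun_prop
  have c3 : ContinuousAt (fun p : ℝ × ℝ => 2 * p.1) (t, z) := by fun_prop
  exact (c1.inv₀ h1).mul (c2.div c3 h2).rexp

lemma continuousAt_heatMoment (hg : MemLp g 2 volume) (n : ℕ) {t : ℝ} (ht : 0 < t) (x : ℝ) :
    ContinuousAt (Function.uncurry (heatMoment g n)) (t, x) := by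
  obtain ⟨b, hb, hle⟩ := exists_integrable_bound_heatMoment hg n ht x
  have hnear : ∀ᶠ p : ℝ × ℝ in 𝓝 (t, x), (t / 2 < p.1 ∧ p.1 < 2 * t) ∧ |p.2 - x| < 1 := by
    have c1 : ∀ᶠ s in 𝓝 t, t / 2 < s ∧ s < 2 * t := Ioo_mem_nhds (by linarith) (by linarith)
    have c2 : ∀ᶠ y in 𝓝 x, |y - x| < 1 := Metric.ball_mem_nhds x one_pos
    have d1 : Tendsto Prod.fst (𝓝 (t, x)) (𝓝 t) := continuous_fst.tendsto (t, x)
    have d2 : Tendsto Prod.snd (𝓝 (t, x)) (𝓝 x) := continuous_snd.tendsto (t, x)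
    exact (d1.eventually c1).and (d2.eventually c2)
  unfold heatMoment Function.uncurry
  refine continuousAt_of_dominated (bound := b)
    (Eventually.of_forall fun p => aestronglyMeasurable_heatMoment hg n p.1 p.2) ?_ hb ?_
  · filter_upwards [hnear] with p hp
    exact Eventually.of_forall fun y => hle p.1 p.2 hp.1.1 hp.1.2 hp.2 y
  · refine Eventually.of_forall fun y => ?_
    have h1 : ContinuousAt (fun p : ℝ × ℝ => heatKernel p.1 (p.2 - y)) (t, x) :=
      ContinuousAt.comp (g := Function.uncurry heatKernel) (f := fun p : ℝ × ℝ => (p.1, p.2 - y))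
        (continuousAt_heatKernel ht _) (by fun_prop)
    exact (ContinuousAt.mul (by fun_prop) h1).mul continuousAt_const

lemma hasDerivAt_heatKernel_space (t z : ℝ) :
    HasDerivAt (heatKernel t) (-(z / t) * heatKernel t z) z := by
  have h1 : HasDerivAt (fun z : ℝ => -z ^ 2 / (2 * t)) (-(z / t)) z := by
    refine (((hasDerivAt_pow 2 z).fun_neg).div_const (2 * t)).congr_deriv ?_
    rcases eq_or_ne t 0 with rfl | ht
    · simp
    · field_simp
      norm_num
  refine (h1.exp.const_mul (√(2 * Real.pi * t))⁻¹).congr_deriv ?_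
  unfold heatKernel
  ring

lemma hasDerivAt_heatKernel_time {t : ℝ} (ht : 0 < t) (z : ℝ) :
    HasDerivAt (fun t => heatKernel t z)
      ((z ^ 2 / (2 * t ^ 2) - 1 / (2 * t)) * heatKernel t z) t := by
  have h0 : 0 < 2 * Real.pi * t := by positivity
  have h1 : HasDerivAt (fun t : ℝ => -z ^ 2 / (2 * t)) (z ^ 2 / (2 * t ^ 2)) t := by
    refine ((hasDerivAt_const t (-z ^ 2)).fun_div ((hasDerivAt_id' t).const_mul 2)
      (by positivity)).congr_deriv ?_
    field_simp
    ring
  have h2 : HasDerivAt (fun t : ℝ => (√(2 * Real.pi * t))⁻¹)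
      (-(1 / (2 * t)) * (√(2 * Real.pi * t))⁻¹) t := by
    refine ((((hasDerivAt_id' t).const_mul (2 * Real.pi)).sqrt h0.ne').fun_inv
      (Real.sqrt_pos.2 h0).ne').congr_deriv ?_
    have h3 := Real.sqrt_pos.2 h0
    rw [Real.sq_sqrt h0.le]
    field_simp
  refine (h2.fun_mul h1.exp).congr_deriv ?_
  unfold heatKernel
  ring

/-- As `∂_z` of the kernel is `-(z/t)` times the kernel, these moments are closed under
differentiation in space. For `n = 0` the truncated index `n - 1` is harmless, its coefficient being
zero. -/
lemma hasDerivAt_heatMoment (hg : MemLp g 2 volume) (n : ℕ) {t : ℝ} (ht : 0 < t) (x : ℝ) :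
    HasDerivAt (heatMoment g n t)
      (n * heatMoment g (n - 1) t x - heatMoment g (n + 1) t x / t) x := by
  obtain ⟨b₁, hb₁, hle₁⟩ := exists_integrable_bound_heatMoment hg (n - 1) ht x
  obtain ⟨b₂, hb₂, hle₂⟩ := exists_integrable_bound_heatMoment hg (n + 1) ht x
  set F' : ℝ → ℝ → ℝ := fun x y => n * ((x - y) ^ (n - 1) * heatKernel t (x - y) * g y) -
    (x - y) ^ (n + 1) * heatKernel t (x - y) * g y / t with hF'
  have h := hasDerivAt_integral_of_dominated_loc_of_deriv_le (μ := volume)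
    (F := fun x y => (x - y) ^ n * heatKernel t (x - y) * g y) (F' := F') (x₀ := x)
    (bound := fun y => n * b₁ y + b₂ y / t) (Metric.ball_mem_nhds x one_pos)
    (Eventually.of_forall fun x => aestronglyMeasurable_heatMoment hg n t x)
    (integrable_heatMoment hg n ht x)
    (((integrable_heatMoment hg (n - 1) ht x).const_mul _).sub
      ((integrable_heatMoment hg (n + 1) ht x).div_const _)).1
    (Eventually.of_forall fun y x' hx' => ?_) ((hb₁.const_mul _).add (hb₂.div_const _))
    (Eventually.of_forall fun y x' _ => ?_)
  · have h1 := h.2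
    have h2 : ∫ y, F' x y = n * heatMoment g (n - 1) t x - heatMoment g (n + 1) t x / t := by
      rw [hF', integral_sub ((integrable_heatMoment hg (n - 1) ht x).const_mul _)
        ((integrable_heatMoment hg (n + 1) ht x).div_const _), integral_const_mul,
        integral_div]
      rfl
    rwa [h2] at h1
  · have e1 := hle₁ t x' (by linarith) (by linarith) hx' y
    have e2 := hle₂ t x' (by linarith) (by linarith) hx' y
    rw [hF', Real.norm_eq_abs]
    refine (abs_sub _ _).trans ?_
    rw [abs_mul, Nat.abs_cast, abs_div, abs_of_pos ht]
    gcongr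
  · have h1 : HasDerivAt (fun x => x - y) 1 x' := (hasDerivAt_id x').sub_const y
    have h2 := ((h1.fun_pow n).fun_mul
      (HasDerivAt.comp x' (hasDerivAt_heatKernel_space t (x' - y)) h1)).mul_const (g y)
    refine h2.congr_deriv ?_
    simp only [hF', Function.comp]
    field_simp
    ring

lemma hasDerivAt_heatMoment_time (hg : MemLp g 2 volume) {t : ℝ} (ht : 0 < t) (x : ℝ) :
    HasDerivAt (fun t => heatMoment g 0 t x)
      (heatMoment g 2 t x / (2 * t ^ 2) - heatMoment g 0 t x / (2 * t)) t := by
  obtain ⟨b₁, hb₁, hle₁⟩ := exists_integrable_bound_heatMoment hg 2 ht x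
  obtain ⟨b₂, hb₂, hle₂⟩ := exists_integrable_bound_heatMoment hg 0 ht x
  set F' : ℝ → ℝ → ℝ := fun t y => (x - y) ^ 2 * heatKernel t (x - y) * g y / (2 * t ^ 2) -
    (x - y) ^ 0 * heatKernel t (x - y) * g y / (2 * t) with hF'
  have h := hasDerivAt_integral_of_dominated_loc_of_deriv_le (μ := volume)
    (F := fun t y => (x - y) ^ 0 * heatKernel t (x - y) * g y) (F' := F') (x₀ := t)
    (bound := fun y => b₁ y / (2 * (t / 2) ^ 2) + b₂ y / (2 * (t / 2)))
    (Ioo_mem_nhds (a := t / 2) (b := 2 * t) (by linarith) (by linarith))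
    (Eventually.of_forall fun t => aestronglyMeasurable_heatMoment hg 0 t x)
    (integrable_heatMoment hg 0 ht x)
    (((integrable_heatMoment hg 2 ht x).div_const _).sub
      ((integrable_heatMoment hg 0 ht x).div_const _)).1
    (Eventually.of_forall fun y t' ht' => ?_) ((hb₁.div_const _).add (hb₂.div_const _))
    (Eventually.of_forall fun y t' ht' => ?_)
  · have h1 := h.2
    have h2 : ∫ y, F' t y = heatMoment g 2 t x / (2 * t ^ 2) - heatMoment g 0 t x / (2 * t) := by
      rw [hF', integral_sub ((integrable_heatMoment hg 2 ht x).div_const _)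
        ((integrable_heatMoment hg 0 ht x).div_const _), integral_div, integral_div]
      rfl
    rwa [h2] at h1
  · have e1 := hle₁ t' x ht'.1 ht'.2 (by simp) y
    have e2 := hle₂ t' x ht'.1 ht'.2 (by simp) y
    have ht0 : 0 < t' := by linarith [ht'.1]
    rw [hF', Real.norm_eq_abs]
    refine (abs_sub _ _).trans ?_
    rw [abs_div, abs_div, abs_of_pos (by positivity : 0 < 2 * t' ^ 2),
      abs_of_pos (by positivity : 0 < 2 * t')]
    have h3 := ht'.1.le
    gcongr
    · exact (abs_nonneg _).trans e1
    · exact (abs_nonneg _).trans e2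
  · have ht0 : 0 < t' := by linarith [ht'.1]
    have h2 := ((hasDerivAt_heatKernel_time ht0 (x - y)).const_mul ((x - y) ^ 0)).mul_const (g y)
    refine h2.congr_deriv ?_
    simp only [hF']
    ring

/-- Since the derivative involves the neighbouring moments, the induction on the order of smoothness
runs over all `n` at once. -/
lemma contDiff_heatMoment (hg : MemLp g 2 volume) {t : ℝ} (ht : 0 < t) (m n : ℕ) :
    ContDiff ℝ m (heatMoment g n t) := by
  induction m generalizing n with
  | zero =>
    rw [Nat.cast_zero, contDiff_zero]
    exact continuous_iff_continuousAt.2 fun x => (hasDerivAt_heatMoment hg n ht x).continuousAt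
  | succ m ih =>
    rw [Nat.cast_succ, contDiff_succ_iff_deriv]
    refine ⟨fun x => (hasDerivAt_heatMoment hg n ht x).differentiableAt, by simp, ?_⟩
    have : deriv (heatMoment g n t) =
        fun x => n * heatMoment g (n - 1) t x - heatMoment g (n + 1) t x / t :=
      funext fun x => (hasDerivAt_heatMoment hg n ht x).deriv
    rw [this]
    exact (contDiff_const.mul (ih _)).sub ((ih _).div_const _)

/-- Half of this expression is the time derivative in `hasDerivAt_heatMoment_time`; that is the heat
equation. -/
lemma iteratedDeriv_two_heatMoment (hg : MemLp g 2 volume) {t : ℝ} (ht : 0 < t) (x : ℝ) :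
    iteratedDeriv 2 (heatMoment g 0 t) x =
      heatMoment g 2 t x / t ^ 2 - heatMoment g 0 t x / t := by
  have h1 : deriv (heatMoment g 0 t) = fun x => -(heatMoment g 1 t x / t) := by
    ext x
    rw [(hasDerivAt_heatMoment hg 0 ht x).deriv]
    simp
  rw [iteratedDeriv_succ, iteratedDeriv_one, h1,
    (((hasDerivAt_heatMoment hg 1 ht x).div_const t).fun_neg).deriv]
  simp only [Nat.cast_one, Nat.sub_self, Nat.reduceAdd]
  field_simp
  ring

end Derivatives
end


/-! ### Continuity at time zero and the limit equation -/

noncomputable section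

/-- From `e^{-y} ≤ 1/y` with `y = z²/(2t)`: away from the origin the kernel is of order `√t`. -/
lemma heatKernel_le_of_le_abs {t d z : ℝ} (ht : 0 < t) (hd : 0 < d) (hz : d ≤ |z|) :
    heatKernel t z ≤ 2 * √t / d ^ 2 := by
  have h1 : Real.exp (-z ^ 2 / (2 * t)) ≤ 2 * t / d ^ 2 := by
    have h2 : d ^ 2 ≤ z ^ 2 := by rw [← sq_abs z]; exact pow_le_pow_left₀ hd.le hz 2
    have h3 : z ^ 2 / (2 * t) ≤ Real.exp (z ^ 2 / (2 * t)) := by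
      linarith [Real.add_one_le_exp (z ^ 2 / (2 * t))]
    have h4 : d ^ 2 / (2 * t) ≤ Real.exp (z ^ 2 / (2 * t)) :=
      le_trans (by gcongr) h3
    rw [neg_div, Real.exp_neg, ← inv_div (d ^ 2)]
    exact inv_anti₀ (by positivity) h4
  have h2 : (√(2 * Real.pi * t))⁻¹ ≤ (√t)⁻¹ := by
    have := Real.two_le_pi
    have h3 : 0 < √t := Real.sqrt_pos.2 ht
    exact inv_anti₀ h3 (Real.sqrt_le_sqrt (by nlinarith))
  calc heatKernel t z ≤ (√t)⁻¹ * (2 * t / d ^ 2) :=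
        mul_le_mul h2 h1 (Real.exp_pos _).le (by positivity)
    _ = 2 * √t / d ^ 2 := by
        have h3 : 0 < √t := Real.sqrt_pos.2 ht
        nth_rw 2 [← Real.mul_self_sqrt ht.le]
        field_simp

section Brownian

variable {Ω : Type*} [MeasurableSpace Ω] {Q : Measure Ω} [IsProbabilityMeasure Q]
  {B : ℝ≥0 → Ω → ℝ} {g : ℝ → ℝ}

/-- A square integrable function that vanishes near `x₀` has a small mean near `x₀` at small
times. -/
lemma ProbabilityTheory.IsPreBrownianReal.sq_integral_comp_le (hB : IsPreBrownianReal B Q)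
    (hg : MemLp g 2 volume) (hgm : Measurable g) {x₀ d : ℝ} (hd : 0 < d)
    (h0 : ∀ y, |y - x₀| < 2 * d → g y = 0) {t x : ℝ} (ht : 0 ≤ t) (hx : |x - x₀| < d) :
    (∫ ω, g (x + B t.toNNReal ω) ∂Q) ^ 2 ≤ 2 * √t / d ^ 2 * ∫ y, g y ^ 2 := by
  have hL := hB.memLp_comp hg x ht
  -- Jensen's inequality, in the form that the variance is nonnegative.
  have h1 : (∫ ω, g (x + B t.toNNReal ω) ∂Q) ^ 2 ≤ ∫ ω, g (x + B t.toNNReal ω) ^ 2 ∂Q := by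
    have h2 := variance_nonneg (fun ω => g (x + B t.toNNReal ω)) Q
    rw [variance_eq_sub hL] at h2
    simpa using h2
  refine h1.trans ?_
  rcases ht.eq_or_lt with rfl | ht
  · have h2 : ∀ᵐ ω ∂Q, g (x + B (0 : ℝ).toNNReal ω) ^ 2 = 0 := by
      filter_upwards [hB.eval_zero_ae_eq_zero] with ω hω
      rw [Real.toNNReal_zero, hω, add_zero, h0 x (by linarith), sq, zero_mul]
    rw [integral_congr_ae h2]
    simp
  · rw [(hB.hasLaw_eval t.toNNReal).integral_comp_const_add ht (f := fun y => g y ^ 2)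
      (hgm.pow_const 2).aestronglyMeasurable, ← integral_const_mul]
    refine integral_mono_of_nonneg (Eventually.of_forall fun y =>
      mul_nonneg (heatKernel_nonneg _ _) (sq_nonneg _)) (hg.integrable_sq.const_mul _)
      (Eventually.of_forall fun y => ?_)
    by_cases hy : |y - x₀| < 2 * d
    · simp [h0 y hy]
    · refine mul_le_mul_of_nonneg_right (heatKernel_le_of_le_abs ht hd ?_) (sq_nonneg _)
      have h3 := abs_sub_le y x x₀
      rw [abs_sub_comm y x] at h3
      linarith

/-- The heat semigroup applied to a continuous square integrable function is continuous at time
zero. -/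
lemma ProbabilityTheory.IsPreBrownianReal.tendsto_integral_comp (hB : IsPreBrownianReal B Q)
    (hm : ∀ t, Measurable (B t)) (hcont : ∀ ω, Continuous fun t => B t ω)
    (hg : Continuous g) (hg2 : MemLp g 2 volume) (x₀ : ℝ) :
    Tendsto (fun p : ℝ × ℝ => ∫ ω, g (p.2 + B p.1.toNNReal ω) ∂Q)
      (𝓝[Ici 0 ×ˢ univ] ((0 : ℝ), x₀)) (𝓝 (g x₀)) := by
  -- As `g` may be unbounded, it is truncated at a level it does not reach near `x₀`. The bounded
  -- part is treated by dominated convergence; the rest `r` vanishes near `x₀`, satisfies `|r| ≤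
  -- |g|`, and falls under `sq_integral_comp_le`.
  set A := |g x₀| + 1 with hA
  set f : ℝ → ℝ := fun y => max (-A) (min A (g y)) with hf
  have hA0 : 0 < A := by positivity
  have hfc : Continuous f := by fun_prop
  have hfA : ∀ y, |f y| ≤ A := fun y =>
    abs_le.2 ⟨le_max_left _ _, max_le (by linarith) (min_le_left _ _)⟩
  have hfeq : ∀ y, |g y| ≤ A → f y = g y := fun y hy => by
    rw [hf]
    simp only
    rw [min_eq_right (abs_le.1 hy).2, max_eq_right (abs_le.1 hy).1]
  have hfg : ∀ y, |g y - f y| ≤ |g y| := fun y => by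
    by_cases hy : |g y| ≤ A
    · rw [hfeq y hy, sub_self, abs_zero]; exact abs_nonneg _
    · simp only [hf]
      rcases le_total 0 (g y) with h | h
      · rw [abs_of_nonneg h] at hy ⊢
        rw [min_eq_left (by linarith), max_eq_right (by linarith), abs_of_nonneg (by linarith)]
        linarith
      · rw [abs_of_nonpos h] at hy ⊢
        rw [min_eq_right (by linarith), max_eq_left (by linarith), abs_of_nonpos (by linarith)]
        linarith
  set r : ℝ → ℝ := fun y => g y - f y with hr
  have hrc : Continuous r := hg.sub hfc
  have hr2 : MemLp r 2 volume := hg2.mono hrc.aestronglyMeasurable (Eventually.of_forall hfg)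
  obtain ⟨d, hd, hrd⟩ : ∃ d > 0, ∀ y, |y - x₀| < 2 * d → r y = 0 := by
    have h1 : ∀ᶠ y in 𝓝 x₀, |g y| < A :=
      hg.abs.continuousAt.eventually_lt continuousAt_const (by linarith)
    obtain ⟨η, hη, h2⟩ := Metric.eventually_nhds_iff.1 h1
    refine ⟨η / 2, by positivity, fun y hy => ?_⟩
    rw [hr]
    simp only
    rw [hfeq y (h2 (by rw [Real.dist_eq]; linarith)).le, sub_self]
  have hmain : Tendsto (fun p : ℝ × ℝ => ∫ ω, f (p.2 + B p.1.toNNReal ω) ∂Q)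
      (𝓝[Ici 0 ×ˢ univ] ((0 : ℝ), x₀)) (𝓝 (g x₀)) := by
    have h1 : Continuous fun p : ℝ × ℝ => ∫ ω, f (p.2 + B p.1.toNNReal ω) ∂Q := by
      refine continuous_of_dominated (bound := fun _ => A) (fun p => ?_) (fun p => ?_)
        (integrable_const A) ?_
      · exact (hfc.measurable.comp ((hm _).const_add _)).aestronglyMeasurable
      · exact Eventually.of_forall fun ω => hfA _
      · refine Eventually.of_forall fun ω => hfc.comp ?_
        have := hcont ω
        have h2 : Continuous fun p : ℝ × ℝ => B p.1.toNNReal ω :=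
          this.comp (continuous_real_toNNReal.comp continuous_fst)
        exact continuous_snd.add h2
    have h2 : ∫ ω, f (x₀ + B (0 : ℝ).toNNReal ω) ∂Q = g x₀ := by
      have h3 : ∀ᵐ ω ∂Q, f (x₀ + B (0 : ℝ).toNNReal ω) = g x₀ := by
        filter_upwards [hB.eval_zero_ae_eq_zero] with ω hω
        rw [Real.toNNReal_zero, hω, add_zero, hfeq x₀ (by linarith)]
      rw [integral_congr_ae h3]
      simp
    have h3 := (h1.tendsto ((0 : ℝ), x₀)).mono_left (nhdsWithin_le_nhds (s := Ici 0 ×ˢ univ))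
    simp only at h3
    rwa [h2] at h3
  have hrem : Tendsto (fun p : ℝ × ℝ => ∫ ω, r (p.2 + B p.1.toNNReal ω) ∂Q)
      (𝓝[Ici 0 ×ˢ univ] ((0 : ℝ), x₀)) (𝓝 0) := by
    have hbd : Tendsto (fun p : ℝ × ℝ => √(2 * √p.1 / d ^ 2 * ∫ y, r y ^ 2))
        (𝓝[Ici 0 ×ˢ univ] ((0 : ℝ), x₀)) (𝓝 0) := by
      have h1 : Continuous fun p : ℝ × ℝ => √(2 * √p.1 / d ^ 2 * ∫ y, r y ^ 2) := by fun_prop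
      have h2 := (h1.tendsto ((0 : ℝ), x₀)).mono_left (nhdsWithin_le_nhds (s := Ici 0 ×ˢ univ))
      simpa using h2
    refine squeeze_zero_norm' ?_ hbd
    have hnear : ∀ᶠ p in 𝓝[Ici 0 ×ˢ univ] ((0 : ℝ), x₀), |p.2 - x₀| < d := by
      have c2 : ∀ᶠ y in 𝓝 x₀, |y - x₀| < d := Metric.ball_mem_nhds x₀ hd
      have d2 : Tendsto Prod.snd (𝓝 ((0 : ℝ), x₀)) (𝓝 x₀) := continuous_snd.tendsto ((0 : ℝ), x₀)
      exact nhdsWithin_le_nhds (d2.eventually c2)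
    filter_upwards [hnear, self_mem_nhdsWithin] with p hp hp0
    rw [Real.norm_eq_abs]
    exact Real.abs_le_sqrt (hB.sq_integral_comp_le hr2 hrc.measurable hd hrd hp0.1 hp)
  have hsum := hmain.add hrem
  rw [add_zero] at hsum
  refine hsum.congr' ?_
  filter_upwards [self_mem_nhdsWithin] with p hp
  have i1 : Integrable (fun ω => f (p.2 + B p.1.toNNReal ω)) Q :=
    Integrable.of_bound (hfc.measurable.comp ((hm _).const_add _)).aestronglyMeasurable A
      (Eventually.of_forall fun ω => hfA _)
  have i2 : Integrable (fun ω => r (p.2 + B p.1.toNNReal ω)) Q :=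
    (hB.memLp_comp hr2 p.2 hp.1).integrable one_le_two
  rw [← integral_add i1 i2]
  simp [hr]

/-- At positive times the Gaussian mean is the zeroth heat moment, hence smooth; the factor
`exp(tσ)` contributes the term `σ u`. Continuity up to time zero comes from `tendsto_integral_comp`.
-/
theorem ProbabilityTheory.IsPreBrownianReal.isClassicalHeatSolution (hB : IsPreBrownianReal B Q)
    (hm : ∀ t, Measurable (B t)) (hcont : ∀ ω, Continuous fun t => B t ω)
    (hg : Continuous g) (hg2 : MemLp g 2 volume) (σ : ℝ) :
    IsClassicalHeatSolution σ g
      (fun t x => (∫ ω, g (x + B t.toNNReal ω) ∂Q) * Real.exp (t * σ)) := by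
  have hpos : ∀ t, 0 < t → ∀ x, ∫ ω, g (x + B t.toNNReal ω) ∂Q = heatMoment g 0 t x := by
    intro t ht x
    rw [(hB.hasLaw_eval t.toNNReal).integral_comp_const_add ht hg2.1]
    simp [heatMoment]
  have hspace : ∀ t, 0 < t → (fun x => (∫ ω, g (x + B t.toNNReal ω) ∂Q) * Real.exp (t * σ)) =
      fun x => heatMoment g 0 t x * Real.exp (t * σ) := fun t ht =>
    funext fun x => by rw [hpos t ht]
  have htime : ∀ t, 0 < t → ∀ x,
      HasDerivAt (fun t => (∫ ω, g (x + B t.toNNReal ω) ∂Q) * Real.exp (t * σ))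
        ((heatMoment g 2 t x / (2 * t ^ 2) - heatMoment g 0 t x / (2 * t)) * Real.exp (t * σ) +
          heatMoment g 0 t x * (Real.exp (t * σ) * σ)) t := by
    intro t ht x
    have h1 := (hasDerivAt_heatMoment_time hg2 ht x).fun_mul
      ((hasDerivAt_mul_const (x := t) σ).exp)
    refine h1.congr_of_eventuallyEq ?_
    filter_upwards [lt_mem_nhds ht] with s hs
    rw [hpos s hs]
  have hzero : ∀ x, (∫ ω, g (x + B (0 : ℝ).toNNReal ω) ∂Q) * Real.exp (0 * σ) = g x := by
    intro x
    have h3 : ∀ᵐ ω ∂Q, g (x + B (0 : ℝ).toNNReal ω) = g x := by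
      filter_upwards [hB.eval_zero_ae_eq_zero] with ω hω
      rw [Real.toNNReal_zero, hω, add_zero]
    rw [integral_congr_ae h3]
    simp
  refine ⟨?_, hzero, fun t ht x => (htime t ht x).differentiableAt, fun t ht => ?_,
    fun t ht x => ?_⟩
  · rintro ⟨t, x⟩ ⟨ht, -⟩
    have hexp : Continuous fun p : ℝ × ℝ => Real.exp (p.1 * σ) := by fun_prop
    rcases (show (0 : ℝ) ≤ t from ht).eq_or_lt with rfl | ht
    · rw [ContinuousWithinAt]
      simp only
      rw [hzero]
      have h1 := (hB.tendsto_integral_comp hm hcont hg hg2 x).mul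
        ((hexp.tendsto ((0 : ℝ), x)).mono_left (nhdsWithin_le_nhds (s := Ici 0 ×ˢ univ)))
      simpa using h1
    · refine ContinuousAt.continuousWithinAt ?_
      have h1 := (continuousAt_heatMoment hg2 0 ht x).mul (hexp.continuousAt (x := (t, x)))
      refine h1.congr ?_
      have d1 : Tendsto Prod.fst (𝓝 (t, x)) (𝓝 t) := continuous_fst.tendsto (t, x)
      filter_upwards [d1.eventually (lt_mem_nhds ht)] with p hp
      simp only [Pi.mul_apply, Function.uncurry, hpos p.1 hp]
  · rw [hspace t ht]
    exact (contDiff_heatMoment hg2 ht 2 0).mul contDiff_const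
  · rw [(htime t ht x).deriv]
    rw [hspace t ht, hpos t ht x]
    have h1 : iteratedDeriv 2 (fun x => heatMoment g 0 t x * Real.exp (t * σ)) x =
        iteratedDeriv 2 (heatMoment g 0 t) x * Real.exp (t * σ) := by
      simp_rw [mul_comm _ (Real.exp (t * σ))]
      exact iteratedDeriv_const_mul_field _ _
    rw [h1, iteratedDeriv_two_heatMoment hg2 ht]
    field_simp

end Brownian
end


/-! ### The homogenization theorem -/

theorem mainTheorem4 {S : Type*} [MeasurableSpace S] (P : Measure S) [IsProbabilityMeasure P]
    {Ω : Type*} [MeasurableSpace Ω] (Q : Measure Ω) [IsProbabilityMeasure Q]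
    (B : ℝ≥0 → Ω → ℝ) (hB : IsBrownianReal B Q)
    (c : ℝ≥0 → ℝ → S → ℝ)
    (hc_meas : Measurable (fun p : ℝ≥0 × ℝ × S => c p.1 p.2.1 p.2.2))
    (hc_bdd : ∃ M : ℝ, ∀ t x s, |c t x s| ≤ M)
    (hc_stat : IsStationaryField c P)
    (hc_cent : ∀ t x, ∫ s, c t x s ∂P = 0)
    (hc_mix : MixingUm c P)
    (α β : ℝ) (hβ : 0 < 2 * β) (hαβ : 2 * β < α)
    (g : ℝ → ℝ) (hg_cont : Continuous g) (hg_L2 : MemLp g 2 volume)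
    (uε : ℝ → ℝ → ℝ → S → ℝ)
    (huε : ∀ ε : ℝ, 0 < ε → ∀ᵐ s ∂P,
      IsMildSolution (rescaledPotential α β (α / 2) ε (fun t x => c t x s)) g
        (fun t x => uε ε t x s))
    (σ : ℝ) (hσ : σ = ∫ r in Ioi (0 : ℝ), fieldCorrelation c P r.toNNReal 0)
    (u : ℝ → ℝ → ℝ)
    (hu : ∀ t x : ℝ, u t x = (∫ ω, g (x + B t.toNNReal ω) ∂Q) * Real.exp (t * σ)) :
    IntegrableOn (fun r : ℝ => fieldCorrelation c P r.toNNReal 0) (Ioi 0) ∧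
    (∀ t x : ℝ, 0 ≤ t → Integrable (fun ω => g (x + B t.toNNReal ω)) Q) ∧
    (∀ t x : ℝ, 0 ≤ t →
      (∀ ε : ℝ, 0 < ε → MemLp (fun s => uε ε t x s) 2 P) ∧
      Tendsto (fun ε : ℝ => eLpNorm (fun s => uε ε t x s - u t x) 2 P) (𝓝[>] 0) (𝓝 0)) ∧
    (∀ t x : ℝ, 0 ≤ t →
      (∀ ε : ℝ, 0 < ε → MemLp (fun s =>
        feynmanKac B Q (rescaledPotential α β (α / 2) ε (fun r y => c r y s)) g t x) 2 P) ∧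
      Tendsto (fun ε : ℝ => eLpNorm (fun s =>
        feynmanKac B Q (rescaledPotential α β (α / 2) ε (fun r y => c r y s)) g t x - u t x) 2 P)
        (𝓝[>] 0) (𝓝 0)) ∧
    IsClassicalHeatSolution σ g u := by
  obtain ⟨M, hM⟩ := hc_bdd
  obtain ⟨φ, h, H, hh, hφ, h1, h2, h3⟩ := exists_isMixingField hc_meas hM hc_stat hc_cent hc_mix
  obtain ⟨B', hm, hcont, hae⟩ := hB.exists_continuous_version
  have hB' : IsPreBrownianReal B' Q := hB.toIsPreBrownianReal.congr fun t => by
    filter_upwards [hae] with ω hω using (hω t).symm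
  have hgB : ∀ t x : ℝ, (fun ω => g (x + B' t.toNNReal ω)) =ᵐ[Q]
      fun ω => g (x + B t.toNNReal ω) := fun t x => by
    filter_upwards [hae] with ω hω
    rw [hω]
  have hu' : u = fun t x => (∫ ω, g (x + B' t.toNNReal ω) ∂Q) * Real.exp (t * σ) := by
    ext t x
    rw [hu, integral_congr_ae (hgB t x)]
  have hw : ∀ t x : ℝ, 0 ≤ t → MemLp (fun ω => g (x + B' t.toNNReal ω)) 2 Q :=
    fun t x ht => hB'.memLp_comp hg_L2 x ht
  have hpath : ∀ (x : ℝ) {T : ℝ → ℝ}, Continuous T →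
      Measurable (Function.uncurry fun (r : ℝ) ω => x + B' (T r).toNNReal ω) := fun x T hT =>
    ((measurable_brownianPath hm hcont).comp
      (((continuous_real_toNNReal.comp hT).measurable.comp measurable_fst).prodMk
        measurable_snd)).const_add x
  refine ⟨H.integrableOn_fieldCorrelation, fun t x ht =>
    ((hw t x ht).integrable one_le_two).congr (hgB t x), fun t x ht => ?_, fun t x ht => ?_, ?_⟩
  · have hrep : ∀ ε : ℝ, 0 < ε → (fun s => uε ε t x s) =ᵐ[P] fun s =>
        ∫ ω, g (x + B' t.toNNReal ω) *
          Real.exp (fieldAction α β ε c (fun r ω => x + B' (t - r).toNNReal ω) t ω s) ∂Q := by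
      intro ε hε
      filter_upwards [huε ε hε] with s hs
      exact H.mildSolution_eq hε hB' hm hcont hg_cont hg_L2 hs ht x
    -- The mild solution sees the path run backwards, so the clock is `t - r`. The representation
    -- holds almost surely for each `ε` separately, which is enough for convergence of norms.
    have hT : Continuous fun r : ℝ => t - r := continuous_const.sub continuous_id
    refine ⟨fun ε hε => (memLp_congr_ae (hrep ε hε)).2 (H.memLp_integral_fieldAction α β hε
      (hpath x hT) t ((hw t x ht).integrable one_le_two)), ?_⟩
    have D := hB'.isDiffusivePair hm hcont x t hT (fun τ hτ => sub_nonneg.2 hτ.2)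
      (fun τ hτ => sub_pos.2 hτ.2) (fun τ τ' => by
        rw [sub_sub_sub_cancel_left, abs_sub_comm])
    refine (H.tendsto_eLpNorm_integral_fieldAction hφ hh h1 h2 h3 hβ hαβ ht D (hpath x hT)
      (hw t x ht)).congr' ?_
    filter_upwards [self_mem_nhdsWithin] with ε hε
    refine eLpNorm_congr_ae ?_
    filter_upwards [hrep ε hε] with s hs
    rw [hs, hu', hσ]
  · have hrep : ∀ ε s, feynmanKac B Q (rescaledPotential α β (α / 2) ε (fun r y => c r y s)) g t x =
        ∫ ω, g (x + B' t.toNNReal ω) *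
          Real.exp (fieldAction α β ε c (fun r ω => x + B' r.toNNReal ω) t ω s) ∂Q := by
      intro ε s
      refine integral_congr_ae ?_
      filter_upwards [hae] with ω hω
      simp only [fieldAction, hω]
    simp only [hrep]
    refine ⟨fun ε hε => H.memLp_integral_fieldAction α β hε
      (hpath x continuous_id) t ((hw t x ht).integrable one_le_two), ?_⟩
    -- For the functional with forward time the same convergence theorem applies with the identity
    -- clock.
    have D := hB'.isDiffusivePair hm hcont x t continuous_id (fun τ hτ => hτ.1)
      (fun τ hτ => hτ.1) (fun τ τ' => rfl)
    have hlim := H.tendsto_eLpNorm_integral_fieldAction hφ hh h1 h2 h3 hβ hαβ ht D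
      (hpath x continuous_id) (hw t x ht)
    rw [hu']
    simp only [hσ]
    exact hlim
  · rw [hu']
    exact hB'.isClassicalHeatSolution hm hcont hg_cont hg_L2 σ
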